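/- All algorithms are randomized word-RAM programs with words of $O(\log n)$ bits; running times are worst-case (they hold for all random choices), and for each input the output is correct with probability at least $2/3$. The Exact Triangle Hypothesis states: for every $\varepsilon>0$ there is a constant $k$ such that no algorithm running in time $O(n^{3-\varepsilon})$ finds, in an $n$-node undirected graph with integer edge weights in $[-n^k,n^k]$, a triangle whose edge weights sum up to $0$ (or reports that there is none). A connectivity oracle for predictable vertex failures consists of three algorithms. The preprocessing algorithm receives an undirected graph $G=(V,E)$ with $n$ vertices and $m$ edges, an integer $d$ with $1\le d\le n$, and a set $\widehat D\subseteq V$ with $|\widehat D|\le d$. The update algorithm then receives the symmetric difference $\widehat D\triangle D$, of size $\eta$, where $D\subseteq V$ is a set of vertices that actually fail, $|D|\le d$. The query algorithm then receives two vertices $u,v\in V\setminus D$ and answers whether they are connected in $G[V\setminus D]$. **Theorem.** Assume the Exact Triangle Hypothesis. Then for no $\varepsilon>0$ is there a connectivity oracle for predictable vertex failures with preprocessing time $O(d^{1-\varepsilon}m)$ or $O(dm^{1-\varepsilon})$ and with update and query times of the form $f(\eta)\cdot n^{o(1)}$, where $f$ is an arbitrary function. This remains true if the preprocessing may additionally take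 $O(n+m)$ time, that is, for preprocessing time $O(d^{1-\varepsilon}m+n+m)$ or $O(dm^{1-\varepsilon}+n+m)$. -/

import Mathlib

open scoped ENNReal symmDiff

/-! ## A randomized word RAM with a step count

A memory state has registers and word-addressed arrays (each program uses finitely many of
either). Programs are built from unit-cost instructions on natural numbers by sequencing,
branching and loops. That the machine has words of `O(log n)` bits is imposed in `RunsWithin`:
no register or array cell, hence no address, ever reaches the bound `B`, which is polynomial in
the size parameter `n` wherever it is used. -/

namespace WordRAM

/-- Binary unit-cost word operations; comparisons return `0` or `1`. -/
inductive Op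
  | add | sub | mul | div | mod | lt | eq | land | lor | xor | shl | shr

def Op.eval : Op → ℕ → ℕ → ℕ
  | .add, a, b => a + b
  | .sub, a, b => a - b
  | .mul, a, b => a * b
  | .div, a, b => a / b
  | .mod, a, b => a % b
  | .lt, a, b => if a < b then 1 else 0
  | .eq, a, b => if a = b then 1 else 0
  | .land, a, b => a &&& b
  | .lor, a, b => a ||| b
  | .xor, a, b => a ^^^ b
  | .shl, a, b => a <<< b
  | .shr, a, b => a >>> b

/-- Programs. Registers and arrays are named by natural numbers. -/
inductive Cmd
  /-- do nothing -/
  | skip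
  /-- `r_x := v` -/
  | const (x v : ℕ)
  /-- `r_x := r_y o r_z` -/
  | op (o : Op) (x y z : ℕ)
  /-- `r_x := A_a[r_y]` (indirect read) -/
  | load (x a y : ℕ)
  /-- `A_a[r_y] := r_x` (indirect write) -/
  | store (a y x : ℕ)
  /-- `r_x :=` a fresh uniformly random element of `{0, ..., r_y}` -/
  | rand (x y : ℕ)
  /-- first `c₁`, then `c₂` -/
  | seq (c₁ c₂ : Cmd)
  /-- if `r_x ≠ 0` then `c₁` else `c₂` -/
  | ite (x : ℕ) (c₁ c₂ : Cmd)
  /-- while `r_x ≠ 0` do `c` -/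
  | while (x : ℕ) (c : Cmd)

structure State where
  reg : ℕ → ℕ
  arr : ℕ → ℕ → ℕ

def State.setReg (s : State) (x v : ℕ) : State :=
  { s with reg := Function.update s.reg x v }

def State.setCell (s : State) (a i v : ℕ) : State :=
  { s with arr := Function.update s.arr a (Function.update (s.arr a) i v) }

/-- Write the list `l` into the cells `0, ..., l.length - 1` of array `a`. -/
def State.writeList (s : State) (a : ℕ) (l : List ℕ) : State :=
  { s with arr := Function.update s.arr a (fun i => (l[i]?).getD (s.arr a i)) }

/-- The memory in which everything is `0`. -/
def State.zero : State := ⟨fun _ => 0, fun _ _ => 0⟩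

/-- All words in memory are smaller than `B`. -/
def State.Bounded (B : ℕ) (s : State) : Prop :=
  (∀ x, s.reg x < B) ∧ ∀ a i, s.arr a i < B

/-- A configuration: the commands still to be executed, and the memory. It is halted when the
list is empty. -/
abbrev Config := List Cmd × State

/-- One step of the machine. -/
noncomputable def step : Config → PMF Config
  | ([], s) => PMF.pure ([], s)
  | (.skip :: k, s) => PMF.pure (k, s)
  | (.const x v :: k, s) => PMF.pure (k, s.setReg x v)
  | (.op o x y z :: k, s) => PMF.pure (k, s.setReg x (o.eval (s.reg y) (s.reg z)))
  | (.load x a y :: k, s) => PMF.pure (k, s.setReg x (s.arr a (s.reg y)))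
  | (.store a y x :: k, s) => PMF.pure (k, s.setCell a (s.reg y) (s.reg x))
  | (.rand x y :: k, s) =>
      (PMF.uniformOfFinset (Finset.range (s.reg y + 1)) Finset.nonempty_range_add_one).map
        fun v => (k, s.setReg x v)
  | (.seq c₁ c₂ :: k, s) => PMF.pure (c₁ :: c₂ :: k, s)
  | (.ite x c₁ c₂ :: k, s) => PMF.pure (if s.reg x ≠ 0 then (c₁ :: k, s) else (c₂ :: k, s))
  | (.while x c :: k, s) =>
      PMF.pure (if s.reg x ≠ 0 then (c :: .while x c :: k, s) else (k, s))

/-- The distribution of the configuration after `t` steps. -/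
noncomputable def runFor : ℕ → Config → PMF Config
  | 0, p => PMF.pure p
  | t + 1, p => (step p).bind (runFor t)

/-- The distribution of the memory after running `c` for `t` steps from memory `s`. -/
noncomputable def exec (c : Cmd) (t : ℕ) (s : State) : PMF State :=
  (runFor t ([c], s)).map Prod.snd

/-- Whatever the random choices, `c` started in memory `s` halts within `t` steps, and all words
in memory stay smaller than `B` throughout. -/
def RunsWithin (c : Cmd) (B t : ℕ) (s : State) : Prop :=
  (∀ t' ≤ t, ∀ p ∈ (runFor t' ([c], s)).support, p.2.Bounded B) ∧
    ∀ p ∈ (runFor t ([c], s)).support, p.1 = []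

end WordRAM

/-! ## The Exact Triangle problem and hypothesis -/

namespace ExactTriangle

open WordRAM

/-- `a, b, c` is a triangle of `G` whose edge weights sum up to `0`. -/
def IsZeroTriangle {n : ℕ} (G : SimpleGraph (Fin n)) (w : Sym2 (Fin n) → ℤ) (a b c : Fin n) :
    Prop :=
  G.Adj a b ∧ G.Adj b c ∧ G.Adj a c ∧ w s(a, b) + w s(b, c) + w s(a, c) = 0

/-- Row-major layout of an `n × n` matrix. -/
def rowMajor {n : ℕ} (M : Fin n → Fin n → ℕ) (p : ℕ) : ℕ :=
  if h : p < n * n then M (Fin.divNat ⟨p, h⟩) (Fin.modNat ⟨p, h⟩) else 0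

open Classical in
/-- The input memory: register `0` holds `n`; arrays `0`, `1`, `2` hold the adjacency matrix, the
positive parts and the negative parts of the edge weights. Everything else is `0`. -/
noncomputable def input {n : ℕ} (G : SimpleGraph (Fin n)) (w : Sym2 (Fin n) → ℤ) : State where
  reg x := if x = 0 then n else 0
  arr a :=
    if a = 0 then rowMajor fun i j => if G.Adj i j then 1 else 0
    else if a = 1 then rowMajor fun i j => if G.Adj i j then (w s(i, j)).toNat else 0
    else if a = 2 then rowMajor fun i j => if G.Adj i j then (-w s(i, j)).toNat else 0
    else fun _ => 0

/-- The memory holds a correct output: either register `0` is `1` and registers `1, 2, 3` hold a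
zero-weight triangle, or register `0` is `0` and there is no such triangle. -/
def CorrectOutput {n : ℕ} (G : SimpleGraph (Fin n)) (w : Sym2 (Fin n) → ℤ) (s : State) : Prop :=
  (s.reg 0 = 1 ∧ ∃ a b c : Fin n, IsZeroTriangle G w a b c ∧
      s.reg 1 = a ∧ s.reg 2 = b ∧ s.reg 3 = c) ∨
    (s.reg 0 = 0 ∧ ¬ ∃ a b c : Fin n, IsZeroTriangle G w a b c)

/-- The randomized program `P` finds zero-weight triangles in `n`-node graphs with integer edge
weights in `[-n ^ k, n ^ k]`, on a word RAM with `O(log n)`-bit words, in time `T n` and with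
error probability at most `1 / 3`. -/
def Solves (k : ℕ) (P : Cmd) (T : ℕ → ℕ) : Prop :=
  ∃ c : ℕ, ∀ (n : ℕ) (G : SimpleGraph (Fin n)) (w : Sym2 (Fin n) → ℤ), 1 ≤ n →
    (∀ e ∈ G.edgeSet, |w e| ≤ (n : ℤ) ^ k) →
      RunsWithin P ((n + 2) ^ c) (T n) (input G w) ∧
      2 / 3 ≤ (exec P (T n) (input G w)).toOuterMeasure {s | CorrectOutput G w s}

/-- The Exact Triangle Hypothesis: for no `ε > 0` can zero-weight triangles in `n`-node graphs
with polynomially bounded integer edge weights be found in time `O(n ^ (3 - ε))`. -/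
def Hypothesis : Prop :=
  ∀ ε : ℝ, 0 < ε → ∃ k : ℕ, ¬ ∃ (P : Cmd) (T : ℕ → ℕ), Solves k P T ∧
    ∃ C : ℝ, ∀ n : ℕ, 1 ≤ n → (T n : ℝ) ≤ C * (n : ℝ) ^ (3 - ε)

end ExactTriangle

/-! ## Connectivity oracles for predictable vertex failures -/

namespace VertexFailure

open WordRAM

/-- The list `E` contains each edge of `G` exactly once, as a pair of endpoints in either order. -/
def IsEdgeList {n : ℕ} (G : SimpleGraph (Fin n)) (E : List (Fin n × Fin n)) : Prop :=
  (E.map fun e => s(e.1, e.2)).Nodup ∧ ∀ e, e ∈ G.edgeSet ↔ e ∈ E.map fun e => s(e.1, e.2)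

/-- The vertices `u` and `v` do not fail and are connected in `G ∖ D = G[V ∖ D]`. -/
def ConnectedAvoiding {n : ℕ} (G : SimpleGraph (Fin n)) (D : Finset (Fin n)) (u v : Fin n) :
    Prop :=
  ∃ (hu : u ∈ {x | x ∉ D}) (hv : v ∈ {x | x ∉ D}),
    (G.induce {x | x ∉ D}).Reachable ⟨u, hu⟩ ⟨v, hv⟩

/-- The memory at the start of the preprocessing phase: registers `0, 1, 2, 3` hold the number `n`
of vertices, the number of edges, `d`, and the size of the predicted set; arrays `0` and `1` hold
the two endpoints of the edges, and array `2` the predicted set. Everything else is `0`. -/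
def preInput {n : ℕ} (E : List (Fin n × Fin n)) (d : ℕ) (P : List (Fin n)) : State :=
  ((((((State.zero.setReg 0 n).setReg 1 E.length).setReg 2 d).setReg 3 P.length).writeList 0
    (E.map fun e => (e.1 : ℕ))).writeList 1 (E.map fun e => (e.2 : ℕ))).writeList 2
    (P.map fun x => (x : ℕ))

/-- The memory at the start of the update phase: the memory `s` left by the preprocessing, with
the size of the symmetric difference in register `0` and its elements in array `3`. -/
def updInput {n : ℕ} (s : State) (Δ : List (Fin n)) : State :=
  (s.setReg 0 Δ.length).writeList 3 (Δ.map fun x => (x : ℕ))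

/-- The memory at the start of the query phase: the memory `s` left by the update, with the two
query vertices in registers `0` and `1`. -/
def qryInput {n : ℕ} (s : State) (u v : Fin n) : State :=
  (s.setReg 0 u).setReg 1 v

/-- The programs for the three phases. -/
structure Oracle where
  pre : Cmd
  upd : Cmd
  qry : Cmd

/-- The distribution of the memory after the three phases, if these take `t₁`, `t₂`, `t₃` steps. -/
noncomputable def Oracle.outcome (O : Oracle) (t₁ t₂ t₃ : ℕ) {n : ℕ} (E : List (Fin n × Fin n))
    (d : ℕ) (P Δ : List (Fin n)) (u v : Fin n) : PMF State :=
  (exec O.pre t₁ (preInput E d P)).bind fun s₁ =>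
    (exec O.upd t₂ (updInput s₁ Δ)).bind fun s₂ => exec O.qry t₃ (qryInput s₂ u v)

/-- `O` is a (randomized) connectivity oracle for predictable vertex failures, on a word RAM with
`O(log n)`-bit words, with preprocessing time `tpre n m d`, update time `tupd n η` and query time
`tqry n η`. It is given an `n`-vertex graph `G` with `m` edges (as an edge list `E`), the bound
`d` and the predicted set `Dhat` (as a list `P`); then the set `D` of vertices that actually fail,
as a list `Δ` of the symmetric difference of `Dhat` and `D`, of size `η`; then two vertices `u`,
`v` outside `D`. The time bounds hold for all random choices, and for each input the answer in
register `0` (`1` for connected, `0` for not connected) is correct with probability at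
least `2 / 3`. -/
def Oracle.IsConnectivityOracle (O : Oracle) (tpre : ℕ → ℕ → ℕ → ℕ) (tupd tqry : ℕ → ℕ → ℕ) :
    Prop :=
  ∃ c : ℕ, ∀ (n : ℕ) (G : SimpleGraph (Fin n)) (E : List (Fin n × Fin n)) (d : ℕ)
    (Dhat : Finset (Fin n)) (P : List (Fin n)),
    IsEdgeList G E → 1 ≤ d → d ≤ n → Dhat.card ≤ d → P.Nodup → P.toFinset = Dhat →
      RunsWithin O.pre ((n + 2) ^ c) (tpre n E.length d) (preInput E d P) ∧
      ∀ (D : Finset (Fin n)) (Δ : List (Fin n)),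
        D.card ≤ d → Δ.Nodup → Δ.toFinset = Dhat ∆ D →
        (∀ s₁ ∈ (exec O.pre (tpre n E.length d) (preInput E d P)).support,
          RunsWithin O.upd ((n + 2) ^ c) (tupd n (Dhat ∆ D).card) (updInput s₁ Δ) ∧
          ∀ s₂ ∈ (exec O.upd (tupd n (Dhat ∆ D).card) (updInput s₁ Δ)).support,
            ∀ u v : Fin n, u ∉ D → v ∉ D →
              RunsWithin O.qry ((n + 2) ^ c) (tqry n (Dhat ∆ D).card) (qryInput s₂ u v)) ∧
        ∀ u v : Fin n, u ∉ D → v ∉ D →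
          2 / 3 ≤ (O.outcome (tpre n E.length d) (tupd n (Dhat ∆ D).card)
              (tqry n (Dhat ∆ D).card) E d P Δ u v).toOuterMeasure
            {s | (ConnectedAvoiding G D u v ∧ s.reg 0 = 1) ∨
              (¬ ConnectedAvoiding G D u v ∧ s.reg 0 = 0)}

/-- The time `t n η` is of the form `f(η) · n ^ o(1)`. -/
def SubpolynomialTime (t : ℕ → ℕ → ℕ) : Prop :=
  ∃ (f h : ℕ → ℝ), Filter.Tendsto h Filter.atTop (nhds 0) ∧
    ∀ n η : ℕ, 1 ≤ n → (t n η : ℝ) ≤ f η * (n : ℝ) ^ h n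

end VertexFailure

/-!
Suppose there is a connectivity oracle with the forbidden running times. It is turned into a program that
solves Exact Triangle in time `O(n ^ (3 - 1 / (2 * r)))`, for an integer `r ≥ 8 / ε`, against the hypothesis.

Let `h` be the integer part of the `r`-th root of `n`. The nodes are divided into groups of `h ^ 2` nodes.
For a group and a modulus `q` of the order of `h ^ 3`, there is a system of sets that has an element
in each of `h ^ 2` slots, one slot per node `c` of the group: the set of a node `a` and a residue `i` contains
the residue of `w(ac) + i`, and the set of a node `b` contains the residue of `-w(bc)`. The set of `a` and
`w(ab)` meets the set of `b` if and only if some triangle `a, b, c` over the group has weight zero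
modulo `q` (`Inst.elem_left_eq_elem_right`). In the bipartite graph of sets and elements, let all the sets
be predicted to fail. If only two of them survive, which is a change of size `2`, then they are connected
if and only if they meet (`SlotGraph.connectedAvoiding_iff`). So one preprocessing and `n ^ 2` updates and
queries answer, for a group, which pairs extend to a triangle of weight zero modulo `q`.

If `q` is random, a nonzero weight is rarely divisible by `q`, because it has few divisors
(`exists_card_divisors_le`). So every answer is wrong with probability at most `1 / 3 + 1 / 15`
(`sum_expect_pairErr_le`). A number of repetitions proportional to `h` and a majority vote make all pairs
correct at once: the potential `∑ (3 / 2) ^ (number of wrong answers)` over all pairs grows only by a factor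
`6 / 5` per repetition in expectation (`Setting.average_mixed_le`), whereas one wrong majority among
`2 * R'` repetitions contributes `(3 / 2) ^ R'`, and `(6 / 5) ^ 2 * (2 / 3) = 24 / 25 < 1`. The potential also
handles that the answers for different pairs depend on each other through the common preprocessing. One
pair with a positive majority is tested against all nodes of the group, so that no wrong triangle is output.
The time is estimated in `exists_total_le`.

The machine-level part has two ingredients. `WP` is a program logic that tracks a time bound, a bound for all
words and an upper bound for the expectation of a function of the final memory. `tr` simulates the programs
of the oracle inside the memory of another program. Since the queries for different pairs all have to
start from the memory after the preprocessing, the simulated memory has two layers whose cells carry time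
stamps, and the upper layer is discarded in constant time by advancing a clock.
-/

namespace WordRAM

/-! ### Expectations -/

/-- The expectation of a nonnegative function under a discrete distribution. -/
noncomputable def expect {α : Type*} (μ : PMF α) (f : α → ℝ≥0∞) : ℝ≥0∞ := ∑' a, μ a * f a

section Expect

variable {α β : Type*}

theorem expect_pure (a : α) (f : α → ℝ≥0∞) : expect (PMF.pure a) f = f a := by
  unfold expect
  rw [tsum_eq_single a]
  · simp
  · intro b hb
    simp [PMF.pure_apply_of_ne _ _ hb]

theorem expect_bind (μ : PMF α) (g : α → PMF β) (f : β → ℝ≥0∞) :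
    expect (μ.bind g) f = expect μ fun a => expect (g a) f := by
  unfold expect
  simp only [PMF.bind_apply, ← ENNReal.tsum_mul_right, ← ENNReal.tsum_mul_left]
  rw [ENNReal.tsum_comm]
  simp only [mul_assoc]

theorem expect_map (μ : PMF α) (g : α → β) (f : β → ℝ≥0∞) :
    expect (μ.map g) f = expect μ fun a => f (g a) := by
  rw [← PMF.bind_pure_comp, expect_bind]
  simp only [Function.comp, expect_pure]

theorem expect_mono (μ : PMF α) {f g : α → ℝ≥0∞} (h : ∀ a ∈ μ.support, f a ≤ g a) :
    expect μ f ≤ expect μ g := by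
  refine ENNReal.tsum_le_tsum fun a => ?_
  by_cases ha : a ∈ μ.support
  · exact mul_le_mul_right (h a ha) _
  · rw [(PMF.apply_eq_zero_iff _ _).2 ha]
    simp

theorem expect_const (μ : PMF α) (c : ℝ≥0∞) : expect μ (fun _ => c) = c := by
  unfold expect
  rw [ENNReal.tsum_mul_right, μ.tsum_coe, one_mul]

theorem expect_add (μ : PMF α) (f g : α → ℝ≥0∞) :
    expect μ (fun a => f a + g a) = expect μ f + expect μ g := by
  unfold expect
  simp only [mul_add]
  exact ENNReal.tsum_add

theorem expect_const_mul (μ : PMF α) (c : ℝ≥0∞) (f : α → ℝ≥0∞) :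
    expect μ (fun a => c * f a) = c * expect μ f := by
  unfold expect
  rw [← ENNReal.tsum_mul_left]
  exact tsum_congr fun a => by ring

theorem expect_finset_sum {ι : Type*} (μ : PMF α) (s : Finset ι) (f : ι → α → ℝ≥0∞) :
    expect μ (fun a => ∑ i ∈ s, f i a) = ∑ i ∈ s, expect μ (f i) := by
  classical
  induction s using Finset.induction_on with
  | empty => simp [expect]
  | insert i s hi ih => simp only [Finset.sum_insert hi, expect_add, ih]

theorem expect_uniform (n : ℕ) (f : ℕ → ℝ≥0∞) :
    expect (PMF.uniformOfFinset (Finset.range (n + 1)) Finset.nonempty_range_add_one) f =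
      (∑ v ∈ Finset.range (n + 1), f v) * ((n + 1 : ℕ) : ℝ≥0∞)⁻¹ := by
  unfold expect
  rw [tsum_eq_sum (s := Finset.range (n + 1))]
  · rw [Finset.sum_mul]
    refine Finset.sum_congr rfl fun v hv => ?_
    rw [PMF.uniformOfFinset_apply_of_mem _ hv, Finset.card_range, mul_comm]
  · intro v hv
    rw [PMF.uniformOfFinset_apply_of_notMem _ hv, zero_mul]

open Classical in
theorem expect_indicator (μ : PMF α) (p : α → Prop) :
    expect μ (fun a => if p a then 1 else 0) = μ.toOuterMeasure {a | p a} := by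
  rw [PMF.toOuterMeasure_apply]
  refine tsum_congr fun a => ?_
  by_cases h : p a <;> simp [Set.indicator, h]

open Classical in
theorem expect_indicator_add_not (μ : PMF α) (p : α → Prop) :
    expect μ (fun a => if p a then 1 else 0) + expect μ (fun a => if ¬ p a then 1 else 0) = 1 := by
  rw [← expect_add]
  refine (congrArg (expect μ) (funext fun a => ?_)).trans (expect_const μ 1)
  by_cases h : p a <;> simp [h]

end Expect

/-! ### Runs that always halt -/

/-- From the configuration `p`, whatever the random choices: all words stay below `B`, the machine
halts within `t` steps, the final memory satisfies `Q`, and the expectation of `f` over the final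
memory is at most `e`. -/
def Good (B t : ℕ) (p : Config) (Q : State → Prop) (f : State → ℝ≥0∞) (e : ℝ≥0∞) : Prop :=
  (∀ t' ≤ t, ∀ p' ∈ (runFor t' p).support, p'.2.Bounded B) ∧
    (∀ p' ∈ (runFor t p).support, p'.1 = [] ∧ Q p'.2) ∧
    expect (runFor t p) (fun p' => f p'.2) ≤ e

theorem runFor_nil (t : ℕ) (s : State) : runFor t ([], s) = PMF.pure ([], s) := by
  induction t with
  | zero => rfl
  | succ t ih => simp [runFor, step, ih]

theorem runFor_succ' (t : ℕ) (p : Config) : runFor (t + 1) p = (runFor t p).bind step := by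
  induction t generalizing p with
  | zero => simp [runFor, PMF.bind_pure]
  | succ t ih =>
    rw [runFor]
    conv_rhs => rw [runFor, PMF.bind_bind]
    congr 1
    funext q
    exact ih q

theorem bind_eq_self_of_support {α : Type*} (μ : PMF α) (g : α → PMF α)
    (h : ∀ a ∈ μ.support, g a = PMF.pure a) : μ.bind g = μ := by
  conv_rhs => rw [← PMF.bind_pure μ]
  ext b
  simp only [PMF.bind_apply]
  refine tsum_congr fun a => ?_
  by_cases ha : a ∈ μ.support
  · rw [h a ha]
  · rw [(PMF.apply_eq_zero_iff _ _).2 ha]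
    simp

theorem runFor_succ_of_halted {t : ℕ} {p : Config} (h : ∀ p' ∈ (runFor t p).support, p'.1 = []) :
    runFor (t + 1) p = runFor t p := by
  rw [runFor_succ']
  refine bind_eq_self_of_support _ _ fun q hq => ?_
  obtain ⟨k, s⟩ := q
  have : k = [] := h _ hq
  subst this
  rfl

theorem Good.halted {B : ℕ} {s : State} {Q : State → Prop} {f : State → ℝ≥0∞} {e : ℝ≥0∞}
    (t : ℕ) (hB : s.Bounded B) (hQ : Q s) (hf : f s ≤ e) : Good B t ([], s) Q f e := by
  refine ⟨fun t' _ p' hp' => ?_, fun p' hp' => ?_, ?_⟩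
  · rw [runFor_nil, PMF.mem_support_pure_iff] at hp'
    subst hp'
    exact hB
  · rw [runFor_nil, PMF.mem_support_pure_iff] at hp'
    subst hp'
    exact ⟨rfl, hQ⟩
  · rw [runFor_nil, expect_pure]
    exact hf

theorem Good.of_step {B t : ℕ} {p : Config} {Q : State → Prop} {f : State → ℝ≥0∞} {e : ℝ≥0∞}
    (e' : Config → ℝ≥0∞) (hB : p.2.Bounded B)
    (h : ∀ p' ∈ (step p).support, Good B t p' Q f (e' p')) (he : expect (step p) e' ≤ e) :
    Good B (t + 1) p Q f e := by
  refine ⟨fun t' ht' p' hp' => ?_, fun p' hp' => ?_, ?_⟩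
  · cases t' with
    | zero =>
      rw [runFor, PMF.mem_support_pure_iff] at hp'
      subst hp'
      exact hB
    | succ t' =>
      rw [runFor, PMF.mem_support_bind_iff] at hp'
      obtain ⟨q, hq, hp'⟩ := hp'
      exact (h q hq).1 t' (by omega) p' hp'
  · rw [runFor, PMF.mem_support_bind_iff] at hp'
    obtain ⟨q, hq, hp'⟩ := hp'
    exact (h q hq).2.1 p' hp'
  · rw [runFor, expect_bind]
    exact (expect_mono _ fun q hq => (h q hq).2.2).trans he

theorem Good.of_step_pure {B t : ℕ} {p p' : Config} {Q : State → Prop} {f : State → ℝ≥0∞}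
    {e : ℝ≥0∞} (hp : step p = PMF.pure p') (hB : p.2.Bounded B) (h : Good B t p' Q f e) :
    Good B (t + 1) p Q f e := by
  refine Good.of_step (fun _ => e) hB (fun q hq => ?_) ?_
  · rw [hp, PMF.mem_support_pure_iff] at hq
    subst hq
    exact h
  · rw [expect_const]

theorem Good.mono {B t t' : ℕ} {p : Config} {Q : State → Prop} {f : State → ℝ≥0∞} {e e' : ℝ≥0∞}
    (h : Good B t p Q f e) (ht : t ≤ t') (he : e ≤ e') : Good B t' p Q f e' := by
  induction ht with
  | refl => exact ⟨h.1, h.2.1, h.2.2.trans he⟩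
  | @step t' _ ih =>
    have hs := runFor_succ_of_halted fun q hq => (ih.2.1 q hq).1
    refine ⟨fun t'' ht'' p' hp' => ?_, ?_, ?_⟩
    · rcases Nat.lt_or_ge t'' (t' + 1) with h1 | h1
      · exact ih.1 t'' (by omega) p' hp'
      · obtain rfl : t'' = t' + 1 := by omega
        rw [hs] at hp'
        exact ih.1 t' le_rfl p' hp'
    · rw [hs]
      exact ih.2.1
    · rw [hs]
      exact ih.2.2

/-! ### Memory updates -/

@[simp] theorem setReg_reg (s : State) (x v y : ℕ) :
    (s.setReg x v).reg y = if y = x then v else s.reg y := by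
  simp [State.setReg, Function.update_apply]

@[simp] theorem setReg_arr (s : State) (x v : ℕ) : (s.setReg x v).arr = s.arr := rfl

@[simp] theorem setCell_reg (s : State) (a i v : ℕ) : (s.setCell a i v).reg = s.reg := rfl

@[simp] theorem setCell_arr (s : State) (a i v b : ℕ) :
    (s.setCell a i v).arr b = if b = a then Function.update (s.arr b) i v else s.arr b := by
  by_cases h : b = a
  · subst h
    simp [State.setCell]
  · simp [State.setCell, h]

theorem State.ext' {s s' : State} (h1 : ∀ x, s.reg x = s'.reg x)
    (h2 : ∀ a i, s.arr a i = s'.arr a i) : s = s' := by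
  cases s
  cases s'
  congr
  · exact funext h1
  · exact funext fun a => funext (h2 a)

theorem Bounded.setReg {B : ℕ} {s : State} (h : s.Bounded B) {x v : ℕ} (hv : v < B) :
    (s.setReg x v).Bounded B := by
  refine ⟨fun y => ?_, h.2⟩
  rw [setReg_reg]
  split_ifs
  · exact hv
  · exact h.1 y

theorem Bounded.setCell {B : ℕ} {s : State} (h : s.Bounded B) {a i v : ℕ} (hv : v < B) :
    (s.setCell a i v).Bounded B := by
  refine ⟨h.1, fun b j => ?_⟩
  rw [setCell_arr]
  split_ifs
  · rw [Function.update_apply]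
    split_ifs
    · exact hv
    · exact h.2 _ _
  · exact h.2 _ _

/-! ### Expressions -/

/-- Expressions over registers and arrays, as an abbreviation for straight-line programs. -/
inductive Expr
  | const (v : ℕ)
  | var (x : ℕ)
  | bin (o : Op) (a b : Expr)
  | load (a : ℕ) (e : Expr)
  | cond (c x y : Expr)

namespace Expr

/-- The value of an expression in a memory state -/
def eval (s : State) : Expr → ℕ
  | const v => v
  | var x => s.reg x
  | bin o a b => o.eval (a.eval s) (b.eval s)
  | load a e => s.arr a (e.eval s)
  | cond c x y => if c.eval s ≠ 0 then x.eval s else y.eval s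

/-- The program that leaves the value of an expression in register `64 + k`. Only the registers
from `64 + k` on are written. -/
def compile : Expr → ℕ → Cmd
  | const v, k => .const (64 + k) v
  | var x, k => .op .land (64 + k) x x
  | bin o a b, k =>
      .seq (a.compile k) (.seq (b.compile (k + 1)) (.op o (64 + k) (64 + k) (64 + (k + 1))))
  | load a e, k => .seq (e.compile k) (.load (64 + k) a (64 + k))
  | cond c x y, k => .seq (c.compile k) (.ite (64 + k) (x.compile k) (y.compile k))

/-- A bound for the number of steps that the compiled expression takes. -/
def cost : Expr → ℕ
  | const _ => 1
  | var _ => 1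
  | bin _ a b => a.cost + b.cost + 3
  | load _ e => e.cost + 2
  | cond c x y => c.cost + x.cost + y.cost + 2

/-- All values that occur in the evaluation are below `B`, and only program variables, that is,
registers below `64`, are read. -/
def Ok (B : ℕ) (s : State) : Expr → Prop
  | const v => v < B
  | var x => x < 64
  | bin o a b => a.Ok B s ∧ b.Ok B s ∧ o.eval (a.eval s) (b.eval s) < B
  | load _ e => e.Ok B s
  | cond c x y => c.Ok B s ∧ x.Ok B s ∧ y.Ok B s

end Expr

/-- The operations whose result is less than the product of any two numbers from `2` on that
exceed the operands. -/
def Op.Tame : Op → Prop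
  | .add | .sub | .mul | .div | .mod | .lt | .eq | .land => True
  | _ => False

namespace Expr

/-- Expressions over program variables with tame operations and constants below `X`. -/
def Tame (X : ℕ) : Expr → Prop
  | const v => v < X
  | var x => x < 64
  | bin o a b => o.Tame ∧ a.Tame X ∧ b.Tame X
  | load _ e => e.Tame X
  | cond c x y => c.Tame X ∧ x.Tame X ∧ y.Tame X

/-- If all words are below `X`, then all values in the evaluation of a tame expression `e` are
below `X ^ e.size`. -/
def size : Expr → ℕ
  | const _ => 1
  | var _ => 1
  | bin _ a b => a.size + b.size
  | load _ e => e.size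
  | cond c x y => c.size + x.size + y.size

theorem size_pos (e : Expr) : 1 ≤ e.size := by
  induction e <;> simp only [size] <;> omega

theorem eval_tame {o : Op} (ho : o.Tame) {a b P Q : ℕ} (hP : 2 ≤ P) (hQ : 2 ≤ Q) (ha : a < P)
    (hb : b < Q) : o.eval a b < P * Q := by
  have hPQ : P ≤ P * Q := Nat.le_mul_of_pos_right _ (by omega)
  have h2 : 2 ≤ P * Q := hP.trans hPQ
  cases o <;> simp only [Op.Tame] at ho <;> simp only [Op.eval]
  · nlinarith
  · omega
  · exact Nat.mul_lt_mul'' ha hb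
  · exact ((Nat.div_le_self a b).trans_lt ha).trans_le hPQ
  · exact ((Nat.mod_le a b).trans_lt ha).trans_le hPQ
  · split_ifs <;> omega
  · split_ifs <;> omega
  · exact (Nat.and_le_left.trans_lt ha).trans_le hPQ

theorem eval_lt_of_tame {X : ℕ} {s : State} (hX : 2 ≤ X) (hs : s.Bounded X) {e : Expr}
    (he : e.Tame X) : e.eval s < X ^ e.size := by
  have key : ∀ e' : Expr, X ≤ X ^ e'.size := fun e' =>
    Nat.le_self_pow (by have := size_pos e'; omega) X
  induction e with
  | const v => simpa [size, eval, Tame] using he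
  | var x => simpa [size, eval] using hs.1 x
  | bin o a b iha ihb =>
    obtain ⟨ho, ha, hb⟩ := he
    simp only [size, eval, pow_add]
    exact eval_tame ho (hX.trans (key a)) (hX.trans (key b)) (iha ha) (ihb hb)
  | load a e ih => exact (hs.2 _ _).trans_le (key e)
  | cond c x y _ ihx ihy =>
    obtain ⟨_, hx, hy⟩ := he
    simp only [eval, size]
    split_ifs
    · exact (ihx hx).trans_le (Nat.pow_le_pow_right (by omega) (by omega))
    · exact (ihy hy).trans_le (Nat.pow_le_pow_right (by omega) (by omega))

theorem ok_of_tame {X B : ℕ} {s : State} (hX : 2 ≤ X) (hs : s.Bounded X) {e : Expr}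
    (he : e.Tame X) (hB : X ^ e.size ≤ B) : e.Ok B s := by
  have sub : ∀ {i j : ℕ}, i ≤ j → X ^ j ≤ B → X ^ i ≤ B := fun hij h =>
    (Nat.pow_le_pow_right (by omega) hij).trans h
  induction e with
  | const v => exact (eval_lt_of_tame hX hs he).trans_le hB
  | var x => exact he
  | bin o a b iha ihb =>
    have h := (eval_lt_of_tame hX hs he).trans_le hB
    obtain ⟨ho, ha, hb⟩ := he
    simp only [size] at hB
    exact ⟨iha ha (sub (by omega) hB), ihb hb (sub (by omega) hB), h⟩
  | load a e ih => exact ih he hB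
  | cond c x y ihc ihx ihy =>
    obtain ⟨hc, hx, hy⟩ := he
    simp only [size] at hB
    exact ⟨ihc hc (sub (by omega) hB), ihx hx (sub (by omega) hB), ihy hy (sub (by omega) hB)⟩

theorem Ok.eval_congr {B : ℕ} {s s' : State} {e : Expr} (he : e.Ok B s) (ha : s'.arr = s.arr)
    (hr : ∀ x < 64, s'.reg x = s.reg x) : e.eval s' = e.eval s := by
  induction e with
  | const v => rfl
  | var x => exact hr x he
  | bin o a b iha ihb => simp only [eval, iha he.1, ihb he.2.1]
  | load a e ih => simp only [eval, ih he, ha]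
  | cond c x y ihc ihx ihy => simp only [eval, ihc he.1, ihx he.2.1, ihy he.2.2]

theorem Ok.congr {B : ℕ} {s s' : State} {e : Expr} (he : e.Ok B s) (ha : s'.arr = s.arr)
    (hr : ∀ x < 64, s'.reg x = s.reg x) : e.Ok B s' := by
  induction e with
  | const v => exact he
  | var x => exact he
  | bin o a b iha ihb =>
    refine ⟨iha he.1, ihb he.2.1, ?_⟩
    rw [he.1.eval_congr ha hr, he.2.1.eval_congr ha hr]
    exact he.2.2
  | load a e ih => exact ih he
  | cond c x y ihc ihx ihy => exact ⟨ihc he.1, ihx he.2.1, ihy he.2.2⟩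

/-- Running a compiled expression: it changes no array and no register below `64 + k`. -/
theorem compile_good {B : ℕ} {e : Expr} {s : State} (he : e.Ok B s) (hB : s.Bounded B) (k : ℕ)
    {kk : List Cmd} {t : ℕ} {Q : State → Prop} {f : State → ℝ≥0∞} {E : ℝ≥0∞}
    (h : ∀ s' : State, s'.Bounded B → s'.arr = s.arr → (∀ y < 64 + k, s'.reg y = s.reg y) →
      s'.reg (64 + k) = e.eval s → Good B t (kk, s') Q f E) :
    Good B (e.cost + t) (e.compile k :: kk, s) Q f E := by
  induction e generalizing s k kk t with
  | const v =>
    rw [cost, add_comm]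
    refine Good.of_step_pure rfl hB (h _ (Bounded.setReg hB he) rfl (fun y hy => ?_) ?_)
    · simp [hy.ne]
    · simp [eval]
  | var x =>
    rw [cost, add_comm]
    have hx : s.reg x &&& s.reg x = s.reg x := Nat.and_self _
    refine Good.of_step_pure rfl hB (h _ (Bounded.setReg hB ?_) rfl (fun y hy => ?_) ?_)
    · simp only [Op.eval, hx]
      exact hB.1 x
    · simp [hy.ne]
    · simp [eval, Op.eval]
  | bin o a b iha ihb =>
    obtain ⟨ha, hb, ho⟩ := he
    have ht : (bin o a b).cost + t = (a.cost + ((b.cost + (t + 1)) + 1)) + 1 := by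
      simp only [cost]
      omega
    rw [ht]
    refine Good.of_step_pure rfl hB (iha ha hB k fun s1 hB1 ha1 hr1 hv1 => ?_)
    refine Good.of_step_pure rfl hB1 ?_
    have hr1' : ∀ x < 64, s1.reg x = s.reg x := fun x hx => hr1 x (by omega)
    refine ihb (hb.congr ha1 hr1') hB1 (k + 1) fun s2 hB2 ha2 hr2 hv2 => ?_
    have hv : o.eval (s2.reg (64 + k)) (s2.reg (64 + (k + 1))) = (bin o a b).eval s := by
      rw [hr2 _ (by omega), hv1, hv2, hb.eval_congr ha1 hr1', eval]
    refine Good.of_step_pure rfl hB2 (h _ (Bounded.setReg hB2 ?_) ?_ (fun y hy => ?_) ?_)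
    · rw [hv]
      exact ho
    · rw [setReg_arr, ha2, ha1]
    · rw [setReg_reg, if_neg hy.ne, hr2 y (by omega), hr1 y hy]
    · rw [setReg_reg, if_pos rfl, hv]
  | load a e ih =>
    have ht : (load a e).cost + t = (e.cost + (t + 1)) + 1 := by
      simp only [cost]
      omega
    rw [ht]
    refine Good.of_step_pure rfl hB (ih he hB k fun s1 hB1 ha1 hr1 hv1 => ?_)
    refine Good.of_step_pure rfl hB1 (h _ (Bounded.setReg hB1 (hB1.2 _ _)) ?_ (fun y hy => ?_) ?_)
    · rw [setReg_arr, ha1]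
    · rw [setReg_reg, if_neg hy.ne, hr1 y hy]
    · rw [setReg_reg, if_pos rfl, hv1, ha1, eval]
  | cond c x y ihc ihx ihy =>
    obtain ⟨hc, hx, hy⟩ := he
    have ht : (cond c x y).cost + t = (c.cost + ((x.cost + y.cost + t) + 1)) + 1 := by
      simp only [cost]
      omega
    rw [ht]
    refine Good.of_step_pure rfl hB (ihc hc hB k fun s1 hB1 ha1 hr1 hv1 => ?_)
    refine Good.of_step_pure rfl hB1 ?_
    have hr1' : ∀ x < 64, s1.reg x = s.reg x := fun x hx => hr1 x (by omega)
    have fin : ∀ s2 : State, s2.Bounded B → s2.arr = s1.arr →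
        (∀ y < 64 + k, s2.reg y = s1.reg y) → s2.reg (64 + k) = (cond c x y).eval s →
        Good B t (kk, s2) Q f E := fun s2 h1 h2 h3 h4 =>
      h s2 h1 (h2.trans ha1) (fun y hy => (h3 y hy).trans (hr1 y hy)) h4
    by_cases h0 : c.eval s ≠ 0
    · rw [if_pos (by rw [hv1]; exact h0)]
      refine Good.mono (ihx (hx.congr ha1 hr1') hB1 k (t := t) fun s2 h1 h2 h3 h4 => ?_)
        (by omega) le_rfl
      exact fin s2 h1 h2 h3 (by rw [h4, hx.eval_congr ha1 hr1', eval, if_pos h0])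
    · rw [if_neg (by rw [hv1]; exact h0)]
      refine Good.mono (ihy (hy.congr ha1 hr1') hB1 k (t := t) fun s2 h1 h2 h3 h4 => ?_)
        (by omega) le_rfl
      exact fin s2 h1 h2 h3 (by rw [h4, hy.eval_congr ha1 hr1', eval, if_neg h0])

end Expr

end WordRAM

namespace WordRAM

/-! ### Program logic with expectations -/

/-- The memory without the scratch registers from `64` on. -/
def State.vars (s : State) : State := ⟨fun x => if x < 64 then s.reg x else 0, s.arr⟩

theorem vars_reg (s : State) {x : ℕ} (hx : x < 64) : s.vars.reg x = s.reg x := if_pos hx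

/-- Judgement on the list `l` of commands to be executed from a memory with program variables and
arrays `σ`. With words below `B` on the machine and below `X` in `σ`, the commands take at most `t`
steps, end in a memory with `Q`, again with words below `X` apart from scratch registers, and the
expectation of `f` over the final memory is at most `e`. It is stated through an arbitrary
continuation `kk`, because the machine may reach the end of `l` at different times for different
random choices. -/
def WP (B X : ℕ) (l : List Cmd) (t : ℕ) (σ : State) (Q : State → Prop) (f : State → ℝ≥0∞)
    (e : ℝ≥0∞) : Prop :=
  σ.Bounded X → ∀ s : State, s.vars = σ → s.Bounded B →
    ∀ (kk : List Cmd) (t' : ℕ) (Q' : State → Prop) (f' : State → ℝ≥0∞),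
      (∀ s' : State, s'.Bounded B → s'.vars.Bounded X → Q s'.vars →
        Good B t' (kk, s') Q' f' (f s'.vars)) →
      Good B (t + t') (l ++ kk, s) Q' f' e

namespace WP

variable {B X t t' : ℕ} {l : List Cmd} {σ : State} {Q Q' : State → Prop} {f f' : State → ℝ≥0∞}
  {e e' : ℝ≥0∞}

theorem intro_bounded (h : σ.Bounded X → WP B X l t σ Q f e) : WP B X l t σ Q f e :=
  fun hσ => h hσ hσ

theorem nil (hQ : Q σ) (he : f σ ≤ e) : WP B X [] t σ Q f e := by
  intro hσ s hs hB kk t' Q' f' h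
  subst hs
  exact (h s hB hσ hQ).mono (by omega) he

theorem mono (h : WP B X l t σ Q f e) (ht : t ≤ t') (hQ : ∀ σ', σ'.Bounded X → Q σ' → Q' σ')
    (hf : ∀ σ', σ'.Bounded X → Q σ' → f' σ' ≤ f σ') (he : e ≤ e') : WP B X l t' σ Q' f' e' := by
  intro hσ s hs hB kk t'' Q'' f'' hk
  refine (h hσ s hs hB kk t'' Q'' f'' fun s' h1 h2 h3 => ?_).mono (by omega) he
  exact (hk s' h1 h2 (hQ _ h2 h3)).mono le_rfl (hf _ h2 h3)

theorem time_mono (h : WP B X l t σ Q f e) (ht : t ≤ t') : WP B X l t' σ Q f e :=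
  h.mono ht (fun _ _ h => h) (fun _ _ _ => le_rfl) le_rfl

theorem le_expect (h : WP B X l t σ Q f e) (he : e ≤ e') : WP B X l t σ Q f e' :=
  h.mono le_rfl (fun _ _ h => h) (fun _ _ _ => le_rfl) he

theorem append {l₁ l₂ : List Cmd} {t₁ t₂ : ℕ} (h₁ : WP B X l₁ t₁ σ Q' f' e)
    (h₂ : ∀ σ', σ'.Bounded X → Q' σ' → WP B X l₂ t₂ σ' Q f (f' σ')) :
    WP B X (l₁ ++ l₂) (t₁ + t₂) σ Q f e := by
  intro hσ s hs hB kk t'' Q'' f'' hk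
  rw [List.append_assoc, add_assoc]
  exact h₁ hσ s hs hB _ _ _ _ fun s' h1 h2 h3 => h₂ _ h2 h3 h2 s' rfl h1 kk t'' Q'' f'' hk

theorem cons {c : Cmd} {t₁ t₂ : ℕ} (h₁ : WP B X [c] t₁ σ Q' f' e)
    (h₂ : ∀ σ', σ'.Bounded X → Q' σ' → WP B X l t₂ σ' Q f (f' σ')) :
    WP B X (c :: l) (t₁ + t₂) σ Q f e :=
  append h₁ h₂

theorem seq {c₁ c₂ : Cmd} (h : WP B X (c₁ :: c₂ :: l) t σ Q f e) :
    WP B X (.seq c₁ c₂ :: l) (1 + t) σ Q f e := by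
  intro hσ s hs hB kk t' Q' f' hk
  have := h hσ s hs hB kk t' Q' f' hk
  rw [show 1 + t + t' = (t + t') + 1 by omega]
  exact Good.of_step_pure rfl hB this

theorem skip (h : WP B X l t σ Q f e) : WP B X (.skip :: l) (1 + t) σ Q f e := by
  intro hσ s hs hB kk t' Q' f' hk
  have := h hσ s hs hB kk t' Q' f' hk
  rw [show 1 + t + t' = (t + t') + 1 by omega]
  exact Good.of_step_pure rfl hB this

end WP

/-- A list of commands as one command. The nesting to the left makes the machine unfold the whole
list before it executes the first of its commands. -/
def block (cs : List Cmd) : Cmd := cs.foldl .seq .skip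

/-- `r_x := e`, for a program variable `x` -/
def assign (x : ℕ) (e : Expr) : Cmd := .seq (e.compile 0) (.op .land x 64 64)

/-- `A_a[i] := e` -/
def put (a : ℕ) (i e : Expr) : Cmd :=
  .seq (i.compile 0) (.seq (e.compile 1) (.store a 64 65))

/-- if `e ≠ 0` then `c₁` else `c₂` -/
def ifte (e : Expr) (c₁ c₂ : Cmd) : Cmd := .seq (e.compile 0) (.ite 64 c₁ c₂)

/-- while `e ≠ 0` do `c` -/
def whileDo (e : Expr) (c : Cmd) : Cmd :=
  .seq (e.compile 0) (.while 64 (.seq c (e.compile 0)))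

/-- `r_i := r_i + 1` -/
def incr (i : ℕ) : Cmd := assign i (.bin .add (.var i) (.const 1))

/-- for `r_i` from `0` to `r_N - 1` do `c` -/
def forTo (i N : ℕ) (c : Cmd) : Cmd :=
  .seq (assign i (.const 0)) (whileDo (.bin .lt (.var i) (.var N)) (.seq c (incr i)))

/-- An expression that can be evaluated in words below `X ^ D` when the variables are below `X`. -/
def Expr.Fits (X D : ℕ) (e : Expr) : Prop := e.Tame X ∧ e.size ≤ D

/-- Compatible bounds `X` for program variables and arrays and `B` for all words. -/
structure Room (B X D : ℕ) : Prop where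
  two_le : 2 ≤ X
  pow_le : X ^ D ≤ B
  pos : 1 ≤ D

theorem Room.le {B X D : ℕ} (h : Room B X D) : X ≤ B :=
  (Nat.le_self_pow (by have := h.pos; omega) X).trans h.pow_le

theorem Expr.Fits.ok {B X D : ℕ} {e : Expr} {s : State} (h : e.Fits X D) (hR : Room B X D)
    (hs : s.Bounded X) : e.Ok B s :=
  Expr.ok_of_tame hR.two_le hs h.1
    ((Nat.pow_le_pow_right (by have := hR.two_le; omega) h.2).trans hR.pow_le)

theorem vars_setReg {s : State} {x v : ℕ} (hx : x < 64) :
    (s.setReg x v).vars = s.vars.setReg x v := by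
  refine State.ext' (fun y => ?_) (fun a i => rfl)
  simp only [State.vars, setReg_reg]
  split_ifs <;> first | rfl | omega

theorem vars_eq {s s' : State} (ha : s'.arr = s.arr) (hr : ∀ y < 64, s'.reg y = s.reg y) :
    s'.vars = s.vars := by
  refine State.ext' (fun y => ?_) (fun a i => ?_)
  · simp only [State.vars]
    split_ifs with h
    · exact hr y h
    · rfl
  · simp only [State.vars, ha]

theorem vars_setCell {s : State} {a i v : ℕ} : (s.setCell a i v).vars = s.vars.setCell a i v :=
  rfl

namespace WP

variable {B X D t t' : ℕ} {l : List Cmd} {σ : State} {Q Q' : State → Prop}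
  {f f' : State → ℝ≥0∞} {e e' : ℝ≥0∞}

theorem block {cs : List Cmd} (h : WP B X (cs ++ l) t σ Q f e) :
    WP B X (block cs :: l) (cs.length + 1 + t) σ Q f e := by
  have key : ∀ (cs : List Cmd) (c : Cmd) (t : ℕ), WP B X (c :: (cs ++ l)) t σ Q f e →
      WP B X (cs.foldl .seq c :: l) (cs.length + t) σ Q f e := by
    intro cs
    induction cs with
    | nil => exact fun c t h => h.time_mono (by simp)
    | cons d cs ih =>
      intro c t h
      exact (ih (.seq c d) _ (seq h)).time_mono (by simp only [List.length_cons]; omega)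
  exact (key cs .skip _ (skip h)).time_mono (by omega)

/-- Running a compiled expression in a memory with program variables `σ` -/
theorem compile_aux {E : Expr} (hE : E.Ok B σ) {s : State}
    (hs : s.vars = σ) (hB : s.Bounded B) {kk : List Cmd} {k : ℕ}
    (h : ∀ s' : State, s'.Bounded B → s'.arr = s.arr → (∀ y < 64 + k, s'.reg y = s.reg y) →
      s'.vars = σ → s'.reg (64 + k) = E.eval σ → Good B t (kk, s') Q f e) :
    Good B (E.cost + t) (E.compile k :: kk, s) Q f e := by
  subst hs
  have hr : ∀ x < 64, s.reg x = s.vars.reg x := fun x hx => (vars_reg s hx).symm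
  refine Expr.compile_good (hE.congr (s' := s) rfl hr) hB k fun s' h1 h2 h3 h4 => ?_
  refine h s' h1 h2 h3 (vars_eq h2 fun y hy => h3 y (by omega)) ?_
  rw [h4]
  exact hE.eval_congr rfl hr

theorem assign_ok (hR : Room B X D) {x : ℕ} (hx : x < 64) {E : Expr}
    (hE : σ.Bounded X → E.Ok B σ) (hv : σ.Bounded X → E.eval σ < X)
    (h : WP B X l t (σ.setReg x (E.eval σ)) Q f e) :
    WP B X (assign x E :: l) (E.cost + 2 + t) σ Q f e := by
  intro hσ s hs hB kk t' Q' f' hk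
  rw [show E.cost + 2 + t + t' = (E.cost + ((t + t') + 1)) + 1 by omega]
  refine Good.of_step_pure rfl hB (compile_aux (hE hσ) hs hB fun s' h1 h2 _ h3 h4 => ?_)
  rw [add_zero] at h4
  have h5 : Op.land.eval (s'.reg 64) (s'.reg 64) = E.eval σ := by
    rw [Op.eval, Nat.and_self, h4]
  refine Good.of_step_pure rfl h1 (h (Bounded.setReg hσ (hv hσ)) _ ?_ ?_ kk t' Q' f' hk)
  · rw [h5, vars_setReg hx, h3]
  · rw [h5]
    exact Bounded.setReg h1 ((hv hσ).trans_le hR.le)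

theorem assign (hR : Room B X D) {x : ℕ} {E : Expr} (hx : x < 64) (hE : E.Fits X D)
    (hv : σ.Bounded X → E.eval σ < X) (h : WP B X l t (σ.setReg x (E.eval σ)) Q f e) :
    WP B X (WordRAM.assign x E :: l) (E.cost + 2 + t) σ Q f e :=
  assign_ok hR hx (fun hσ => hE.ok hR hσ) hv h

theorem put (hR : Room B X D) {a : ℕ} {I E : Expr} (hI : I.Fits X D) (hE : E.Fits X D)
    (hv : σ.Bounded X → E.eval σ < X)
    (h : WP B X l t (σ.setCell a (I.eval σ) (E.eval σ)) Q f e) :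
    WP B X (put a I E :: l) (I.cost + E.cost + 3 + t) σ Q f e := by
  intro hσ s hs hB kk t' Q' f' hk
  rw [show I.cost + E.cost + 3 + t + t' = (I.cost + ((E.cost + ((t + t') + 1)) + 1)) + 1 by omega]
  refine Good.of_step_pure rfl hB
    (compile_aux (hI.ok hR hσ) hs hB fun s1 h1 h2 _ h3 h4 => ?_)
  refine Good.of_step_pure rfl h1
    (compile_aux (hE.ok hR hσ) h3 h1 fun s2 h5 h6 h7 h8 h9 => ?_)
  rw [add_zero] at h4
  have h10 : s2.reg 64 = I.eval σ := (h7 64 (by norm_num)).trans h4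
  have h11 : s2.reg 65 = E.eval σ := h9
  refine Good.of_step_pure rfl h5 (h (Bounded.setCell hσ (hv hσ)) _ ?_ ?_ kk t' Q' f' hk)
  · rw [vars_setCell, h10, h11, h8]
  · rw [h11]
    exact Bounded.setCell h5 ((hv hσ).trans_le hR.le)

theorem ifte (hR : Room B X D) {E : Expr} {c₁ c₂ : Cmd} (hE : E.Fits X D)
    (h₁ : E.eval σ ≠ 0 → WP B X (c₁ :: l) t σ Q f e)
    (h₂ : E.eval σ = 0 → WP B X (c₂ :: l) t σ Q f e) :
    WP B X (ifte E c₁ c₂ :: l) (E.cost + 2 + t) σ Q f e := by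
  intro hσ s hs hB kk t' Q' f' hk
  rw [show E.cost + 2 + t + t' = (E.cost + ((t + t') + 1)) + 1 by omega]
  refine Good.of_step_pure rfl hB
    (compile_aux (hE.ok hR hσ) hs hB fun s1 h1 h2 _ h3 h4 => ?_)
  rw [add_zero] at h4
  refine Good.of_step_pure rfl h1 ?_
  by_cases h0 : E.eval σ = 0
  · rw [if_neg (by rw [h4]; simpa using h0)]
    exact h₂ h0 hσ s1 h3 h1 kk t' Q' f' hk
  · rw [if_pos (by rw [h4]; exact h0)]
    exact h₁ h0 hσ s1 h3 h1 kk t' Q' f' hk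

theorem rand (hR : Room B X D) {x y : ℕ} (hx : x < 64) (hy : y < 64) (E : ℕ → ℝ≥0∞)
    (h : ∀ v ≤ σ.reg y, WP B X l t (σ.setReg x v) Q f (E v))
    (he : (∑ v ∈ Finset.range (σ.reg y + 1), E v) * ((σ.reg y + 1 : ℕ) : ℝ≥0∞)⁻¹ ≤ e) :
    WP B X (.rand x y :: l) (1 + t) σ Q f e := by
  intro hσ s hs hB kk t' Q' f' hk
  subst hs
  rw [show 1 + t + t' = (t + t') + 1 by omega]
  have hyr := vars_reg s hy
  rw [hyr] at h he
  refine Good.of_step (fun p => E (p.2.reg x)) hB (fun p hp => ?_) ?_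
  · rw [List.cons_append, step, PMF.mem_support_map_iff] at hp
    obtain ⟨v, hv, rfl⟩ := hp
    rw [PMF.mem_support_uniformOfFinset_iff, Finset.mem_range] at hv
    have hvX : v < X := by
      have := hσ.1 y
      rw [hyr] at this
      omega
    have hr : (s.setReg x v).reg x = v := by simp
    dsimp only
    rw [hr]
    exact h v (by omega) (Bounded.setReg hσ hvX) _ (vars_setReg hx)
      (Bounded.setReg hB (hvX.trans_le hR.le)) kk t' Q' f' hk
  · rw [List.cons_append, step, expect_map]
    simp only [setReg_reg, if_true]
    rw [expect_uniform]
    exact he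

/-- A loop whose condition is about to be evaluated and holds -/
theorem while_true (hR : Room B X D) {E : Expr} {c : Cmd} (hE : E.Fits X D) (h0 : E.eval σ ≠ 0)
    (h : WP B X (c :: E.compile 0 :: .while 64 (.seq c (E.compile 0)) :: l) t σ Q f e) :
    WP B X (E.compile 0 :: .while 64 (.seq c (E.compile 0)) :: l) (E.cost + 2 + t) σ Q f e := by
  intro hσ s hs hB kk t' Q' f' hk
  rw [show E.cost + 2 + t + t' = E.cost + (((t + t') + 1) + 1) by omega]
  refine compile_aux (hE.ok hR hσ) hs hB fun s1 h1 _ _ h3 h4 => ?_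
  rw [add_zero] at h4
  refine Good.of_step_pure
    (p' := (.seq c (E.compile 0) :: .while 64 (.seq c (E.compile 0)) :: (l ++ kk), s1)) ?_ h1 ?_
  · simp [step, h4, h0]
  · exact Good.of_step_pure rfl h1 (h hσ s1 h3 h1 kk t' Q' f' hk)

/-- A loop whose condition is about to be evaluated and fails -/
theorem while_false (hR : Room B X D) {E : Expr} {c : Cmd} (hE : E.Fits X D) (h0 : E.eval σ = 0)
    (h : WP B X l t σ Q f e) :
    WP B X (E.compile 0 :: .while 64 (.seq c (E.compile 0)) :: l) (E.cost + 1 + t) σ Q f e := by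
  intro hσ s hs hB kk t' Q' f' hk
  rw [show E.cost + 1 + t + t' = E.cost + ((t + t') + 1) by omega]
  refine compile_aux (hE.ok hR hσ) hs hB fun s1 h1 _ _ h3 h4 => ?_
  rw [add_zero] at h4
  refine Good.of_step_pure (p' := (l ++ kk, s1)) ?_ h1 (h hσ s1 h3 h1 kk t' Q' f' hk)
  simp [step, h4, h0]

theorem incr (hR : Room B X D) {i : ℕ} (hD : 2 ≤ D) (hi : i < 64)
    (hv : σ.Bounded X → σ.reg i + 1 < X) (h : WP B X l t (σ.setReg i (σ.reg i + 1)) Q f e) :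
    WP B X (incr i :: l) (7 + t) σ Q f e :=
  assign hR hi ⟨⟨trivial, hi, by have := hR.two_le; simp only [Expr.Tame]; omega⟩, hD⟩ hv h

/-- A counting loop with invariant `I` and potential `Φ`, both of which may depend on the number of
rounds done: if in each round the potential does not increase in expectation, then neither does it
over the whole loop. -/
theorem forTo (hR : Room B X D) (hD : 2 ≤ D) {i N : ℕ} {c : Cmd} (hi : i < 64) (hN : N < 64)
    (cnt tb : ℕ) (I : ℕ → State → Prop) (Φ : ℕ → State → ℝ≥0∞)
    (hI : ∀ j ≤ cnt, ∀ σ', I j σ' → σ'.reg i = j ∧ σ'.reg N = cnt)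
    (h0 : I 0 (σ.setReg i 0)) (hΦ : Φ 0 (σ.setReg i 0) ≤ e)
    (hbody : ∀ j < cnt, ∀ σ', σ'.Bounded X → I j σ' →
      WP B X [c, WordRAM.incr i] tb σ' (I (j + 1)) (Φ (j + 1)) (Φ j σ'))
    (hexit : ∀ σ', σ'.Bounded X → I cnt σ' → WP B X l t σ' Q f (Φ cnt σ')) :
    WP B X (forTo i N c :: l) (cnt * (tb + 8) + 15 + t) σ Q f e := by
  have hX := hR.two_le
  set C : Expr := .bin .lt (.var i) (.var N) with hC
  have hCf : C.Fits X D := ⟨⟨trivial, hi, hN⟩, hD⟩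
  have hCv : ∀ j ≤ cnt, ∀ σ', I j σ' → C.eval σ' = if j < cnt then 1 else 0 := by
    intro j hj σ' h
    obtain ⟨h1, h2⟩ := hI j hj σ' h
    simp [hC, Expr.eval, Op.eval, h1, h2]
  -- the loop from round `cnt - r` on, with the condition still to be evaluated
  have loop : ∀ r ≤ cnt, ∀ σ', σ'.Bounded X → I (cnt - r) σ' →
      WP B X (C.compile 0 :: .while 64 (.seq (.seq c (WordRAM.incr i)) (C.compile 0)) :: l)
        (r * (tb + 8) + 6 + t) σ' Q f (Φ (cnt - r) σ') := by
    intro r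
    induction r with
    | zero =>
      intro _ σ' hσ' hIσ
      have hc := hCv _ (Nat.sub_le _ _) _ hIσ
      rw [if_neg (by omega)] at hc
      exact (while_false hR hCf hc (hexit σ' hσ' hIσ)).time_mono (by simp [hC, Expr.cost])
    | succ r ih =>
      intro hr σ' hσ' hIσ
      have hc := hCv _ (Nat.sub_le _ _) _ hIσ
      rw [if_pos (by omega)] at hc
      have hj : cnt - (r + 1) + 1 = cnt - r := by omega
      have hb := hbody (cnt - (r + 1)) (by omega) σ' hσ' hIσ
      rw [hj] at hb
      have h2 : WP B X ([c, WordRAM.incr i] ++ (C.compile 0 ::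
          .while 64 (.seq (.seq c (WordRAM.incr i)) (C.compile 0)) :: l))
          (tb + (r * (tb + 8) + 6 + t)) σ' Q f (Φ (cnt - (r + 1)) σ') :=
        append hb fun σ'' h1 h2 => ih (by omega) σ'' h1 h2
      refine (while_true hR hCf (by omega) (seq h2)).time_mono ?_
      have : (r + 1) * (tb + 8) = r * (tb + 8) + tb + 8 := by ring
      simp only [hC, Expr.cost]
      omega
  refine (seq (assign hR hi ⟨?_, ?_⟩ (fun _ => ?_) (seq ((intro_bounded fun hσ =>
    loop cnt le_rfl _ hσ ?_).le_expect ?_)))).time_mono ?_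
  · simp only [Expr.Tame]
    omega
  · simp only [Expr.size]
    omega
  · simp only [Expr.eval]
    omega
  · rw [Nat.sub_self]
    exact h0
  · rw [Nat.sub_self]
    exact hΦ
  · simp only [Expr.cost]
    omega

end WP

end WordRAM

namespace WordRAM

/-! ### Stamped memory layers -/

/-- The array that holds the values of the simulated array `α` in one of two layers. The layer
`false` is written during the preprocessing phase, the layer `true` afterwards. -/
def valArr (b : Bool) (α : ℕ) : ℕ := (if b then 12 else 10) + 4 * α

/-- The array that holds the stamps of the simulated array `α` in one of two layers. A cell of
a layer counts as written only if its stamp is the current value of the clock of the layer, so that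
a layer is cleared by advancing the clock. -/
def stampArr (b : Bool) (α : ℕ) : ℕ := (if b then 13 else 11) + 4 * α

/-- The register that holds the clock of a layer. -/
def clk (b : Bool) : ℕ := if b then 59 else 58

/-- Cell `i` of the simulated array `α`, as seen in the lower layer alone -/
def lower (σ : State) (α i : ℕ) : ℕ :=
  if σ.arr (stampArr false α) i = σ.reg (clk false) then σ.arr (valArr false α) i else 0

/-- Cell `i` of the simulated array `α`: the upper layer hides the lower layer. -/
def lay (σ : State) (α i : ℕ) : ℕ :=
  if σ.arr (stampArr true α) i = σ.reg (clk true) then σ.arr (valArr true α) i else lower σ α i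

/-- A memory from a family of arrays: array `0` stands for the registers. -/
def ofLay (L : ℕ → ℕ → ℕ) : State := ⟨L 0, fun a => L (a + 1)⟩

/-- The simulated memory -/
def view (σ : State) : State := ofLay (lay σ)

/-- The expression for a cell of the simulated memory -/
def layE (α : ℕ) (e : Expr) : Expr :=
  .cond (.bin .eq (.load (stampArr true α) e) (.var (clk true))) (.load (valArr true α) e)
    (.cond (.bin .eq (.load (stampArr false α) e) (.var (clk false))) (.load (valArr false α) e)
      (.const 0))

theorem eval_layE (σ : State) (α : ℕ) (e : Expr) : (layE α e).eval σ = lay σ α (e.eval σ) := by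
  simp only [layE, Expr.eval, Op.eval, lay, lower]
  by_cases h1 : σ.arr (stampArr true α) (e.eval σ) = σ.reg (clk true)
  · simp [h1]
  · by_cases h2 : σ.arr (stampArr false α) (e.eval σ) = σ.reg (clk false)
    · simp [h1, h2]
    · simp [h1, h2]

theorem size_layE (α : ℕ) (e : Expr) : (layE α e).size = 4 * e.size + 3 := by
  simp only [layE, Expr.size]
  ring

theorem cost_layE (α : ℕ) (e : Expr) : (layE α e).cost = 4 * e.cost + 21 := by
  simp only [layE, Expr.cost]
  ring

theorem tame_layE {X : ℕ} (hX : 2 ≤ X) (α : ℕ) {e : Expr} (he : e.Tame X) :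
    (layE α e).Tame X := by
  simp only [layE, Expr.Tame, Op.Tame, clk, he]
  simp
  omega

/-- Cell `i` of the simulated array `α` becomes `e` in layer `b`. -/
def write (b : Bool) (α : ℕ) (i e : Expr) : Cmd :=
  .seq (i.compile 0) (.seq (e.compile 1)
    (.seq (.store (valArr b α) 64 65) (.store (stampArr b α) 64 (clk b))))

/-- What writing in layer `b` leaves unchanged -/
structure Frame (b : Bool) (σ σ' : State) : Prop where
  reg : ∀ x < 60, σ'.reg x = σ.reg x
  arr : ∀ a < 10, σ'.arr a = σ.arr a
  other_val : ∀ α, σ'.arr (valArr (!b) α) = σ.arr (valArr (!b) α)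
  other_stamp : ∀ α, σ'.arr (stampArr (!b) α) = σ.arr (stampArr (!b) α)
  stamp : (∀ α i, σ.arr (stampArr b α) i ≤ σ.reg (clk b)) →
    ∀ α i, σ'.arr (stampArr b α) i ≤ σ'.reg (clk b)

theorem Frame.refl (b : Bool) (σ : State) : Frame b σ σ :=
  ⟨fun _ _ => rfl, fun _ _ => rfl, fun _ => rfl, fun _ => rfl, fun h => h⟩

theorem Frame.trans {b : Bool} {σ σ' σ'' : State} (h : Frame b σ σ') (h' : Frame b σ' σ'') :
    Frame b σ σ'' :=
  ⟨fun x hx => (h'.reg x hx).trans (h.reg x hx), fun a ha => (h'.arr a ha).trans (h.arr a ha),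
    fun α => (h'.other_val α).trans (h.other_val α),
    fun α => (h'.other_stamp α).trans (h.other_stamp α), fun hs => h'.stamp (h.stamp hs)⟩

theorem Frame.setReg (b : Bool) (σ : State) {x v : ℕ} (hx : 60 ≤ x) :
    Frame b σ (σ.setReg x v) :=
  ⟨fun y hy => by rw [setReg_reg, if_neg (by omega)], fun _ _ => rfl, fun _ => rfl, fun _ => rfl,
    fun h α i => by
      have : clk b < 60 := by cases b <;> simp [clk]
      rw [setReg_arr, setReg_reg, if_neg (by omega)]
      exact h α i⟩

theorem Frame.lower_eq {σ σ' : State} (h : Frame true σ σ') : lower σ' = lower σ := by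
  funext α i
  have h1 := h.other_val α
  have h2 := h.other_stamp α
  simp only [Bool.not_true] at h1 h2
  rw [lower, lower, h1, h2, h.reg _ (by simp [clk])]

/-- Layer `b` is the one where writing takes effect: it is the upper layer, or the upper layer is
empty. -/
def Ready (b : Bool) (σ : State) : Prop :=
  b = true ∨ ∀ α i, σ.arr (stampArr true α) i ≠ σ.reg (clk true)

theorem Frame.ready {b : Bool} {σ σ' : State} (h : Frame b σ σ') (hr : Ready b σ) :
    Ready b σ' := by
  rcases hr with rfl | hr
  · exact Or.inl rfl
  · cases b with
    | true => exact Or.inl rfl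
    | false =>
      refine Or.inr fun α i => ?_
      have := h.other_stamp α
      simp only [Bool.not_false] at this
      rw [this, h.reg _ (by simp [clk])]
      exact hr α i

theorem setReg_view {σ : State} {x v : ℕ} (hx : 60 ≤ x) : view (σ.setReg x v) = view σ := by
  have h1 : clk true ≠ x := by simp only [clk, if_true]; omega
  have h2 : clk false ≠ x := by simp [clk]; omega
  simp only [view]
  congr 1
  funext α i
  simp only [lay, lower, setReg_arr, setReg_reg, if_neg h1, if_neg h2]

/-- The memory after a cell of the simulated memory is written -/
def written (b : Bool) (σ : State) (α i v : ℕ) : State :=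
  (σ.setCell (valArr b α) i v).setCell (stampArr b α) i (σ.reg (clk b))

theorem frame_written (b : Bool) (σ : State) (α i v : ℕ) : Frame b σ (written b σ α i v) := by
  refine ⟨fun _ _ => rfl, fun a ha => ?_, fun β => ?_, fun β => ?_, fun h β j => ?_⟩
  · have h1 : a ≠ stampArr b α := by cases b <;> simp [stampArr] <;> omega
    have h2 : a ≠ valArr b α := by cases b <;> simp [valArr] <;> omega
    simp only [written, setCell_arr, if_neg h1, if_neg h2]
  · have h1 : valArr (!b) β ≠ stampArr b α := by cases b <;> simp [stampArr, valArr] <;> omega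
    have h2 : valArr (!b) β ≠ valArr b α := by cases b <;> simp [valArr] <;> omega
    simp only [written, setCell_arr, if_neg h1, if_neg h2]
  · have h1 : stampArr (!b) β ≠ stampArr b α := by cases b <;> simp [stampArr] <;> omega
    have h2 : stampArr (!b) β ≠ valArr b α := by cases b <;> simp [stampArr, valArr] <;> omega
    simp only [written, setCell_arr, if_neg h1, if_neg h2]
  · have h2 : stampArr b β ≠ valArr b α := by cases b <;> simp [stampArr, valArr] <;> omega
    simp only [written, setCell_arr, if_neg h2, setCell_reg]
    split_ifs
    · rw [Function.update_apply]
      split_ifs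
      · exact le_rfl
      · exact h β j
    · exact h β j

theorem lay_written {b : Bool} {σ : State} (hr : Ready b σ) (α i v β j : ℕ) :
    lay (written b σ α i v) β j = if β = α ∧ j = i then v else lay σ β j := by
  have e1 : ∀ b', stampArr b' β = stampArr b' α ↔ β = α := fun b' => by
    simp only [stampArr]; omega
  have e2 : ∀ b', valArr b' β = valArr b' α ↔ β = α := fun b' => by
    simp only [valArr]; omega
  have e3 : ∀ b' b'', valArr b' β ≠ stampArr b'' α := fun b' b'' => by
    cases b' <;> cases b'' <;> simp [stampArr, valArr] <;> omega
  have e4 : ∀ b' b'', stampArr b' β ≠ valArr b'' α := fun b' b'' => by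
    cases b' <;> cases b'' <;> simp [stampArr, valArr] <;> omega
  have e5 : ∀ b', stampArr (!b') β ≠ stampArr b' α := fun b' => by
    cases b' <;> simp [stampArr] <;> omega
  have e6 : ∀ b', valArr (!b') β ≠ valArr b' α := fun b' => by
    cases b' <;> simp [valArr] <;> omega
  cases b with
  | true =>
    have e5' := e5 true
    have e6' := e6 true
    simp only [Bool.not_true] at e5' e6'
    simp only [lay, lower, written, setCell_arr, setCell_reg, e1, e2, e3, e4, e5', e6', if_false]
    by_cases h1 : β = α
    · subst h1
      by_cases h2 : j = i
      · subst h2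
        simp
      · simp [h2]
    · simp [h1]
  | false =>
    have hr' : ∀ α i, σ.arr (stampArr true α) i ≠ σ.reg (clk true) := by
      rcases hr with h | h
      · exact absurd h (by simp)
      · exact h
    have e5' := e5 false
    have e6' := e6 false
    simp only [Bool.not_false] at e5' e6'
    simp only [lay, lower, written, setCell_arr, setCell_reg, e1, e2, e3, e4, e5', e6', if_false,
      hr']
    by_cases h1 : β = α
    · subst h1
      by_cases h2 : j = i
      · subst h2
        simp
      · simp [h2]
    · simp [h1]

theorem view_written_reg {b : Bool} {σ : State} (hr : Ready b σ) (x v : ℕ) :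
    view (written b σ 0 x v) = (view σ).setReg x v := by
  refine State.ext' (fun y => ?_) (fun a i => ?_)
  · simp only [view, ofLay, lay_written hr, setReg_reg, true_and]
  · simp only [view, ofLay, lay_written hr, setReg_arr]
    simp

theorem view_written_cell {b : Bool} {σ : State} (hr : Ready b σ) (a i v : ℕ) :
    view (written b σ (a + 1) i v) = (view σ).setCell a i v := by
  refine State.ext' (fun y => ?_) (fun a' i' => ?_)
  · simp only [view, ofLay, lay_written hr, setCell_reg]
    simp
  · simp only [view, ofLay, lay_written hr, setCell_arr]
    by_cases h : a' = a
    · subst h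
      simp [Function.update_apply]
    · simp [h]

namespace WP

variable {B X D t : ℕ} {l : List Cmd} {σ : State} {Q : State → Prop} {f : State → ℝ≥0∞}
  {e : ℝ≥0∞}

theorem write (hR : Room B X D) {b : Bool} {α : ℕ} {I E : Expr} (hI : I.Fits X D)
    (hE : σ.Bounded X → E.Ok B σ) (hv : σ.Bounded X → E.eval σ < X)
    (h : WP B X l t (written b σ α (I.eval σ) (E.eval σ)) Q f e) :
    WP B X (write b α I E :: l) (I.cost + E.cost + 5 + t) σ Q f e := by
  intro hσ s hs hB kk t' Q' f' hk
  rw [show I.cost + E.cost + 5 + t + t' =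
    (I.cost + ((E.cost + (((t + t') + 1) + 1 + 1)) + 1)) + 1 by omega]
  refine Good.of_step_pure rfl hB (compile_aux (hI.ok hR hσ) hs hB fun s1 h1 h2 _ h3 h4 => ?_)
  refine Good.of_step_pure rfl h1 (compile_aux (hE hσ) h3 h1 fun s2 h5 h6 h7 h8 h9 => ?_)
  rw [add_zero] at h4
  have h10 : s2.reg 64 = I.eval σ := (h7 64 (by norm_num)).trans h4
  have h11 : s2.reg 65 = E.eval σ := h9
  have hc : clk b < 64 := by cases b <;> simp [clk]
  have h12 : s2.reg (clk b) = σ.reg (clk b) := by rw [← h8, vars_reg _ hc]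
  have hclk : σ.reg (clk b) < X := hσ.1 _
  refine Good.of_step_pure rfl h5 ?_
  have h13 : (s2.setCell (valArr b α) (s2.reg 64) (s2.reg 65)).Bounded B := by
    rw [h11]
    exact Bounded.setCell h5 ((hv hσ).trans_le hR.le)
  refine Good.of_step_pure rfl h5 (Good.of_step_pure rfl h13
    (h (Bounded.setCell (Bounded.setCell hσ (hv hσ)) hclk) _ ?_ ?_ kk t' Q' f' hk))
  · rw [setCell_reg, vars_setCell, vars_setCell, h10, h11, h12, h8, written]
  · rw [setCell_reg, h12]
    exact Bounded.setCell h13 (hclk.trans_le hR.le)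

end WP

/-! ### Simulation of programs on a stamped layer -/

/-- The expression for a simulated register -/
def rd (x : ℕ) : Expr := layE 0 (.const x)

/-- The simulation of a program with writes in layer `b` -/
def tr (b : Bool) : Cmd → Cmd
  | .skip => .skip
  | .const x v => write b 0 (.const x) (.const v)
  | .op o x y z => write b 0 (.const x) (.bin o (rd y) (rd z))
  | .load x a y => write b 0 (.const x) (layE (a + 1) (rd y))
  | .store a y x => write b (a + 1) (rd y) (rd x)
  | .rand x y => block [assign 60 (rd y), .rand 60 60, write b 0 (.const x) (.var 60)]
  | .seq c₁ c₂ => .seq (tr b c₁) (tr b c₂)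
  | .ite x c₁ c₂ => ifte (rd x) (tr b c₁) (tr b c₂)
  | .while x c => whileDo (rd x) (tr b c)

/-- All registers that a program mentions are below `X`. -/
def NamesLt (X : ℕ) : Cmd → Prop
  | .skip => True
  | .const x _ => x < X
  | .op _ x y z => x < X ∧ y < X ∧ z < X
  | .load x _ y => x < X ∧ y < X
  | .store _ y x => x < X ∧ y < X
  | .rand x y => x < X ∧ y < X
  | .seq c₁ c₂ => NamesLt X c₁ ∧ NamesLt X c₂
  | .ite x c₁ c₂ => x < X ∧ NamesLt X c₁ ∧ NamesLt X c₂
  | .while x c => x < X ∧ NamesLt X c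

theorem NamesLt.mono {X Y : ℕ} (h : X ≤ Y) {c : Cmd} (hc : NamesLt X c) : NamesLt Y c := by
  induction c with
  | skip => trivial
  | const x v => exact lt_of_lt_of_le hc h
  | op o x y z => exact ⟨hc.1.trans_le h, hc.2.1.trans_le h, hc.2.2.trans_le h⟩
  | load x a y => exact ⟨hc.1.trans_le h, hc.2.trans_le h⟩
  | store a y x => exact ⟨hc.1.trans_le h, hc.2.trans_le h⟩
  | rand x y => exact ⟨hc.1.trans_le h, hc.2.trans_le h⟩
  | seq c₁ c₂ h1 h2 => exact ⟨h1 hc.1, h2 hc.2⟩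
  | ite x c₁ c₂ h1 h2 => exact ⟨hc.1.trans_le h, h1 hc.2.1, h2 hc.2.2⟩
  | _ x c h1 => exact ⟨hc.1.trans_le h, h1 hc.2⟩

theorem exists_namesLt (c : Cmd) : ∃ X, NamesLt X c := by
  induction c with
  | skip => exact ⟨0, trivial⟩
  | const x v => exact ⟨x + 1, Nat.lt_succ_self x⟩
  | op o x y z => exact ⟨x + y + z + 1, by simp only [NamesLt]; omega⟩
  | load x a y => exact ⟨x + y + 1, by simp only [NamesLt]; omega⟩
  | store a y x => exact ⟨x + y + 1, by simp only [NamesLt]; omega⟩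
  | rand x y => exact ⟨x + y + 1, by simp only [NamesLt]; omega⟩
  | seq c₁ c₂ h1 h2 =>
    obtain ⟨X, hX⟩ := h1
    obtain ⟨Y, hY⟩ := h2
    exact ⟨X + Y, hX.mono (by omega), hY.mono (by omega)⟩
  | ite x c₁ c₂ h1 h2 =>
    obtain ⟨X, hX⟩ := h1
    obtain ⟨Y, hY⟩ := h2
    exact ⟨X + Y + x + 1, by omega, hX.mono (by omega), hY.mono (by omega)⟩
  | _ x c h1 =>
    obtain ⟨X, hX⟩ := h1
    exact ⟨X + x + 1, by omega, hX.mono (by omega)⟩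

/-- The stack of commands of the simulating machine against the stack of the simulated machine.
At a loop, either the whole loop or the evaluation of its condition is still ahead. -/
inductive Rel (b : Bool) : List Cmd → List Cmd → Prop
  | nil : Rel b [] []
  | cons (c : Cmd) {k k' : List Cmd} : Rel b k k' → Rel b (c :: k) (tr b c :: k')
  | loop (x : ℕ) (c : Cmd) {k k' : List Cmd} : Rel b k k' →
      Rel b (.while x c :: k)
        ((rd x).compile 0 :: .while 64 (.seq (tr b c) ((rd x).compile 0)) :: k')

section Simulation

variable {B X D : ℕ}

theorem eval_rd (σ : State) (x : ℕ) : (rd x).eval σ = (view σ).reg x := eval_layE _ _ _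

theorem fits_rd (hR : Room B X D) (hD : 40 ≤ D) {x : ℕ} (hx : x < X) : (rd x).Fits X D :=
  ⟨tame_layE hR.two_le 0 hx, by rw [rd, size_layE]; simp only [Expr.size]; omega⟩

theorem cost_rd (x : ℕ) : (rd x).cost = 25 := cost_layE _ _

/-- The simulation of `t` steps from the stack `k`, as a property of the simulating stack `k'` -/
def Simulates (B X : ℕ) (b : Bool) (F : State → ℝ≥0∞) (t : ℕ) (k k' : List Cmd) (σ : State) :
    Prop :=
  WP B X k' (200 * t) σ
    (fun σ' => Frame b σ σ' ∧ ∃ p ∈ (runFor t (k, view σ)).support, view σ' = p.2)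
    (fun σ' => F (view σ')) (expect (runFor t (k, view σ)) fun p => F p.2)

theorem Simulates.advance {b : Bool} {F : State → ℝ≥0∞} {t : ℕ} {k k₁ k₁' : List Cmd}
    {σ σ₁ : State} (h : Simulates B X b F t k₁ k₁' σ₁) (hf : Frame b σ σ₁)
    (hs : step (k, view σ) = PMF.pure (k₁, view σ₁)) :
    WP B X k₁' (200 * t) σ₁
      (fun σ' => Frame b σ σ' ∧ ∃ p ∈ (runFor (t + 1) (k, view σ)).support, view σ' = p.2)
      (fun σ' => F (view σ')) (expect (runFor (t + 1) (k, view σ)) fun p => F p.2) := by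
  have hr : runFor (t + 1) (k, view σ) = runFor t (k₁, view σ₁) := by
    rw [runFor, hs, PMF.pure_bind]
  rw [hr]
  exact h.mono le_rfl (fun σ' _ h1 => ⟨hf.trans h1.1, h1.2⟩) (fun _ _ _ => le_rfl) le_rfl

/-- Whatever the random choices, the stack `k` halts from memory `s` within `t` steps, and all words
stay below `B`. -/
def HaltsWithin (B t : ℕ) (k : List Cmd) (s : State) : Prop :=
  (∀ t' ≤ t, ∀ p ∈ (runFor t' (k, s)).support, p.2.Bounded B) ∧
    ∀ p ∈ (runFor t (k, s)).support, p.1 = []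

theorem HaltsWithin.bounded {t : ℕ} {k : List Cmd} {s : State} (h : HaltsWithin B t k s) :
    s.Bounded B :=
  h.1 0 (Nat.zero_le _) (k, s) (by simp [runFor])

theorem HaltsWithin.step {t : ℕ} {k k₁ : List Cmd} {s s₁ : State} (h : HaltsWithin B (t + 1) k s)
    (hp : (k₁, s₁) ∈ (WordRAM.step (k, s)).support) : HaltsWithin B t k₁ s₁ := by
  have key : ∀ t' q, q ∈ (runFor t' (k₁, s₁)).support → q ∈ (runFor (t' + 1) (k, s)).support := by
    intro t' q hq
    rw [runFor, PMF.mem_support_bind_iff]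
    exact ⟨_, hp, hq⟩
  exact ⟨fun t' ht' q hq => h.1 (t' + 1) (by omega) q (key t' q hq),
    fun q hq => h.2 q (key t q hq)⟩

theorem fits_const {x : ℕ} (hx : x < X) (hD : 40 ≤ D) : (Expr.const x).Fits X D :=
  ⟨hx, by simp only [Expr.size]; omega⟩

/-- A stack of commands is simulated with constant overhead per step, and the distribution of the
simulated memory is the one of the simulated machine. -/
theorem simulates (hR : Room B X D) (hD : 40 ≤ D) {B₀ : ℕ} (hB₀ : B₀ ≤ X) {b : Bool}
    (F : State → ℝ≥0∞) {t : ℕ} {k k' : List Cmd} {σ : State} (hrel : Rel b k k')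
    (hn : ∀ c ∈ k, NamesLt X c) (hr : Ready b σ) (hh : HaltsWithin B₀ t k (view σ)) :
    Simulates B X b F t k k' σ := by
  have hX := hR.two_le
  induction t generalizing k k' σ with
  | zero =>
    have hk : k = [] := hh.2 (k, view σ) (by simp [runFor])
    subst hk
    cases hrel
    refine WP.nil ⟨Frame.refl b σ, ([], view σ), by simp [runFor], rfl⟩ ?_
    rw [runFor, expect_pure]
  | succ t ih =>
    cases hrel with
    | nil =>
      refine WP.nil ⟨Frame.refl b σ, ([], view σ), by simp [runFor_nil], rfl⟩ ?_
      rw [runFor_nil, expect_pure]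
    | @loop x c k k' hrel =>
      have hx : x < X := (hn _ List.mem_cons_self).1
      have hc : NamesLt X c := (hn _ List.mem_cons_self).2
      have hk : ∀ c ∈ k, NamesLt X c := fun c' h => hn c' (List.mem_cons_of_mem _ h)
      by_cases h0 : (view σ).reg x = 0
      · have hs : step (.while x c :: k, view σ) = PMF.pure (k, view σ) := by simp [step, h0]
        refine (WP.while_false hR (fits_rd hR hD hx) (by rw [eval_rd, h0])
          ((ih hrel hk hr (hh.step (by simp [hs]))).advance (Frame.refl b σ) hs)).time_mono ?_
        rw [cost_rd]
        omega
      · have hs : step (.while x c :: k, view σ) = PMF.pure (c :: .while x c :: k, view σ) := by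
          simp [step, h0]
        refine (WP.while_true hR (fits_rd hR hD hx) (by rw [eval_rd]; exact h0)
          ((ih (Rel.cons c (Rel.loop x c hrel)) ?_ hr (hh.step (by simp [hs]))).advance
            (Frame.refl b σ) hs)).time_mono ?_
        · intro c' h
          rcases List.mem_cons.1 h with rfl | h
          · exact hc
          · exact hn c' h
        · rw [cost_rd]
          omega
    | @cons c k k' hrel =>
      have hc : NamesLt X c := hn _ List.mem_cons_self
      have hk : ∀ c ∈ k, NamesLt X c := fun c' h => hn c' (List.mem_cons_of_mem _ h)
      have hk2 : ∀ c₁, NamesLt X c₁ → ∀ c ∈ c₁ :: k, NamesLt X c := by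
        intro c₁ h₁ c' h
        rcases List.mem_cons.1 h with rfl | h
        · exact h₁
        · exact hk c' h
      -- a command that writes one value
      have wr : ∀ (α : ℕ) (I E : Expr) (s₁ : State), I.Fits X D → E.Ok B σ ∨ E.Fits X D →
          view (written b σ α (I.eval σ) (E.eval σ)) = s₁ →
          lay (written b σ α (I.eval σ) (E.eval σ)) α (I.eval σ) = E.eval σ →
          step (c :: k, view σ) = PMF.pure (k, s₁) → tr b c = write b α I E →
          I.cost + E.cost + 5 ≤ 200 → Simulates B X b F (t + 1) (c :: k) (tr b c :: k') σ := by
        intro α I E s₁ hI hE hv hl hs htr hcost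
        subst hv
        have hh' := hh.step (k₁ := k) (s₁ := view (written b σ α (I.eval σ) (E.eval σ)))
          (by simp [hs])
        have hf := frame_written b σ α (I.eval σ) (E.eval σ)
        have hEX : E.eval σ < X := by
          have h1 := hh'.bounded
          have h2 : lay (written b σ α (I.eval σ) (E.eval σ)) α (I.eval σ) < B₀ := by
            cases α with
            | zero => exact h1.1 _
            | succ a => exact h1.2 a _
          rw [hl] at h2
          omega
        rw [htr]
        exact (WP.write hR hI (fun hσ => hE.elim id fun h => h.ok hR hσ) (fun _ => hEX)
          ((ih hrel hk (hf.ready hr) hh').advance hf hs)).time_mono (by omega)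
      have hl : ∀ α i v, lay (written b σ α i v) α i = v := fun α i v => by
        simp [lay_written hr]
      cases c with
      | skip =>
        exact (WP.skip ((ih hrel hk hr (hh.step (by simp [step]))).advance
          (Frame.refl b σ) rfl)).time_mono (by omega)
      | const x v =>
        have hv : v < X := by
          have h1 := (hh.step (k₁ := k) (s₁ := (view σ).setReg x v) (by simp [step])).bounded.1 x
          rw [setReg_reg, if_pos rfl] at h1
          omega
        exact wr 0 (.const x) (.const v) _ (fits_const hc hD) (Or.inr (fits_const hv hD))
          (view_written_reg hr _ _) (hl _ _ _) rfl rfl (by simp [Expr.cost])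
      | op o x y z =>
        obtain ⟨hx, hy, hz⟩ := hc
        have hσX : σ.Bounded X → (Expr.bin o (rd y) (rd z)).Ok B σ := fun hσ =>
          ⟨(fits_rd hR hD hy).ok hR hσ, (fits_rd hR hD hz).ok hR hσ, by
            have h1 := (hh.step (k₁ := k) (s₁ := _) (PMF.mem_support_pure_iff _ _ |>.2
              rfl)).bounded.1 x
            rw [setReg_reg, if_pos rfl] at h1
            rw [eval_rd, eval_rd]
            exact h1.trans_le (hB₀.trans hR.le)⟩
        refine WP.intro_bounded fun hσ => wr 0 (.const x) (.bin o (rd y) (rd z)) _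
          (fits_const hx hD) (Or.inl (hσX hσ)) (view_written_reg hr _ _) (hl _ _ _) ?_ rfl
          (by simp [Expr.cost, cost_rd])
        simp only [Expr.eval, eval_rd]
        rfl
      | load x a y =>
        obtain ⟨hx, hy⟩ := hc
        refine wr 0 (.const x) (layE (a + 1) (rd y)) _
          (fits_const hx hD) (Or.inr ⟨tame_layE hX _ (fits_rd hR hD hy).1, ?_⟩)
          (view_written_reg hr _ _) (hl _ _ _) ?_ rfl ?_
        · simp only [rd, size_layE, Expr.size]
          omega
        · simp only [Expr.eval, eval_layE, eval_rd]
          rfl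
        · simp [Expr.cost, cost_layE, cost_rd]
      | store a y x =>
        obtain ⟨hx, hy⟩ := hc
        refine wr (a + 1) (rd y) (rd x) _ (fits_rd hR hD hy) (Or.inr (fits_rd hR hD hx))
          (view_written_cell hr _ _ _) (hl _ _ _) ?_ rfl (by simp [cost_rd])
        simp only [eval_rd]
        rfl
      | rand x y =>
        obtain ⟨hx, hy⟩ := hc
        have hstep : step (.rand x y :: k, view σ) =
            (PMF.uniformOfFinset (Finset.range ((view σ).reg y + 1))
              Finset.nonempty_range_add_one).map fun v => (k, (view σ).setReg x v) := rfl
        have hyB : (view σ).reg y < B₀ := hh.bounded.1 y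
        have h60 : σ.setReg 60 ((view σ).reg y) = σ.setReg 60 ((rd y).eval σ) := by rw [eval_rd]
        -- the memory before the drawn number is written
        have hw : ∀ v, ((σ.setReg 60 ((rd y).eval σ)).setReg 60 v) = σ.setReg 60 v := by
          intro v
          refine State.ext' (fun z => ?_) (fun _ _ => rfl)
          simp only [setReg_reg]
          split_ifs <;> rfl
        have hF60 : ∀ v, Frame b σ (σ.setReg 60 v) := fun v => Frame.setReg b σ le_rfl
        refine (WP.block (WP.assign hR (by norm_num) (fits_rd hR hD hy)
          (fun _ => by rw [eval_rd]; omega)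
          (WP.rand hR (by norm_num) (by norm_num)
            (fun v => expect (runFor t (k, (view σ).setReg x v)) fun p => F p.2)
            (fun v hv => WP.write hR (t := 200 * t) (fits_const hx hD)
              (fun _ => by simp [Expr.Ok]) (fun hσ => by exact hσ.1 60) ?_) ?_))).time_mono ?_
        · have hv' : v ≤ (view σ).reg y := by
            rw [setReg_reg, if_pos rfl, eval_rd] at hv
            exact hv
          have hmem : (k, (view σ).setReg x v) ∈ (step (.rand x y :: k, view σ)).support := by
            rw [hstep, PMF.mem_support_map_iff]
            exact ⟨v, by simp; omega, rfl⟩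
          rw [hw]
          have he1 : (Expr.const x).eval (σ.setReg 60 v) = x := rfl
          have he2 : (Expr.var 60).eval (σ.setReg 60 v) = v := by simp [Expr.eval]
          rw [he1, he2]
          have hr60 : Ready b (σ.setReg 60 v) := (hF60 v).ready hr
          have hview : view (written b (σ.setReg 60 v) 0 x v) = (view σ).setReg x v := by
            rw [view_written_reg hr60, setReg_view le_rfl]
          have hf : Frame b σ (written b (σ.setReg 60 v) 0 x v) :=
            (hF60 v).trans (frame_written _ _ _ _ _)
          have := ih (σ := written b (σ.setReg 60 v) 0 x v) hrel hk (hf.ready hr)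
            (by rw [hview]; exact hh.step hmem)
          rw [Simulates, hview] at this
          refine this.mono le_rfl (fun σ' _ h1 => ⟨hf.trans h1.1, ?_⟩) (fun _ _ _ => le_rfl) le_rfl
          obtain ⟨p, hp, hp2⟩ := h1.2
          refine ⟨p, ?_, hp2⟩
          rw [runFor, PMF.mem_support_bind_iff]
          exact ⟨_, hmem, hp⟩
        · have hrr : (σ.setReg 60 ((rd y).eval σ)).reg 60 = (view σ).reg y := by
            rw [setReg_reg, if_pos rfl, eval_rd]
          rw [hrr, runFor, expect_bind, hstep, expect_map, expect_uniform]
        · simp only [cost_rd, Expr.cost, List.length_cons, List.length_nil]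
          omega
      | seq c₁ c₂ =>
        refine (WP.seq ((ih (k := c₁ :: c₂ :: k) (Rel.cons c₁ (Rel.cons c₂ hrel)) ?_ hr
          (hh.step (by simp [step]))).advance (Frame.refl b σ) rfl)).time_mono (by omega)
        intro c' h
        rcases List.mem_cons.1 h with rfl | h
        · exact hc.1
        · exact hk2 c₂ hc.2 c' h
      | ite x c₁ c₂ =>
        obtain ⟨hx, h1, h2⟩ := hc
        have hcost : (rd x).cost + 2 + 200 * t ≤ 200 * (t + 1) := by
          rw [cost_rd]
          omega
        refine (WP.ifte hR (fits_rd hR hD hx) (fun h0 => ?_) (fun h0 => ?_)).time_mono hcost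
        · rw [eval_rd] at h0
          have hs : step (.ite x c₁ c₂ :: k, view σ) = PMF.pure (c₁ :: k, view σ) := by
            simp [step, h0]
          exact (ih (Rel.cons c₁ hrel) (hk2 c₁ h1) hr (hh.step (by simp [hs]))).advance
            (Frame.refl b σ) hs
        · rw [eval_rd] at h0
          have hs : step (.ite x c₁ c₂ :: k, view σ) = PMF.pure (c₂ :: k, view σ) := by
            simp [step, h0]
          exact (ih (Rel.cons c₂ hrel) (hk2 c₂ h2) hr (hh.step (by simp [hs]))).advance
            (Frame.refl b σ) hs
      | _ x c =>
        have hx : x < X := hc.1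
        by_cases h0 : (view σ).reg x = 0
        · have hs : step (.while x c :: k, view σ) = PMF.pure (k, view σ) := by simp [step, h0]
          refine (WP.seq (WP.while_false hR (fits_rd hR hD hx) (by rw [eval_rd, h0])
            ((ih hrel hk hr (hh.step (by simp [hs]))).advance (Frame.refl b σ) hs))).time_mono ?_
          rw [cost_rd]
          omega
        · have hs : step (.while x c :: k, view σ) = PMF.pure (c :: .while x c :: k, view σ) := by
            simp [step, h0]
          refine (WP.seq (WP.while_true hR (fits_rd hR hD hx) (by rw [eval_rd]; exact h0)
            ((ih (Rel.cons c (Rel.loop x c hrel)) ?_ hr (hh.step (by simp [hs]))).advance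
              (Frame.refl b σ) hs))).time_mono ?_
          · intro c' h
            rcases List.mem_cons.1 h with rfl | h
            · exact hc.2
            · exact hn c' h
          · rw [cost_rd]
            omega

/-- Running a program on the simulated memory -/
theorem WP.simulate (hR : Room B X D) (hD : 40 ≤ D) {B₀ : ℕ} (hB₀ : B₀ ≤ X) {b : Bool} {c : Cmd}
    (F : State → ℝ≥0∞) {t t' : ℕ} {l : List Cmd} {σ s : State} {Q : State → Prop}
    {f : State → ℝ≥0∞} {e : ℝ≥0∞} (hn : NamesLt X c) (hr : Ready b σ) (hs : view σ = s)
    (hh : RunsWithin c B₀ t s)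
    (h : ∀ σ', Frame b σ σ' → view σ' ∈ (exec c t s).support →
      WP B X l t' σ' Q f (F (view σ')))
    (he : expect (exec c t s) F ≤ e) :
    WP B X (tr b c :: l) (200 * t + t') σ Q f e := by
  subst hs
  have h1 := simulates hR hD hB₀ F (Rel.cons c Rel.nil) (by simpa using hn) hr hh
  rw [exec, expect_map] at he
  refine (WP.cons h1 fun σ' _ h2 => h σ' h2.1 ?_).le_expect he
  obtain ⟨p, hp, hp2⟩ := h2.2
  rw [exec, PMF.mem_support_map_iff]
  exact ⟨p, hp, hp2.symm⟩

end Simulation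

end WordRAM

namespace SlotGraph

open WordRAM VertexFailure

/-! ### Set disjointness as connectivity under vertex failures -/

/-- The vertices are `d` sets, followed by `g` slots of `p` elements each. -/
abbrev numVerts (d g p : ℕ) : ℕ := d + g * p

/-- The vertex for element `z` of slot `t` -/
def elt (d p t z : ℕ) : ℕ := d + t * p + z

theorem elt_lt {d g p t z : ℕ} (ht : t < g) (hz : z < p) : elt d p t z < numVerts d g p := by
  have : (t + 1) * p ≤ g * p := Nat.mul_le_mul_right p ht
  simp only [elt, numVerts]
  nlinarith

theorem elt_inj {d p t t' z z' : ℕ} (hz : z < p) (hz' : z' < p)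
    (h : elt d p t z = elt d p t' z') : t = t' ∧ z = z' := by
  have h1 : t * p + z = t' * p + z' := by
    simp only [elt] at h
    omega
  have h2 : t = t' := by
    have a1 : (z + t * p) / p = t := by
      rw [Nat.add_mul_div_right _ _ (by omega), Nat.div_eq_of_lt hz, zero_add]
    have a2 : (z' + t' * p) / p = t' := by
      rw [Nat.add_mul_div_right _ _ (by omega), Nat.div_eq_of_lt hz', zero_add]
    rw [← a1, ← a2, add_comm z, h1, add_comm]
  subst h2
  exact ⟨rfl, by omega⟩

/-- Every set contains exactly one element of each slot: set `u` contains element `z u t` of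
slot `t`. -/
def graph (d g p : ℕ) (z : ℕ → ℕ → ℕ) : SimpleGraph (Fin (numVerts d g p)) where
  Adj x y := ((x : ℕ) < d ∧ ∃ t < g, (y : ℕ) = elt d p t (z x t)) ∨
    ((y : ℕ) < d ∧ ∃ t < g, (x : ℕ) = elt d p t (z y t))
  symm := ⟨fun x y h => h.symm⟩
  loopless := ⟨fun x h => by
    have : ∀ t z, (x : ℕ) = elt d p t z → d ≤ x := fun t z h => by simp only [elt] at h; omega
    rcases h with ⟨h, t, _, ht⟩ | ⟨h, t, _, ht⟩ <;> exact absurd (this _ _ ht) (by omega)⟩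

variable {d g p : ℕ} {z : ℕ → ℕ → ℕ}

/-- The edges, ordered by set and then by slot -/
def edges (d g p : ℕ) (z : ℕ → ℕ → ℕ) (hz : ∀ u t, z u t < p) :
    List (Fin (numVerts d g p) × Fin (numVerts d g p)) :=
  List.ofFn fun e : Fin (d * g) =>
    have hg : 0 < g := Nat.pos_of_ne_zero fun h => by subst h; exact absurd e.2 (by simp)
    (⟨e / g, lt_of_lt_of_le ((Nat.div_lt_iff_lt_mul hg).2 e.2) (Nat.le_add_right _ _)⟩,
      ⟨elt d p (e % g) (z (e / g) (e % g)), elt_lt (Nat.mod_lt _ hg) (hz _ _)⟩)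

theorem length_edges (hz : ∀ u t, z u t < p) : (edges d g p z hz).length = d * g := by
  simp [edges]

theorem isEdgeList_edges (hz : ∀ u t, z u t < p) :
    IsEdgeList (graph d g p z) (edges d g p z hz) := by
  constructor
  · rw [edges, List.map_ofFn, List.nodup_ofFn]
    intro e e' h
    have hg : 0 < g := Nat.pos_of_ne_zero fun h => by subst h; exact absurd e.2 (by simp)
    have hd : (e : ℕ) / g < d := (Nat.div_lt_iff_lt_mul hg).2 e.2
    simp only [Function.comp, Sym2.eq_iff, Fin.ext_iff] at h
    rcases h with ⟨h1, h2⟩ | ⟨h1, h2⟩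
    · obtain ⟨h3, -⟩ := elt_inj (hz _ _) (hz _ _) h2
      refine Fin.ext ?_
      rw [← Nat.div_add_mod (e : ℕ) g, ← Nat.div_add_mod (e' : ℕ) g, h1, h3]
    · simp only [elt] at h1
      omega
  · intro x
    induction x using Sym2.ind with
    | h x y =>
      rw [SimpleGraph.mem_edgeSet, edges, List.map_ofFn, List.mem_ofFn]
      have key : ∀ x y : Fin (numVerts d g p), (x : ℕ) < d → ∀ t < g, (y : ℕ) = elt d p t (z x t) →
          ∃ e : Fin (d * g), (e : ℕ) / g = x ∧ elt d p (e % g) (z (e / g) (e % g)) = y := by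
        intro x y hx t ht hy
        have h1 : (t + x * g) / g = x := by
          rw [Nat.add_mul_div_right _ _ (by omega), Nat.div_eq_of_lt ht, zero_add]
        have h2 : (t + x * g) % g = t := by
          rw [Nat.add_mul_mod_self_right, Nat.mod_eq_of_lt ht]
        have h3 : t + x * g < d * g := by
          have : ((x : ℕ) + 1) * g ≤ d * g := Nat.mul_le_mul_right g hx
          nlinarith
        exact ⟨⟨t + x * g, h3⟩, h1, by simp only [h1, h2, hy]⟩
      constructor
      · rintro (⟨hx, t, ht, hy⟩ | ⟨hy, t, ht, hx⟩)
        · obtain ⟨e, h1, h2⟩ := key x y hx t ht hy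
          refine ⟨e, ?_⟩
          simp only [Function.comp, Sym2.eq_iff, Fin.ext_iff]
          exact Or.inl ⟨h1, h2⟩
        · obtain ⟨e, h1, h2⟩ := key y x hy t ht hx
          refine ⟨e, ?_⟩
          simp only [Function.comp, Sym2.eq_iff, Fin.ext_iff]
          exact Or.inr ⟨h1, h2⟩
      · rintro ⟨e, he⟩
        have hg : 0 < g := Nat.pos_of_ne_zero fun h => by subst h; exact absurd e.2 (by simp)
        have hd : (e : ℕ) / g < d := (Nat.div_lt_iff_lt_mul hg).2 e.2
        simp only [Function.comp, Sym2.eq_iff, Fin.ext_iff] at he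
        rcases he with ⟨h1, h2⟩ | ⟨h1, h2⟩
        · exact Or.inl ⟨by omega, e % g, Nat.mod_lt _ hg, by rw [← h2, ← h1]⟩
        · exact Or.inr ⟨by omega, e % g, Nat.mod_lt _ hg, by rw [← h2, ← h1]⟩

/-- The set vertices, which are the ones predicted to fail -/
def sets (d g p : ℕ) : Finset (Fin (numVerts d g p)) := Finset.univ.filter fun x => (x : ℕ) < d

/-- The set vertices as a list without repetition, the form in which the oracle reads them -/
def setList (d g p : ℕ) : List (Fin (numVerts d g p)) :=
  List.ofFn fun i : Fin d => Fin.castLE (Nat.le_add_right _ _) i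

theorem setList_nodup : (setList d g p).Nodup := by
  rw [setList, List.nodup_ofFn]
  exact Fin.castLE_injective _

theorem setList_toFinset : (setList d g p).toFinset = sets d g p := by
  ext x
  simp only [setList, List.mem_toFinset, List.mem_ofFn, sets, Finset.mem_filter, Finset.mem_univ,
    true_and]
  constructor
  · rintro ⟨i, rfl⟩
    exact i.2
  · intro h
    exact ⟨⟨x, h⟩, Fin.ext rfl⟩

theorem card_sets : (sets d g p).card = d := by
  rw [← setList_toFinset, List.toFinset_card_of_nodup setList_nodup, setList, List.length_ofFn]

/-- When all set vertices other than `u` and `v` fail, then `u` and `v` are connected if and only if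
the two sets intersect. -/
theorem connectedAvoiding_iff (hz : ∀ u t, z u t < p) {u v : Fin (numVerts d g p)} (hu : (u : ℕ) < d)
    (hv : (v : ℕ) < d) (huv : u ≠ v) :
    ConnectedAvoiding (graph d g p z) (sets d g p \ {u, v}) u v ↔ ∃ t < g, z u t = z v t := by
  have hmem : ∀ x : Fin (numVerts d g p), x ∉ sets d g p \ {u, v} ↔ d ≤ (x : ℕ) ∨ x = u ∨ x = v := by
    intro x
    simp only [sets, Finset.mem_sdiff, Finset.mem_filter, Finset.mem_univ, true_and,
      Finset.mem_insert, Finset.mem_singleton]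
    by_cases h : (x : ℕ) < d <;> by_cases h1 : x = u <;> by_cases h2 : x = v <;> simp_all
  constructor
  · rintro ⟨hu', hv', hr⟩
    by_contra hno
    push Not at hno
    rw [SimpleGraph.reachable_iff_reflTransGen] at hr
    have inv : ∀ y : {x | x ∉ sets d g p \ {u, v}},
        Relation.ReflTransGen ((graph d g p z).induce _).Adj ⟨u, hu'⟩ y →
        y.1 = u ∨ ∃ t < g, (y.1 : ℕ) = elt d p t (z u t) := by
      intro y hy
      induction hy with
      | refl => exact Or.inl rfl
      | @tail x y _ hxy ih =>
        rw [SimpleGraph.induce_adj] at hxy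
        have hy := (hmem y.1).1 y.2
        rcases hxy with ⟨hx, t, ht, hyt⟩ | ⟨hyd, t, ht, hxt⟩
        · rcases ih with ih | ⟨t', _, ih⟩
          · exact Or.inr ⟨t, ht, by rw [hyt, ih]⟩
          · simp only [elt] at ih
            omega
        · rcases hy with hy | hy | hy
          · omega
          · exact Or.inl hy
          · rcases ih with ih | ⟨t', ht', ih⟩
            · have := congrArg Fin.val ih
              simp only [elt] at hxt
              omega
            · rw [ih, hy] at hxt
              obtain ⟨h1, h2⟩ := elt_inj (hz _ _) (hz _ _) hxt
              subst h1
              exact absurd h2 (hno t' ht)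
    rcases inv _ hr with h | ⟨t, _, h⟩
    · exact huv h.symm
    · simp only [elt] at h
      omega
  · rintro ⟨t, ht, h⟩
    have hu' : u ∉ sets d g p \ {u, v} := (hmem u).2 (Or.inr (Or.inl rfl))
    have hv' : v ∉ sets d g p \ {u, v} := (hmem v).2 (Or.inr (Or.inr rfl))
    set x : Fin (numVerts d g p) := ⟨elt d p t (z u t), elt_lt ht (hz _ _)⟩ with hx
    have hx' : x ∉ sets d g p \ {u, v} :=
      (hmem x).2 (Or.inl (by simp only [hx, elt]; omega))
    refine ⟨hu', hv', ?_⟩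
    have h1 : ((graph d g p z).induce {x | x ∉ sets d g p \ {u, v}}).Adj ⟨u, hu'⟩ ⟨x, hx'⟩ :=
      Or.inl ⟨hu, t, ht, rfl⟩
    have h2 : ((graph d g p z).induce {x | x ∉ sets d g p \ {u, v}}).Adj ⟨x, hx'⟩ ⟨v, hv'⟩ :=
      Or.inr ⟨hv, t, ht, congrArg (elt d p t) h⟩
    exact h1.reachable.trans h2.reachable

/-! ### The oracle on these graphs -/

/-- The memory at the start of the preprocessing phase -/
def preState (d g p : ℕ) (z : ℕ → ℕ → ℕ) : State where
  reg x := if x = 0 then numVerts d g p else if x = 1 then d * g else if x = 2 then d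
    else if x = 3 then d else 0
  arr a i :=
    if a = 0 then (if i < d * g then i / g else 0)
    else if a = 1 then (if i < d * g then elt d p (i % g) (z (i / g) (i % g)) else 0)
    else if a = 2 then (if i < d then i else 0)
    else 0

/-- The memory at the start of the update phase -/
def updState (s : State) (u v : ℕ) : State := ((s.setReg 0 2).setCell 3 0 u).setCell 3 1 v

/-- The memory at the start of the query phase -/
def qryState (s : State) (u v : ℕ) : State := (s.setReg 0 u).setReg 1 v

theorem getD_ofFn {m : ℕ} (f : Fin m → ℕ) (i c : ℕ) :
    ((List.ofFn f)[i]?).getD c = if h : i < m then f ⟨i, h⟩ else c := by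
  by_cases h : i < m
  · simp [h]
  · simp [h]

theorem preInput_eq (hz : ∀ u t, z u t < p) :
    preInput (edges d g p z hz) d (setList d g p) = preState d g p z := by
  refine State.ext' (fun x => ?_) (fun a i => ?_)
  · simp only [preInput, State.writeList, setReg_reg, preState, length_edges, setList,
      List.length_ofFn, State.zero]
    by_cases h0 : x = 0 <;> by_cases h1 : x = 1 <;> by_cases h2 : x = 2 <;>
      by_cases h3 : x = 3 <;> simp_all
  · simp only [preInput, State.writeList, preState, edges, setList, List.map_ofFn, getD_ofFn,
      Function.update_apply, setReg_arr, State.zero, Function.comp]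
    by_cases h2 : a = 2
    · subst h2
      simp only [if_true, List.map_id', List.bind_eq_flatMap, List.pure_def, OfNat.ofNat_ne_zero,
        OfNat.ofNat_ne_one, if_false]
      rw [← List.map_eq_flatMap, List.map_ofFn, getD_ofFn]
      simp
    · by_cases h1 : a = 1
      · subst h1
        simp
      · by_cases h0 : a = 0
        · subst h0
          simp
        · simp [h0, h1, h2]

theorem updInput_eq {n : ℕ} (s : State) (u v : Fin n) :
    updInput s [u, v] = updState s u v := by
  refine State.ext' (fun x => ?_) (fun a i => ?_)
  · simp [updInput, updState, State.writeList]
  · by_cases ha : a = 3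
    · subst ha
      simp only [updInput, updState, State.writeList, setCell_arr, setReg_arr, if_true,
        Function.update_self, Function.update_apply]
      rcases i with _ | _ | i <;> simp
    · simp [updInput, updState, State.writeList, ha]

open Classical in
/-- The probability that the answer to the query whether `u` and `v` are connected is not the truth
value `truth`, given the memory after the preprocessing -/
noncomputable def err (O : Oracle) (t₂ t₃ u v : ℕ) (truth : Prop) (s₁ : State) : ℝ≥0∞ :=
  expect (exec O.upd t₂ (updState s₁ u v)) fun s₂ =>
    expect (exec O.qry t₃ (qryState s₂ u v)) fun s => if (s.reg 0 = 1 ↔ truth) then 0 else 1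

/-- What an oracle with word bound `(N + 2) ^ c` does on slot graphs, in terms of numbers -/
def Serves (O : Oracle) (tpre : ℕ → ℕ → ℕ → ℕ) (tupd tqry : ℕ → ℕ → ℕ) (c : ℕ) : Prop :=
  ∀ (d g p : ℕ) (z : ℕ → ℕ → ℕ), 1 ≤ d → (∀ u t, z u t < p) →
    RunsWithin O.pre ((numVerts d g p + 2) ^ c) (tpre (numVerts d g p) (d * g) d) (preState d g p z) ∧
    ∀ u v : ℕ, u < d → v < d → u ≠ v →
      (∀ s₁ ∈ (exec O.pre (tpre (numVerts d g p) (d * g) d) (preState d g p z)).support,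
        RunsWithin O.upd ((numVerts d g p + 2) ^ c) (tupd (numVerts d g p) 2) (updState s₁ u v) ∧
        ∀ s₂ ∈ (exec O.upd (tupd (numVerts d g p) 2) (updState s₁ u v)).support,
          RunsWithin O.qry ((numVerts d g p + 2) ^ c) (tqry (numVerts d g p) 2) (qryState s₂ u v)) ∧
      expect (exec O.pre (tpre (numVerts d g p) (d * g) d) (preState d g p z))
        (err O (tupd (numVerts d g p) 2) (tqry (numVerts d g p) 2) u v (∃ t < g, z u t = z v t)) ≤ 1 / 3

theorem serves_of_isConnectivityOracle {O : Oracle} {tpre : ℕ → ℕ → ℕ → ℕ}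
    {tupd tqry : ℕ → ℕ → ℕ} (h : O.IsConnectivityOracle tpre tupd tqry) :
    ∃ c, Serves O tpre tupd tqry c := by
  classical
  obtain ⟨c, hc⟩ := h
  refine ⟨c, fun d g p z hd hz => ?_⟩
  have h1 := hc (numVerts d g p) (graph d g p z) (edges d g p z hz) d (sets d g p) (setList d g p)
    (isEdgeList_edges hz) hd (Nat.le_add_right _ _) card_sets.le setList_nodup setList_toFinset
  rw [length_edges, preInput_eq] at h1
  refine ⟨h1.1, fun u v hu hv huv => ?_⟩
  set u' : Fin (numVerts d g p) := ⟨u, by simp only [numVerts]; omega⟩ with hu'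
  set v' : Fin (numVerts d g p) := ⟨v, by simp only [numVerts]; omega⟩ with hv'
  have huv' : u' ≠ v' := fun h => huv (congrArg Fin.val h)
  have hsub : ({u', v'} : Finset (Fin (numVerts d g p))) ⊆ sets d g p := by
    intro x hx
    simp only [Finset.mem_insert, Finset.mem_singleton] at hx
    rcases hx with rfl | rfl <;> simp [sets, hu', hv', hu, hv]
  have hsd : sets d g p ∆ (sets d g p \ {u', v'}) = {u', v'} := by
    ext x
    simp only [Finset.mem_symmDiff, Finset.mem_sdiff]
    have := @hsub x
    tauto
  have hcard : (sets d g p ∆ (sets d g p \ {u', v'})).card = 2 := by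
    rw [hsd, Finset.card_pair huv']
  have h2 := h1.2 (sets d g p \ {u', v'}) [u', v']
    ((Finset.card_le_card Finset.sdiff_subset).trans card_sets.le) (by simpa using huv')
    (by rw [hsd]; ext; simp)
  rw [hcard] at h2
  have hu2 : u' ∉ sets d g p \ {u', v'} := by simp
  have hv2 : v' ∉ sets d g p \ {u', v'} := by simp
  obtain ⟨h3, h4⟩ := h2
  refine ⟨fun s₁ hs₁ => ?_, ?_⟩
  · have h5 := h3 s₁ hs₁
    rw [updInput_eq] at h5
    exact ⟨h5.1, fun s₂ hs₂ => h5.2 s₂ hs₂ u' v' hu2 hv2⟩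
  · have h6 := h4 u' v' hu2 hv2
    rw [connectedAvoiding_iff hz hu hv huv', ← expect_indicator, Oracle.outcome, preInput_eq, expect_bind] at h6
    simp only [updInput_eq, expect_bind] at h6
    set truth : Prop := ∃ t < g, z u t = z v t
    set μ := exec O.pre (tpre (numVerts d g p) (d * g) d) (preState d g p z)
    have h7 : expect μ (err O (tupd (numVerts d g p) 2) (tqry (numVerts d g p) 2) u v truth) + 2 / 3 ≤
        1 := by
      refine (add_le_add_right h6 _).trans ?_
      rw [← expect_add]
      refine le_of_le_of_eq (expect_mono _ fun s₁ _ => ?_) (expect_const _ 1)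
      refine (expect_add _ _ _).symm.le.trans ?_
      refine le_of_le_of_eq (expect_mono _ fun s₂ _ => ?_) (expect_const _ 1)
      refine (expect_add _ _ _).symm.le.trans ?_
      refine le_of_le_of_eq (expect_mono _ fun s _ => ?_) (expect_const _ 1)
      by_cases ht : truth
      · by_cases hs : s.reg 0 = 1
        · simp [ht, hs]
        · simp [ht, hs]
      · by_cases hs : s.reg 0 = 1
        · simp [ht, hs]
        · by_cases hs' : s.reg 0 = 0 <;> simp [ht, hs, hs']
    have h8 : (1 : ℝ≥0∞) = 1 / 3 + 2 / 3 := by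
      rw [← ENNReal.add_div]
      norm_num
      exact (ENNReal.div_self (by norm_num) (by norm_num)).symm
    rw [h8] at h7
    exact (ENNReal.add_le_add_iff_right (ENNReal.div_ne_top (by norm_num) (by norm_num))).1 h7

end SlotGraph

namespace ExactTriangle

/-! ### The divisor bound -/

theorem exists_add_one_pow_le (s : ℕ) : ∃ K : ℕ, 1 ≤ K ∧ ∀ a : ℕ, (a + 1) ^ s ≤ K * 2 ^ a := by
  have h := tendsto_pow_const_div_const_pow_of_one_lt s (one_lt_two : (1 : ℝ) < 2)
  obtain ⟨C, hC⟩ := h.bddAbove_range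
  refine ⟨2 * ⌈C⌉₊ + 1, by omega, fun a => ?_⟩
  have h1 : ((a + 1 : ℕ) : ℝ) ^ s / 2 ^ (a + 1) ≤ C := hC ⟨a + 1, rfl⟩
  rw [div_le_iff₀ (by positivity)] at h1
  have h2 : ((a + 1 : ℕ) : ℝ) ^ s ≤ ((2 * ⌈C⌉₊ + 1 : ℕ) : ℝ) * 2 ^ a := by
    refine h1.trans ?_
    rw [pow_succ]
    push_cast
    have := Nat.le_ceil C
    have h3 : (0 : ℝ) < 2 ^ a := by positivity
    nlinarith
  exact_mod_cast h2

/-- For every `s`, the number of divisors of `n` is `O(n ^ (1 / s))`: large primes contribute factors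
`(a + 1) ^ s ≤ p ^ a` to the `s`-th power, and the few small primes bounded multiples of `p ^ a`. -/
theorem exists_card_divisors_pow_le (s : ℕ) :
    ∃ C : ℕ, 1 ≤ C ∧ ∀ n : ℕ, n ≠ 0 → n.divisors.card ^ s ≤ C * n := by
  obtain ⟨K, hK, hKa⟩ := exists_add_one_pow_le s
  refine ⟨K ^ 2 ^ s, Nat.one_le_pow _ _ hK, fun n hn => ?_⟩
  rw [Nat.card_divisors hn, ← Finset.prod_pow]
  have h1 : ∀ p ∈ n.primeFactors, (n.factorization p + 1) ^ s ≤
      (if p < 2 ^ s then K else 1) * p ^ n.factorization p := by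
    intro p hp
    have hp2 : 2 ≤ p := (Nat.prime_of_mem_primeFactors hp).two_le
    split_ifs with h
    · exact (hKa _).trans (Nat.mul_le_mul_left _ (Nat.pow_le_pow_left hp2 _))
    · rw [one_mul]
      calc (n.factorization p + 1) ^ s ≤ (2 ^ n.factorization p) ^ s :=
            Nat.pow_le_pow_left Nat.lt_two_pow_self _
        _ = (2 ^ s) ^ n.factorization p := by rw [← pow_mul, ← pow_mul, mul_comm]
        _ ≤ p ^ n.factorization p := Nat.pow_le_pow_left (by omega) _
  refine (Finset.prod_le_prod' h1).trans ?_
  rw [Finset.prod_mul_distrib]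
  have h2 : ∏ p ∈ n.primeFactors, p ^ n.factorization p = n :=
    Nat.prod_factorization_pow_eq_self hn
  rw [h2]
  refine Nat.mul_le_mul_right _ ?_
  rw [Finset.prod_ite, Finset.prod_const, Finset.prod_const_one, mul_one]
  refine Nat.pow_le_pow_right hK ?_
  calc (n.primeFactors.filter fun p => p < 2 ^ s).card ≤ (Finset.range (2 ^ s)).card :=
        Finset.card_le_card fun p hp => by
          simpa using (Finset.mem_filter.1 hp).2
    _ = 2 ^ s := Finset.card_range _

/-- Numbers that are polynomial in `h` have only `O(h)` divisors. -/
theorem exists_card_divisors_le (k r : ℕ) : ∃ K : ℕ, 1 ≤ K ∧ ∀ n h W : ℕ, 1 ≤ h →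
    n < (h + 1) ^ r → W ≠ 0 → W ≤ 3 * n ^ k → W.divisors.card ≤ K * h := by
  obtain ⟨C, hC, hCn⟩ := exists_card_divisors_pow_le (r * k + 1)
  refine ⟨6 * C, by omega, fun n h W hh hn hW hWn => ?_⟩
  refine (Nat.pow_le_pow_iff_left (n := r * k + 1) (by omega)).1 ((hCn W hW).trans ?_)
  calc C * W ≤ C * (3 * ((2 * h) ^ r) ^ k) := by
        refine Nat.mul_le_mul_left _ (hWn.trans (Nat.mul_le_mul_left _ ?_))
        exact Nat.pow_le_pow_left (hn.le.trans (Nat.pow_le_pow_left (by omega) _)) _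
    _ = (3 * C) * (2 * h) ^ (r * k) := by rw [← pow_mul]; ring
    _ ≤ (3 * C) ^ (r * k + 1) * (2 * h) ^ (r * k + 1) :=
        Nat.mul_le_mul (Nat.le_self_pow (by omega) _) (Nat.pow_le_pow_right (by omega) (by omega))
    _ = (6 * C * h) ^ (r * k + 1) := by rw [← mul_pow]; ring_nf

end ExactTriangle

namespace ExactTriangle

/-! ### Hashing edge weights to a random modulus -/

/-- A weighted graph on `0, ..., n - 1` in the row-major form of the input: adjacency matrix, and
positive and negative parts of the weights. -/
structure Inst where
  n : ℕ
  adj : ℕ → ℕ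
  pos : ℕ → ℕ
  neg : ℕ → ℕ

namespace Inst

variable (I : Inst)

/-- The position of entry `(a, b)` of a matrix -/
def ix (a b : ℕ) : ℕ := a * I.n + b

/-- The sum of the weights of the edges `ab`, `bc` and `ac` -/
def wsum (a b c : ℕ) : ℤ :=
  (I.pos (I.ix a b) + I.pos (I.ix b c) + I.pos (I.ix a c) : ℕ) -
    (I.neg (I.ix a b) + I.neg (I.ix b c) + I.neg (I.ix a c) : ℕ)

/-- `a, b, c` is a triangle of weight zero. -/
def Zero (a b c : ℕ) : Prop :=
  I.adj (I.ix a b) = 1 ∧ I.adj (I.ix b c) = 1 ∧ I.adj (I.ix a c) = 1 ∧ I.wsum a b c = 0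

/-- A residue of the weight at position `p` modulo `q` -/
def res (q p : ℕ) : ℕ := I.pos p % q + (q - I.neg p % q)

/-- A residue of the negative weight at position `p` modulo `q` -/
def nres (q p : ℕ) : ℕ := I.neg p % q + (q - I.pos p % q)

/-- Node `t` of the group `γ` of nodes -/
def node (g γ t : ℕ) : ℕ := (γ * g + t) % I.n

/-- The elements of the sets: the sets `a * q + i` belong to a node `a` and a residue `i`, and their
element in slot `t` is the residue of `i` plus the weight of `ac`, where `c` is node `t` of the group.
The sets `n * q + b` belong to a node `b`, and their element in slot `t` is the residue of the negative
weight of `bc`. The elements `q` and `q + 1` stand for missing edges. -/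
def elem (g γ q u t : ℕ) : ℕ :=
  if u < I.n * q then
    if I.adj (u / q * I.n + I.node g γ t) = 1 then
      (I.res q (u / q * I.n + I.node g γ t) + u % q) % q
    else q
  else
    if I.adj ((u - I.n * q) * I.n + I.node g γ t) = 1 then
      I.nres q ((u - I.n * q) * I.n + I.node g γ t) % q
    else q + 1

theorem elem_lt {q : ℕ} (hq : 1 ≤ q) (g γ u t : ℕ) : I.elem g γ q u t < q + 2 := by
  have h : ∀ x, x % q < q := fun x => Nat.mod_lt _ (by omega)
  simp only [elem]
  split_ifs
  · exact (h _).trans (by omega)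
  · omega
  · exact (h _).trans (by omega)
  · omega

/-- The set to query for the node `a` of the pair at position `j` -/
def left (q j : ℕ) : ℕ := j / I.n * q + I.res q j % q

/-- The set to query for the node `b` of the pair at position `j` -/
def right (q j : ℕ) : ℕ := I.n * q + j % I.n

/-- Whether the pair at position `j` is an edge that forms a triangle of weight zero with a node of the
group `γ` -/
def Truth (g γ j : ℕ) : Prop :=
  I.adj j = 1 ∧ ∃ t < g, I.Zero (j / I.n) (j % I.n) (I.node g γ t)

theorem res_cast {q : ℕ} (hq : 1 ≤ q) (p : ℕ) :
    ((I.res q p : ℕ) : ZMod q) = (((I.pos p : ℤ) - I.neg p : ℤ) : ZMod q) := by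
  have h : I.neg p % q ≤ q := (Nat.mod_lt _ hq).le
  simp [res, Nat.cast_sub h, sub_eq_add_neg]

theorem nres_cast {q : ℕ} (hq : 1 ≤ q) (p : ℕ) :
    ((I.nres q p : ℕ) : ZMod q) = (((I.neg p : ℤ) - I.pos p : ℤ) : ZMod q) := by
  have h : I.pos p % q ≤ q := (Nat.mod_lt _ hq).le
  simp [nres, Nat.cast_sub h, sub_eq_add_neg]

theorem left_lt {q j : ℕ} (hq : 1 ≤ q) (hj : j < I.n * I.n) : I.left q j < I.n * q := by
  have h1 : j / I.n < I.n := Nat.div_lt_of_lt_mul hj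
  have h2 : I.res q j % q < q := Nat.mod_lt _ hq
  have h3 : (j / I.n + 1) * q ≤ I.n * q := Nat.mul_le_mul_right q h1
  simp only [left]
  nlinarith

/-- The two sets for a pair of nodes intersect if and only if a triangle over this pair has weight
zero modulo `q`. -/
theorem elem_left_eq_elem_right {q j : ℕ} (hq : 1 ≤ q) (hj : j < I.n * I.n) (g γ t : ℕ) :
    I.elem g γ q (I.left q j) t = I.elem g γ q (I.right q j) t ↔
      I.adj (I.ix (j % I.n) (I.node g γ t)) = 1 ∧ I.adj (I.ix (j / I.n) (I.node g γ t)) = 1 ∧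
        (q : ℤ) ∣ I.wsum (j / I.n) (j % I.n) (I.node g γ t) := by
  have hi : I.res q j % q < q := Nat.mod_lt _ hq
  have h1 : I.left q j / q = j / I.n := by
    rw [left, add_comm, Nat.add_mul_div_right _ _ (by omega), Nat.div_eq_of_lt hi, zero_add]
  have h2 : I.left q j % q = I.res q j % q := by
    rw [left, add_comm, Nat.add_mul_mod_self_right, Nat.mod_mod]
  have h3 : ¬ I.right q j < I.n * q := by simp only [right]; omega
  have h4 : I.right q j - I.n * q = j % I.n := by simp only [right]; omega
  have hjj : I.ix (j / I.n) (j % I.n) = j := by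
    rw [ix, mul_comm]
    exact Nat.div_add_mod j I.n
  have hlt : ∀ x, x % q < q := fun x => Nat.mod_lt _ (by omega)
  simp only [elem, if_pos (I.left_lt hq hj), if_neg h3, h1, h2, h4]
  set c := I.node g γ t
  change (if I.adj (I.ix (j / I.n) c) = 1 then (I.res q (I.ix (j / I.n) c) + I.res q j % q) % q
    else q) = (if I.adj (I.ix (j % I.n) c) = 1 then I.nres q (I.ix (j % I.n) c) % q else q + 1) ↔ _
  by_cases ha : I.adj (I.ix (j / I.n) c) = 1
  · by_cases hb : I.adj (I.ix (j % I.n) c) = 1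
    · rw [if_pos ha, if_pos hb, ← ZMod.natCast_eq_natCast_iff', Nat.cast_add, ZMod.natCast_mod,
        I.res_cast hq, I.res_cast hq, I.nres_cast hq, ← ZMod.intCast_zmod_eq_zero_iff_dvd, wsum, hjj]
      simp only [ha, hb, true_and]
      rw [← sub_eq_zero]
      push_cast
      constructor
      · intro h
        rw [← h]
        ring
      · intro h
        rw [← h]
        ring
    · rw [if_pos ha, if_neg hb]
      have := hlt (I.res q (I.ix (j / I.n) c) + I.res q j % q)
      simp only [hb, false_and, iff_false]
      omega
  · rw [if_neg ha]
    simp only [ha, false_and, and_false, iff_false]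
    split_ifs
    · have := hlt (I.nres q (I.ix (j % I.n) c))
      omega
    · omega

theorem intersect_of_truth {q j : ℕ} (hq : 1 ≤ q) (hj : j < I.n * I.n) {g γ : ℕ}
    (h : I.Truth g γ j) :
    ∃ t < g, I.elem g γ q (I.left q j) t = I.elem g γ q (I.right q j) t := by
  obtain ⟨_, t, ht, h1, h2, h3, h4⟩ := h
  exact ⟨t, ht, (I.elem_left_eq_elem_right hq hj g γ t).2 ⟨h2, h3, by rw [h4]; exact dvd_zero _⟩⟩

open Classical in
/-- For a pair without a triangle of weight zero in the group, few moduli make the two sets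
intersect: each of them divides one of the nonzero weights. -/
theorem card_false_intersect_le {k L M g γ j : ℕ} (hM : 1 ≤ M) (hj : j < I.n * I.n)
    (hpos : ∀ p, I.pos p ≤ I.n ^ k) (hneg : ∀ p, I.neg p ≤ I.n ^ k)
    (hL : ∀ W : ℕ, W ≠ 0 → W ≤ 3 * I.n ^ k → W.divisors.card ≤ L)
    (hadj : I.adj j = 1) (h : ¬ I.Truth g γ j) :
    ((Finset.range M).filter fun v =>
      ∃ t < g, I.elem g γ (v + M) (I.left (v + M) j) t =
        I.elem g γ (v + M) (I.right (v + M) j) t).card ≤ g * L := by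
  have hjj : I.ix (j / I.n) (j % I.n) = j := by
    rw [ix, mul_comm]
    exact Nat.div_add_mod j I.n
  set W : ℕ → ℕ := fun t => (I.wsum (j / I.n) (j % I.n) (I.node g γ t)).natAbs with hW
  have hWle : ∀ t, W t ≤ 3 * I.n ^ k := by
    intro t
    simp only [hW, wsum]
    have h1 := hpos (I.ix (j / I.n) (j % I.n))
    have h2 := hpos (I.ix (j % I.n) (I.node g γ t))
    have h3 := hpos (I.ix (j / I.n) (I.node g γ t))
    have h4 := hneg (I.ix (j / I.n) (j % I.n))
    have h5 := hneg (I.ix (j % I.n) (I.node g γ t))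
    have h6 := hneg (I.ix (j / I.n) (I.node g γ t))
    omega
  calc _ ≤ (((Finset.range g).filter fun t => W t ≠ 0).biUnion fun t =>
        (W t).divisors.image fun x => x - M).card := by
        refine Finset.card_le_card fun v hv => ?_
        rw [Finset.mem_filter, Finset.mem_range] at hv
        obtain ⟨hv, t, ht, heq⟩ := hv
        rw [I.elem_left_eq_elem_right (by omega) hj] at heq
        have h0 : W t ≠ 0 := fun h0 =>
          h ⟨hadj, t, ht, by rw [hjj]; exact hadj, heq.1, heq.2.1, Int.natAbs_eq_zero.1 h0⟩
        rw [Finset.mem_biUnion]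
        refine ⟨t, by simp [ht, h0], Finset.mem_image.2 ⟨v + M, ?_, by omega⟩⟩
        exact Nat.mem_divisors.2 ⟨Int.natCast_dvd.1 heq.2.2, h0⟩
    _ ≤ ∑ t ∈ (Finset.range g).filter fun t => W t ≠ 0, L := by
        refine Finset.card_biUnion_le.trans (Finset.sum_le_sum fun t ht => ?_)
        exact Finset.card_image_le.trans (hL _ (Finset.mem_filter.1 ht).2 (hWle t))
    _ ≤ g * L := by
        rw [Finset.sum_const, smul_eq_mul]
        refine Nat.mul_le_mul_right _ ((Finset.card_filter_le _ _).trans ?_)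
        rw [Finset.card_range]

end Inst

open WordRAM SlotGraph VertexFailure

/-- The probability that, given the memory after the preprocessing with modulus `q`, the answer to
the query for the pair at position `j` differs from the truth for group `γ`. Pairs that are not edges
are not counted. -/
noncomputable def pairErr (I : Inst) (O : Oracle) (t₂ t₃ g γ q j : ℕ) (s₁ : State) : ℝ≥0∞ :=
  if I.adj j = 1 then err O t₂ t₃ (I.left q j) (I.right q j) (I.Truth g γ j) s₁ else 0

theorem err_le_one (O : Oracle) (t₂ t₃ u v : ℕ) (truth : Prop) (s₁ : State) :
    err O t₂ t₃ u v truth s₁ ≤ 1 := by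
  classical
  refine le_of_le_of_eq (expect_mono _ fun s₂ _ => ?_) (expect_const _ 1)
  refine le_of_le_of_eq (expect_mono _ fun s _ => ?_) (expect_const _ 1)
  split_ifs <;> simp

/-- Over the random choice of the modulus and of the preprocessing, the answer for a fixed pair is
wrong with probability at most `1 / 3 + 1 / 15`. -/
theorem sum_expect_pairErr_le {O : Oracle} {tpre : ℕ → ℕ → ℕ → ℕ} {tupd tqry : ℕ → ℕ → ℕ} {c : ℕ}
    (hO : Serves O tpre tupd tqry c) (I : Inst) {k L M g γ j : ℕ} (hM : 1 ≤ M)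
    (hj : j < I.n * I.n) (hpos : ∀ p, I.pos p ≤ I.n ^ k) (hneg : ∀ p, I.neg p ≤ I.n ^ k)
    (hL : ∀ W : ℕ, W ≠ 0 → W ≤ 3 * I.n ^ k → W.divisors.card ≤ L) (hgL : 15 * (g * L) ≤ M) :
    ∑ v ∈ Finset.range M,
      expect (exec O.pre (tpre (numVerts (I.n * (v + M) + I.n) g (v + M + 2))
          ((I.n * (v + M) + I.n) * g) (I.n * (v + M) + I.n))
        (preState (I.n * (v + M) + I.n) g (v + M + 2) (I.elem g γ (v + M))))
        (pairErr I O (tupd (numVerts (I.n * (v + M) + I.n) g (v + M + 2)) 2)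
          (tqry (numVerts (I.n * (v + M) + I.n) g (v + M + 2)) 2) g γ (v + M) j) ≤
      (M : ℝ≥0∞) * (2 / 5) := by
  classical
  have hn : 1 ≤ I.n := Nat.pos_of_ne_zero fun h => by simp [h] at hj
  by_cases hadj : I.adj j = 1
  swap
  · refine (Finset.sum_nonpos fun v _ => ?_).trans zero_le
    refine (expect_mono (g := fun _ => 0) _ fun s _ => ?_).trans (expect_const _ 0).le
    simp [pairErr, hadj]
  set conn : ℕ → Prop := fun v => ∃ t < g, I.elem g γ (v + M) (I.left (v + M) j) t =
    I.elem g γ (v + M) (I.right (v + M) j) t with hconn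
  have h1 : ∀ v ∈ Finset.range M,
      expect (exec O.pre (tpre (numVerts (I.n * (v + M) + I.n) g (v + M + 2))
          ((I.n * (v + M) + I.n) * g) (I.n * (v + M) + I.n))
        (preState (I.n * (v + M) + I.n) g (v + M + 2) (I.elem g γ (v + M))))
        (pairErr I O (tupd (numVerts (I.n * (v + M) + I.n) g (v + M + 2)) 2)
          (tqry (numVerts (I.n * (v + M) + I.n) g (v + M + 2)) 2) g γ (v + M) j) ≤
      1 / 3 + if conn v ∧ ¬ I.Truth g γ j then 1 else 0 := by
    intro v _
    have hq : 1 ≤ v + M := by omega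
    have hpe : ∀ t₂ t₃, pairErr I O t₂ t₃ g γ (v + M) j =
        err O t₂ t₃ (I.left (v + M) j) (I.right (v + M) j) (I.Truth g γ j) :=
      fun _ _ => funext fun _ => if_pos hadj
    rw [hpe]
    by_cases hc : conn v ↔ I.Truth g γ j
    · have hl := I.left_lt hq hj
      have hr : j % I.n < I.n := Nat.mod_lt _ hn
      have h2 := ((hO (I.n * (v + M) + I.n) g (v + M + 2) (I.elem g γ (v + M)) (by omega)
        (I.elem_lt hq g γ)).2 (I.left (v + M) j) (I.right (v + M) j) (by omega)
          (by simp only [Inst.right]; omega) (by simp only [Inst.right]; omega)).2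
      have h3 : (∃ t < g, I.elem g γ (v + M) (I.left (v + M) j) t =
          I.elem g γ (v + M) (I.right (v + M) j) t) = I.Truth g γ j := propext hc
      rw [h3] at h2
      exact h2.trans le_self_add
    · have hnt : ¬ I.Truth g γ j := fun ht =>
        hc ⟨fun _ => ht, fun _ => I.intersect_of_truth hq hj ht⟩
      have hcv : conn v := by
        by_contra h
        exact hc ⟨fun h' => absurd h' h, fun h' => absurd h' hnt⟩
      rw [if_pos ⟨hcv, hnt⟩]
      refine le_trans ?_ le_add_self
      exact le_of_le_of_eq (expect_mono _ fun s _ => err_le_one _ _ _ _ _ _ s) (expect_const _ 1)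
  refine (Finset.sum_le_sum h1).trans ?_
  rw [Finset.sum_add_distrib, Finset.sum_const, Finset.card_range, nsmul_eq_mul, ← Finset.sum_filter,
    Finset.sum_const, nsmul_eq_mul, mul_one]
  have h2 : (((Finset.range M).filter fun v => conn v ∧ ¬ I.Truth g γ j).card : ℝ≥0∞) ≤
      (M : ℝ≥0∞) * (1 / 15) := by
    have h3 : 15 * ((Finset.range M).filter fun v => conn v ∧ ¬ I.Truth g γ j).card ≤ M := by
      by_cases ht : I.Truth g γ j
      · simp [ht]
      · simp only [ht, not_false_eq_true, and_true]
        exact (Nat.mul_le_mul_left _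
          (I.card_false_intersect_le hM hj hpos hneg hL hadj ht)).trans hgL
    have h4 : (15 : ℝ≥0∞) *
        ((Finset.range M).filter fun v => conn v ∧ ¬ I.Truth g γ j).card ≤ M := by
      exact_mod_cast h3
    rw [mul_one_div, ENNReal.le_div_iff_mul_le (by simp) (by simp), mul_comm]
    exact h4
  refine (add_le_add_right h2 _).trans ?_
  rw [← mul_add]
  refine mul_le_mul_right (le_of_eq ?_) _
  have ht : ∀ a b : ℕ, b ≠ 0 → (a : ℝ≥0∞) / b ≠ ⊤ := fun a b hb =>
    ENNReal.div_ne_top (by simp) (by simpa using hb)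
  have h3 := ht 1 3 (by norm_num)
  have h15 := ht 1 15 (by norm_num)
  have h5 := ht 2 5 (by norm_num)
  push_cast at h3 h15 h5
  rw [← ENNReal.toReal_eq_toReal_iff' (ENNReal.add_ne_top.2 ⟨h3, h15⟩) h5,
    ENNReal.toReal_add h3 h15]
  norm_num

end ExactTriangle

namespace WordRAM

namespace Expr

instance : Add Expr := ⟨.bin .add⟩
instance : Sub Expr := ⟨.bin .sub⟩
instance : Mul Expr := ⟨.bin .mul⟩
instance : Div Expr := ⟨.bin .div⟩
instance : Mod Expr := ⟨.bin .mod⟩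

/-- `1` if `a < b`, and `0` otherwise -/
def lt (a b : Expr) : Expr := .bin .lt a b

/-- `1` if `a = b`, and `0` otherwise -/
def eq (a b : Expr) : Expr := .bin .eq a b

@[simp] theorem add_def (a b : Expr) : a + b = .bin .add a b := rfl
@[simp] theorem sub_def (a b : Expr) : a - b = .bin .sub a b := rfl
@[simp] theorem mul_def (a b : Expr) : a * b = .bin .mul a b := rfl
@[simp] theorem div_def (a b : Expr) : a / b = .bin .div a b := rfl
@[simp] theorem mod_def (a b : Expr) : a % b = .bin .mod a b := rfl

attribute [simp] lt eq eval Tame size cost Op.eval Op.Tame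

end Expr

/-- What writing in layer `b` and in the registers from `30` to `57` leaves unchanged -/
structure Loose (b : Bool) (σ σ' : State) : Prop where
  reg : ∀ x < 30, σ'.reg x = σ.reg x
  clk : ∀ b', σ'.reg (clk b') = σ.reg (clk b')
  arr : ∀ a < 10, σ'.arr a = σ.arr a
  other_val : ∀ α, σ'.arr (valArr (!b) α) = σ.arr (valArr (!b) α)
  other_stamp : ∀ α, σ'.arr (stampArr (!b) α) = σ.arr (stampArr (!b) α)
  stamp : (∀ α i, σ.arr (stampArr b α) i ≤ σ.reg (WordRAM.clk b)) →
    ∀ α i, σ'.arr (stampArr b α) i ≤ σ'.reg (WordRAM.clk b)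

theorem clk_eq (b : Bool) : clk b = 58 ∨ clk b = 59 := by cases b <;> simp [clk]

theorem Frame.loose {b : Bool} {σ σ' : State} (h : Frame b σ σ') : Loose b σ σ' :=
  ⟨fun x hx => h.reg x (by omega),
    fun b' => h.reg _ (by have := clk_eq b'; omega), h.arr,
    h.other_val, h.other_stamp, h.stamp⟩

theorem Loose.refl (b : Bool) (σ : State) : Loose b σ σ := (Frame.refl b σ).loose

theorem Loose.trans {b : Bool} {σ σ' σ'' : State} (h : Loose b σ σ') (h' : Loose b σ' σ'') :
    Loose b σ σ'' :=
  ⟨fun x hx => (h'.reg x hx).trans (h.reg x hx), fun b' => (h'.clk b').trans (h.clk b'),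
    fun a ha => (h'.arr a ha).trans (h.arr a ha),
    fun α => (h'.other_val α).trans (h.other_val α),
    fun α => (h'.other_stamp α).trans (h.other_stamp α), fun hs => h'.stamp (h.stamp hs)⟩

theorem Loose.setReg {b : Bool} {σ σ' : State} (h : Loose b σ σ') {x v : ℕ} (hx : 30 ≤ x)
    (hx' : x < 58) : Loose b σ (σ'.setReg x v) := by
  refine h.trans ⟨fun y hy => by rw [setReg_reg, if_neg (by omega)], fun b' => ?_, fun _ _ => rfl,
    fun _ => rfl, fun _ => rfl, fun hs α i => ?_⟩
  · rw [setReg_reg, if_neg (by have := clk_eq b'; omega)]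
  · rw [setReg_arr, setReg_reg, if_neg (by have := clk_eq b; omega)]
    exact hs α i

theorem Loose.written {b : Bool} {σ σ' : State} (h : Loose b σ σ') (α i v : ℕ) :
    Loose b σ (written b σ' α i v) :=
  h.trans (frame_written b σ' α i v).loose

theorem Loose.ready {b : Bool} {σ σ' : State} (h : Loose b σ σ') (hr : Ready b σ) :
    Ready b σ' := by
  rcases hr with rfl | hr
  · exact Or.inl rfl
  · cases b with
    | true => exact Or.inl rfl
    | false =>
      refine Or.inr fun α i => ?_
      have := h.other_stamp α
      simp only [Bool.not_false] at this
      rw [this, h.clk]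
      exact hr α i

theorem Loose.lower_eq {σ σ' : State} (h : Loose true σ σ') : lower σ' = lower σ := by
  funext α i
  have h1 := h.other_val α
  have h2 := h.other_stamp α
  simp only [Bool.not_true] at h1 h2
  rw [lower, lower, h1, h2, h.clk]

theorem view_setReg {σ : State} {x v : ℕ} (hx : x < 58) : view (σ.setReg x v) = view σ := by
  have h1 : clk true ≠ x := by simp only [clk, if_true]; omega
  have h2 : clk false ≠ x := by simp [clk]; omega
  simp only [view]
  congr 1
  funext α i
  simp only [lay, lower, setReg_arr, setReg_reg, if_neg h1, if_neg h2]

@[simp] theorem written_reg (b : Bool) (σ : State) (α i v : ℕ) :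
    (written b σ α i v).reg = σ.reg := rfl

theorem WP.assign_eq {B X D t : ℕ} {l : List Cmd} {σ : State} {Q : State → Prop}
    {f : State → ℝ≥0∞} {e : ℝ≥0∞} (hR : Room B X D) {x : ℕ} {E : Expr} (v : ℕ) (hx : x < 64)
    (hE : E.Fits X D) (hv : E.eval σ = v) (hvX : σ.Bounded X → v < X)
    (h : WP B X l t (σ.setReg x v) Q f e) :
    WP B X (WordRAM.assign x E :: l) (E.cost + 2 + t) σ Q f e := by
  subst hv
  exact WP.assign hR hx hE hvX h

theorem WP.write_eq {B X D t : ℕ} {l : List Cmd} {σ : State} {Q : State → Prop}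
    {f : State → ℝ≥0∞} {e : ℝ≥0∞} (hR : Room B X D) {b : Bool} {α : ℕ} {I E : Expr} (i v : ℕ)
    (hI : I.Fits X D) (hE : E.Fits X D) (hi : I.eval σ = i) (hv : E.eval σ = v)
    (hvX : σ.Bounded X → v < X) (h : WP B X l t (written b σ α i v) Q f e) :
    WP B X (WordRAM.write b α I E :: l) (I.cost + E.cost + 5 + t) σ Q f e := by
  subst hi
  subst hv
  exact WP.write hR hI (fun hσ => hE.ok hR hσ) hvX h

end WordRAM

namespace ExactTriangle

open WordRAM SlotGraph VertexFailure Expr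

/-! ### The program for Exact Triangle -/

/-- Residues of the weight at the position given by an expression. The modulus is in register
`13`, the positive and negative parts of the weights are in arrays `1` and `2`. -/
def resE (p : Expr) : Expr := load 1 p % var 13 + (var 13 - load 2 p % var 13)

/-- Residues of the negative weight -/
def nresE (p : Expr) : Expr := load 2 p % var 13 + (var 13 - load 1 p % var 13)

/-- Write the edge with the number in register `30` into the input for the oracle. -/
def edgeBody : Cmd := block
  [assign 33 (var 30 / var 6),
    assign 35 ((var 11 * var 6 + var 30 % var 6) % var 4),
    assign 34 (cond (lt (var 33) (var 17)) (var 33 / var 13 * var 4 + var 35)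
      ((var 33 - var 17) * var 4 + var 35)),
    assign 36 (cond (lt (var 33) (var 17))
      (cond (eq (load 0 (var 34)) (const 1)) ((resE (var 34) + var 33 % var 13) % var 13) (var 13))
      (cond (eq (load 0 (var 34)) (const 1)) (nresE (var 34) % var 13) (var 13 + const 1))),
    write false 1 (var 30) (var 33),
    write false 2 (var 30) (var 14 + (var 30 % var 6) * (var 13 + const 2) + var 36)]

/-- Query the oracle for the pair with the position in register `30`, and count a positive
answer. -/
def pairBody (O : Oracle) : Cmd := block
  [assign 33 (var 30 / var 4 * var 13 + resE (var 30) % var 13),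
    assign 34 (var 17 + var 30 % var 4),
    incr 59,
    write true 0 (const 0) (const 2),
    write true 4 (const 0) (var 33),
    write true 4 (const 1) (var 34),
    tr true O.upd,
    write true 0 (const 0) (var 33),
    write true 0 (const 1) (var 34),
    tr true O.qry,
    put 3 (var 30) (cond (eq (load 0 (var 30)) (const 1))
      (load 3 (var 30) + eq (rd 0) (const 1)) (load 3 (var 30)))]

/-- One repetition for the group in register `11`: draw a modulus, run the preprocessing, and query
all pairs. -/
def repBody (O : Oracle) : Cmd := block
  [assign 13 (var 7 - const 1),
    .rand 13 13,
    assign 13 (var 13 + var 7),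
    assign 17 (var 4 * var 13),
    assign 14 (var 17 + var 4),
    assign 15 (var 14 * var 6),
    assign 16 (var 14 + var 6 * (var 13 + const 2)),
    incr 58,
    incr 59,
    write false 0 (const 0) (var 16),
    write false 0 (const 1) (var 15),
    write false 0 (const 2) (var 14),
    write false 0 (const 3) (var 14),
    forTo 30 15 edgeBody,
    forTo 30 14 (write false 3 (var 30) (var 30)),
    tr false O.pre,
    forTo 30 10 (pairBody O)]

/-- Test whether the pair in registers `31` and `32` forms a triangle of weight zero with the node of
the group whose number is in register `30`. -/
def checkBody : Cmd := block
  [assign 35 ((var 11 * var 6 + var 30) % var 4),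
    ifte (load 0 (var 31 * var 4 + var 32) * load 0 (var 32 * var 4 + var 35) *
        load 0 (var 31 * var 4 + var 35) *
        eq (load 1 (var 31 * var 4 + var 32) + load 1 (var 32 * var 4 + var 35) +
            load 1 (var 31 * var 4 + var 35))
          (load 2 (var 31 * var 4 + var 32) + load 2 (var 32 * var 4 + var 35) +
            load 2 (var 31 * var 4 + var 35)))
      (block [assign 0 (const 1), assign 1 (var 31), assign 2 (var 32), assign 3 (var 35)])
      .skip]

/-- Process the group in register `11`: take the majority of the answers for every pair, and test one
pair with a positive majority against all nodes of the group. -/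
def groupBody (O : Oracle) : Cmd := block
  [forTo 30 10 (put 3 (var 30) (const 0)),
    forTo 12 8 (repBody O),
    assign 36 (const 0),
    forTo 30 10
      (assign 36 (cond (lt (var 8) (load 3 (var 30) + load 3 (var 30))) (var 30) (var 36))),
    assign 31 (var 36 / var 4),
    assign 32 (var 36 % var 4),
    forTo 30 6 checkBody]

/-- The `r`-th power of an expression -/
def powE (e : Expr) : ℕ → Expr
  | 0 => const 1
  | r + 1 => powE e r * e

/-- The program: `h` is the integer part of the `r`-th root of `n`, groups have `h ^ 2` nodes, moduli
are between `C₁ * h ^ 3` and twice this number, and there are `C₂ * h` repetitions. -/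
def triangleProgram (O : Oracle) (r C₁ C₂ : ℕ) : Cmd := block
  [assign 4 (var 0),
    assign 0 (const 0),
    assign 10 (var 4 * var 4),
    assign 5 (const 1),
    forTo 11 4 (assign 5 (cond (lt (var 4) (powE (var 5 + const 1) r)) (var 5)
      (var 5 + const 1))),
    assign 6 (var 5 * var 5),
    assign 7 (const C₁ * var 5 * var 5 * var 5),
    assign 8 (const C₂ * var 5),
    assign 9 (var 4 / var 6 + const 1),
    forTo 11 9 (groupBody O)]

/-- A run of the program on an instance `I`, after the choice of the parameters: groups have `g`
nodes, moduli are between `M` and `2 * M`, there are `R` repetitions and `G` groups. All numbers that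
occur in variables and arrays are below `X`. The numbers `Tp`, `Tu` and `Tq` bound the running times of
the oracle. -/
structure Setting where
  O : Oracle
  tpre : ℕ → ℕ → ℕ → ℕ
  tupd : ℕ → ℕ → ℕ
  tqry : ℕ → ℕ → ℕ
  c : ℕ
  serves : Serves O tpre tupd tqry c
  I : Inst
  g : ℕ
  M : ℕ
  R : ℕ
  G : ℕ
  B : ℕ
  X : ℕ
  D : ℕ
  room : Room B X D
  depth : 64 ≤ D
  Tp : ℕ
  Tu : ℕ
  Tq : ℕ
  n_pos : 1 ≤ I.n
  g_pos : 1 ≤ g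
  M_pos : 1 ≤ M
  names_pre : NamesLt X O.pre
  names_upd : NamesLt X O.upd
  names_qry : NamesLt X O.qry
  lt_X : 64 < X
  word_le : ∀ q < 2 * M, (numVerts (I.n * q + I.n) g (q + 2) + 2) ^ c ≤ X
  size_lt : ∀ q < 2 * M, numVerts (I.n * q + I.n) g (q + 2) < X
  edges_lt : ∀ q < 2 * M, (I.n * q + I.n) * g < X
  sq_lt : I.n * I.n < X
  M_lt : 2 * M < X
  R_lt : R < X
  G_lt : G < X
  clk_lt : G * R * (I.n * I.n + 1) < X
  time_le : ∀ q, M ≤ q → q < 2 * M →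
    tpre (numVerts (I.n * q + I.n) g (q + 2)) ((I.n * q + I.n) * g) (I.n * q + I.n) ≤ Tp ∧
      tupd (numVerts (I.n * q + I.n) g (q + 2)) 2 ≤ Tu ∧ tqry (numVerts (I.n * q + I.n) g (q + 2)) 2 ≤ Tq

namespace Setting

variable (S : Setting)

/-- The variables and arrays that are fixed once the parameters are computed -/
structure Static (σ : State) : Prop where
  r4 : σ.reg 4 = S.I.n
  r6 : σ.reg 6 = S.g
  r7 : σ.reg 7 = S.M
  r8 : σ.reg 8 = S.R
  r9 : σ.reg 9 = S.G
  r10 : σ.reg 10 = S.I.n * S.I.n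
  a0 : σ.arr 0 = S.I.adj
  a1 : σ.arr 1 = S.I.pos
  a2 : σ.arr 2 = S.I.neg

variable {S}

theorem Static.congr {σ σ' : State} (h : S.Static σ) (hr : ∀ x < 11, σ'.reg x = σ.reg x)
    (ha : ∀ a < 3, σ'.arr a = σ.arr a) : S.Static σ' := by
  refine ⟨?_, ?_, ?_, ?_, ?_, ?_, ?_, ?_, ?_⟩
  · rw [hr 4 (by norm_num), h.r4]
  · rw [hr 6 (by norm_num), h.r6]
  · rw [hr 7 (by norm_num), h.r7]
  · rw [hr 8 (by norm_num), h.r8]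
  · rw [hr 9 (by norm_num), h.r9]
  · rw [hr 10 (by norm_num), h.r10]
  · rw [ha 0 (by norm_num), h.a0]
  · rw [ha 1 (by norm_num), h.a1]
  · rw [ha 2 (by norm_num), h.a2]

variable (S)

/-- The variables that are fixed once the modulus `q` is drawn for group `γ` -/
structure Modulus (γ q : ℕ) (σ : State) : Prop where
  static : S.Static σ
  r11 : σ.reg 11 = γ
  r13 : σ.reg 13 = q
  r14 : σ.reg 14 = S.I.n * q + S.I.n
  r15 : σ.reg 15 = (S.I.n * q + S.I.n) * S.g
  r17 : σ.reg 17 = S.I.n * q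

variable {S}

theorem Modulus.congr {γ q : ℕ} {σ σ' : State} (h : S.Modulus γ q σ)
    (hr : ∀ x < 30, σ'.reg x = σ.reg x) (ha : ∀ a < 3, σ'.arr a = σ.arr a) :
    S.Modulus γ q σ' := by
  refine ⟨h.static.congr (fun x hx => hr x (by omega)) ha, ?_, ?_, ?_, ?_, ?_⟩
  · rw [hr 11 (by norm_num), h.r11]
  · rw [hr 13 (by norm_num), h.r13]
  · rw [hr 14 (by norm_num), h.r14]
  · rw [hr 15 (by norm_num), h.r15]
  · rw [hr 17 (by norm_num), h.r17]

theorem Modulus.loose {γ q : ℕ} {b : Bool} {σ σ' : State} (h : S.Modulus γ q σ)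
    (hl : Loose b σ σ') : S.Modulus γ q σ' :=
  h.congr hl.reg fun a ha => hl.arr a (by omega)

end Setting

/-! ### Writing the input for the oracle -/

/-- The input of the preprocessing phase with only the first `e₁` edges and the first `e₂` vertices
of the predicted set -/
def partialState (d g p : ℕ) (z : ℕ → ℕ → ℕ) (e₁ e₂ : ℕ) : State where
  reg x := if x = 0 then numVerts d g p else if x = 1 then d * g else if x = 2 then d
    else if x = 3 then d else 0
  arr a i :=
    if a = 0 then (if i < e₁ then i / g else 0)
    else if a = 1 then (if i < e₁ then elt d p (i % g) (z (i / g) (i % g)) else 0)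
    else if a = 2 then (if i < e₂ then i else 0)
    else 0

theorem partialState_edge (d g p : ℕ) (z : ℕ → ℕ → ℕ) (e : ℕ) :
    ((partialState d g p z e 0).setCell 0 e (e / g)).setCell 1 e
      (elt d p (e % g) (z (e / g) (e % g))) = partialState d g p z (e + 1) 0 := by
  refine State.ext' (fun x => rfl) (fun a i => ?_)
  rw [setCell_arr, setCell_arr]
  by_cases ha : a = 1
  · subst ha
    simp only [partialState, Function.update_apply, if_true, one_ne_zero, if_false]
    by_cases hi : i = e
    · subst hi
      simp
    · have : i < e ↔ i < e + 1 := by omega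
      simp [hi, this]
  · by_cases ha0 : a = 0
    · subst ha0
      simp only [partialState, Function.update_apply, if_true, zero_ne_one, if_false]
      by_cases hi : i = e
      · subst hi
        simp
      · have : i < e ↔ i < e + 1 := by omega
        simp [hi, this]
    · simp [partialState, ha, ha0]

theorem partialState_set (d g p : ℕ) (z : ℕ → ℕ → ℕ) (e₁ e : ℕ) :
    (partialState d g p z e₁ e).setCell 2 e e = partialState d g p z e₁ (e + 1) := by
  refine State.ext' (fun x => rfl) (fun a i => ?_)
  rw [setCell_arr]
  by_cases ha : a = 2
  · subst ha
    simp only [partialState, Function.update_apply, if_true, OfNat.ofNat_ne_zero, if_false,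
      OfNat.ofNat_ne_one]
    by_cases hi : i = e
    · subst hi
      simp
    · have : i < e ↔ i < e + 1 := by omega
      simp [hi, this]
  · simp [partialState, ha]

namespace Setting

variable {S : Setting}

theorem fits_edge (e : Expr) (h : e.Tame S.X) (h' : e.size ≤ 64) : e.Fits S.X S.D :=
  ⟨h, h'.trans S.depth⟩

/-- One round of the loop over the edges -/
theorem wp_edgeBody {γ q e : ℕ} {σ : State} (hq : 1 ≤ q) (hq' : q < 2 * S.M)
    (hσ : S.Modulus γ q σ) (h30 : σ.reg 30 = e) (he : e < (S.I.n * q + S.I.n) * S.g)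
    (hr : Ready false σ)
    (hv : view σ = partialState (S.I.n * q + S.I.n) S.g (q + 2) (S.I.elem S.g γ q) e 0) {K : ℝ≥0∞} :
    WP S.B S.X [edgeBody, incr 30] 300 σ
      (fun σ' => Loose false σ σ' ∧ σ'.reg 30 = e + 1 ∧
        view σ' = partialState (S.I.n * q + S.I.n) S.g (q + 2) (S.I.elem S.g γ q) (e + 1) 0)
      (fun _ => K) K := by
  have hX := S.lt_X
  have hn := S.n_pos
  have hg := S.g_pos
  have hst := hσ.static
  have hdX := S.size_lt q hq'
  have hmX := S.edges_lt q hq'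
  simp only [numVerts] at hdX
  set u := e / S.g with hu
  set t := e % S.g with ht
  set c := S.I.node S.g γ t with hc
  have hud : u < S.I.n * q + S.I.n := (Nat.div_lt_iff_lt_mul hg).2 he
  have htg : t < S.g := Nat.mod_lt _ hg
  have hcn : c < S.I.n := Nat.mod_lt _ hn
  set ix := if u < S.I.n * q then u / q * S.I.n + c else (u - S.I.n * q) * S.I.n + c with hix
  have hixX : ix < S.X := by
    have key : ∀ a, a < S.I.n → a * S.I.n + c < S.X := by
      intro a ha
      have h1 : (a + 1) * S.I.n ≤ S.I.n * S.I.n := Nat.mul_le_mul_right _ ha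
      have := S.sq_lt
      nlinarith
    rw [hix]
    split_ifs with h
    · exact key _ (Nat.div_lt_of_lt_mul (by rw [mul_comm]; exact h))
    · exact key _ (by omega)
  have hz := S.I.elem_lt hq S.g γ u t
  have helt : elt (S.I.n * q + S.I.n) (q + 2) t (S.I.elem S.g γ q u t) < S.X :=
    (elt_lt htg hz).trans (S.size_lt q hq')
  have hM := S.M_lt
  have hX2 : 2 < S.X := by omega
  refine WP.time_mono (WP.block
    (WP.assign_eq S.room u (by norm_num) (fits_edge _ (by simp) (by simp))
      (by simp [h30, hst.r6, hu]) (fun _ => by omega)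
    (WP.assign_eq S.room c (by norm_num) (fits_edge _ (by simp) (by simp))
      (by simp [h30, hst.r6, hst.r4, hσ.r11, hc, Inst.node, ht]) (fun _ => by omega)
    (WP.assign_eq S.room ix (by norm_num) (fits_edge _ (by simp) (by simp))
      (by simp [hσ.r17, hst.r4, hσ.r13, hix]) (fun _ => hixX)
    (WP.assign_eq S.room (S.I.elem S.g γ q u t) (by norm_num)
      (fits_edge _ (by simp [resE, nresE]; omega) (by simp [resE, nresE]))
      ?_ (fun _ => by omega)
    (WP.write_eq S.room e u (fits_edge _ (by simp) (by simp)) (fits_edge _ (by simp) (by simp))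
      (by simp [h30]) (by simp) (fun _ => by omega)
    (WP.write_eq S.room e (elt (S.I.n * q + S.I.n) (q + 2) t (S.I.elem S.g γ q u t))
      (fits_edge _ (by simp) (by simp)) (fits_edge _ (by simp; omega) (by simp))
      (by simp [h30]) (by simp [h30, hst.r6, hσ.r13, hσ.r14, elt, ht]) (fun _ => helt)
    (WP.incr S.room (by have := S.depth; omega) (by norm_num) (fun _ => ?_)
      (WP.nil (t := 0) ?_ le_rfl))))))))) ?_
  · have hif : ix = (if u < S.I.n * q then u / q * S.I.n + c else (u - S.I.n * q) * S.I.n + c) := rfl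
    by_cases h : u < S.I.n * q
    · rw [if_pos h] at hif
      simp [resE, hσ.r17, hσ.r13, hst.a0, hst.a1, hst.a2, Inst.elem, h, ← hc, ← hif,
        Inst.res]
    · rw [if_neg h] at hif
      simp [nresE, hσ.r17, hσ.r13, hst.a0, hst.a1, hst.a2, Inst.elem, h, ← hc, ← hif,
        Inst.nres]
  · have := S.edges_lt q hq'
    simp [h30]
    omega
  · set σ₁ := (((σ.setReg 33 u).setReg 35 c).setReg 34 ix).setReg 36 (S.I.elem S.g γ q u t)
      with hσ₁
    have hl₁ : Loose false σ σ₁ :=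
      ((((Loose.refl _ _).setReg (by norm_num) (by norm_num)).setReg (by norm_num)
        (by norm_num)).setReg (by norm_num) (by norm_num)).setReg (by norm_num) (by norm_num)
    have hv₁ : view σ₁ = view σ := by
      simp only [hσ₁]
      rw [view_setReg (by norm_num), view_setReg (by norm_num), view_setReg (by norm_num),
        view_setReg (by norm_num)]
    have hl₂ := hl₁.written 1 e u
    refine ⟨(hl₂.written _ _ _).setReg (by norm_num) (by norm_num), by simp [hσ₁, h30], ?_⟩
    rw [view_setReg (by norm_num), view_written_cell (hl₂.ready hr),
      view_written_cell (hl₁.ready hr), hv₁, hv]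
    exact partialState_edge _ _ _ _ _
  · simp [resE, nresE]

end Setting

end ExactTriangle

namespace WordRAM

/-- No stamp is ahead of the clock of its layer. -/
def Stamps (σ : State) : Prop := ∀ b α i, σ.arr (stampArr b α) i ≤ σ.reg (clk b)

theorem Loose.stamps {b : Bool} {σ σ' : State} (h : Loose b σ σ') (hs : Stamps σ) : Stamps σ' := by
  intro b' α i
  by_cases hb : b' = b
  · subst hb
    exact h.stamp (hs b') α i
  · have hb' : b' = !b := by cases b <;> cases b' <;> simp_all
    subst hb'
    rw [h.other_stamp, h.clk]
    exact hs _ α i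

theorem view_eq_lower {σ : State} (h : ∀ α i, σ.arr (stampArr true α) i ≠ σ.reg (clk true)) :
    view σ = ofLay (lower σ) := by
  simp only [view]
  congr 1
  funext α i
  rw [lay, if_neg (h α i)]

theorem view_eq_zero {σ : State} (h : ∀ b α i, σ.arr (stampArr b α) i ≠ σ.reg (clk b)) :
    view σ = State.zero := by
  rw [view_eq_lower (h true)]
  have : lower σ = fun _ _ => 0 := by
    funext α i
    rw [lower, if_neg (h false α i)]
  rw [this]
  rfl

end WordRAM

namespace ExactTriangle

open WordRAM SlotGraph VertexFailure Expr

namespace Setting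

variable {S : Setting}

/-! ### Preprocessing -/

theorem partialState_zero (d g p : ℕ) (z : ℕ → ℕ → ℕ) :
    (((State.zero.setReg 0 (numVerts d g p)).setReg 1 (d * g)).setReg 2 d).setReg 3 d =
      partialState d g p z 0 0 := by
  refine State.ext' (fun x => ?_) (fun a i => ?_)
  · simp only [setReg_reg, partialState, State.zero]
    by_cases h0 : x = 0 <;> by_cases h1 : x = 1 <;> by_cases h2 : x = 2 <;>
      by_cases h3 : x = 3 <;> simp_all
  · simp [partialState, State.zero]

/-- From the draw of the modulus `q` to the end of the preprocessing. Advancing both clocks clears the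
simulated memory, and then the input of the oracle is written into the lower layer. -/
theorem wp_prepare {γ q : ℕ} {σ : State} (hq : S.M ≤ q) (hq' : q < 2 * S.M) (hσ : S.Static σ)
    (h11 : σ.reg 11 = γ) (h13 : σ.reg 13 = q) (hs : Stamps σ) (h58 : σ.reg 58 + 1 < S.X)
    (h59 : σ.reg 59 + 1 < S.X) {l : List Cmd} {t : ℕ} {Q : State → Prop} {f : State → ℝ≥0∞}
    (F : State → ℝ≥0∞) {E : ℝ≥0∞}
    (h : ∀ σ', S.Modulus γ q σ' → (∀ x < 13, σ'.reg x = σ.reg x) → σ'.reg 58 = σ.reg 58 + 1 →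
      σ'.reg 59 = σ.reg 59 + 1 → σ'.arr 3 = σ.arr 3 → Stamps σ' →
      ofLay (lower σ') ∈ (exec S.O.pre (S.tpre (numVerts (S.I.n * q + S.I.n) S.g (q + 2))
        ((S.I.n * q + S.I.n) * S.g) (S.I.n * q + S.I.n))
        (preState (S.I.n * q + S.I.n) S.g (q + 2) (S.I.elem S.g γ q))).support →
      WP S.B S.X l t σ' Q f (F (ofLay (lower σ'))))
    (hE : expect (exec S.O.pre (S.tpre (numVerts (S.I.n * q + S.I.n) S.g (q + 2))
        ((S.I.n * q + S.I.n) * S.g) (S.I.n * q + S.I.n))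
        (preState (S.I.n * q + S.I.n) S.g (q + 2) (S.I.elem S.g γ q))) F ≤ E) :
    WP S.B S.X
      (assign 17 (var 4 * var 13) :: assign 14 (var 17 + var 4) :: assign 15 (var 14 * var 6) ::
        assign 16 (var 14 + var 6 * (var 13 + const 2)) :: incr 58 :: incr 59 ::
        write false 0 (const 0) (var 16) :: write false 0 (const 1) (var 15) ::
        write false 0 (const 2) (var 14) :: write false 0 (const 3) (var 14) ::
        forTo 30 15 edgeBody :: forTo 30 14 (write false 3 (var 30) (var 30)) ::
        tr false S.O.pre :: l)
      (200 * S.Tp + 600 * ((S.I.n * q + S.I.n) * S.g) + 600 + t) σ Q f E := by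
  have hX := S.lt_X
  have hn := S.n_pos
  have hg := S.g_pos
  have hM := S.M_pos
  have hD := S.depth
  have hq1 : 1 ≤ q := hM.trans hq
  set d := S.I.n * q + S.I.n with hd
  set N := numVerts d S.g (q + 2) with hN
  set z := S.I.elem S.g γ q with hz
  have hd1 : 1 ≤ d := by omega
  have hNX : N < S.X := S.size_lt q hq'
  have hdN : d ≤ N := Nat.le_add_right _ _
  have hmX : d * S.g < S.X := S.edges_lt q hq'
  have hpre := (S.serves d S.g (q + 2) z hd1 (S.I.elem_lt hq1 S.g γ)).1
  have hB₀ := S.word_le q hq'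
  have hTp := (S.time_le q hq hq').1
  -- the memory when the parameters of the oracle graph are known and the layers are cleared
  set σ₁ := (((((σ.setReg 17 (S.I.n * q)).setReg 14 d).setReg 15 (d * S.g)).setReg 16 N).setReg 58
    (σ.reg 58 + 1)).setReg 59 (σ.reg 59 + 1) with hσ₁
  have hst₁ : ∀ b α i, σ₁.arr (stampArr b α) i < σ₁.reg (clk b) := by
    intro b α i
    have := hs b α i
    cases b
    · simp only [hσ₁, setReg_arr, clk]
      simp [clk] at this ⊢
      omega
    · simp only [hσ₁, setReg_arr, clk]
      simp [clk] at this ⊢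
      omega
  have hready₁ : Ready false σ₁ := Or.inr fun α i => (hst₁ true α i).ne
  have hview₁ : view σ₁ = State.zero := view_eq_zero fun b α i => (hst₁ b α i).ne
  have hmod₁ : S.Modulus γ q σ₁ := by
    refine ⟨hσ.congr (fun x hx => ?_) (fun a _ => rfl), ?_, ?_, ?_, ?_, ?_⟩
    · simp only [hσ₁, setReg_reg]
      rw [if_neg (by omega), if_neg (by omega), if_neg (by omega), if_neg (by omega),
        if_neg (by omega), if_neg (by omega)]
    all_goals simp [hσ₁, h11, h13, hd]
  -- the memory when the registers of the oracle are set
  set w₁ := written false σ₁ 0 0 N with hw₁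
  set w₂ := written false w₁ 0 1 (d * S.g) with hw₂
  set w₃ := written false w₂ 0 2 d with hw₃
  set w₄ := written false w₃ 0 3 d with hw₄
  have l₁ : Loose false σ₁ w₁ := (Loose.refl _ _).written _ _ _
  have l₂ : Loose false σ₁ w₂ := l₁.written _ _ _
  have l₃ : Loose false σ₁ w₃ := l₂.written _ _ _
  have l₄ : Loose false σ₁ w₄ := l₃.written _ _ _
  have hview₄ : view w₄ = partialState d S.g (q + 2) z 0 0 := by
    rw [hw₄, view_written_reg (l₃.ready hready₁), hw₃, view_written_reg (l₂.ready hready₁), hw₂,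
      view_written_reg (l₁.ready hready₁), hw₁, view_written_reg hready₁, hview₁]
    exact partialState_zero _ _ _ _
  have r15 : ∀ σ', Loose false σ₁ σ' → σ'.reg 15 = d * S.g := fun σ' hl => by
    rw [hl.reg 15 (by norm_num)]
    exact hmod₁.r15
  have r14 : ∀ σ', Loose false σ₁ σ' → σ'.reg 14 = d := fun σ' hl => by
    rw [hl.reg 14 (by norm_num)]
    exact hmod₁.r14
  set rest : List Cmd := forTo 30 15 edgeBody ::
    forTo 30 14 (write false 3 (var 30) (var 30)) :: tr false S.O.pre :: l with hrest
  set T := d * S.g * (300 + 8) + 15 + (d * (40 + 8) + 15 + (200 * S.Tp + t)) with hT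
  have start : WP S.B S.X rest T w₄ Q f E → WP S.B S.X
      (assign 17 (var 4 * var 13) :: assign 14 (var 17 + var 4) :: assign 15 (var 14 * var 6) ::
        assign 16 (var 14 + var 6 * (var 13 + const 2)) :: incr 58 :: incr 59 ::
        write false 0 (const 0) (var 16) :: write false 0 (const 1) (var 15) ::
        write false 0 (const 2) (var 14) :: write false 0 (const 3) (var 14) :: rest)
      (T + 100) σ Q f E := fun h => WP.time_mono
    (WP.assign_eq S.room (S.I.n * q) (by norm_num) (fits_edge _ (by simp) (by simp))
      (by simp [hσ.r4, h13]) (fun _ => by omega)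
    (WP.assign_eq S.room d (by norm_num) (fits_edge _ (by simp) (by simp))
      (by simp [hσ.r4, hd]) (fun _ => by omega)
    (WP.assign_eq S.room (d * S.g) (by norm_num) (fits_edge _ (by simp) (by simp))
      (by simp [hσ.r6]) (fun _ => hmX)
    (WP.assign_eq S.room N (by norm_num) (fits_edge _ (by simp; omega) (by simp))
      (by simp [hσ.r6, h13, hN, numVerts]) (fun _ => hNX)
    (WP.incr S.room (by omega) (by norm_num) (fun _ => by simpa using h58)
    (WP.incr S.room (by omega) (by norm_num) (fun _ => by simpa using h59)
    (WP.write_eq S.room 0 N (fits_edge _ (by simp; omega) (by simp))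
      (fits_edge _ (by simp) (by simp)) (by simp) (by simp) (fun _ => hNX)
    (WP.write_eq S.room 1 (d * S.g) (fits_edge _ (by simp; omega) (by simp))
      (fits_edge _ (by simp) (by simp)) (by simp) (by simp) (fun _ => hmX)
    (WP.write_eq S.room 2 d (fits_edge _ (by simp; omega) (by simp))
      (fits_edge _ (by simp) (by simp)) (by simp) (by simp) (fun _ => by omega)
    (WP.write_eq S.room 3 d (fits_edge _ (by simp; omega) (by simp))
      (fits_edge _ (by simp) (by simp)) (by simp) (by simp) (fun _ => by omega) h))))))))))
    (by simp; omega)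
  refine (start (WP.forTo S.room (t := d * (40 + 8) + 15 + (200 * S.Tp + t)) (by omega)
    (by norm_num) (by norm_num) (d * S.g) 300
    (fun e σ' => Loose false σ₁ σ' ∧ σ'.reg 30 = e ∧
      view σ' = partialState d S.g (q + 2) z e 0) (fun _ _ => E)
    (fun e he σ' hI => ⟨hI.2.1, r15 σ' hI.1⟩) ?init le_rfl ?body fun σ₂ hb₂ hI₂ =>
    WP.forTo S.room (t := 200 * S.Tp + t) (by omega) (by norm_num) (by norm_num)
    d 40 (fun e σ' => Loose false σ₁ σ' ∧ σ'.reg 30 = e ∧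
      view σ' = partialState d S.g (q + 2) z (d * S.g) e) (fun _ _ => E)
    (fun e he σ' hI => ⟨hI.2.1, r14 σ' hI.1⟩) ?init2 le_rfl ?body2 fun σ₃ hb₃ hI₃ =>
    (WP.simulate S.room (t' := t) (by omega) hB₀ F S.names_pre (hI₃.1.ready hready₁)
    hI₃.2.2 hpre ?fin hE).time_mono (Nat.add_le_add_right (Nat.mul_le_mul_left 200 hTp) t))).time_mono ?time
  case time =>
    have : d ≤ d * S.g := Nat.le_mul_of_pos_right _ hg
    omega
  case init =>
    refine ⟨l₄.setReg (by norm_num) (by norm_num), by simp, ?_⟩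
    rw [view_setReg (by norm_num)]
    exact hview₄
  case body =>
    intro e he σ' _ hI
    refine (wp_edgeBody hq1 hq' (hmod₁.loose hI.1) hI.2.1 he (hI.1.ready hready₁) hI.2.2).mono
      le_rfl (fun σ'' _ h => ⟨hI.1.trans h.1, h.2⟩) (fun _ _ _ => le_rfl) le_rfl
  case init2 =>
    refine ⟨hI₂.1.setReg (by norm_num) (by norm_num), by simp, ?_⟩
    rw [view_setReg (by norm_num)]
    exact hI₂.2.2
  case body2 =>
    intro e he σ' _ hI
    refine WP.time_mono (WP.write_eq S.room e e (fits_edge _ (by simp) (by simp))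
      (fits_edge _ (by simp) (by simp)) (by simp [hI.2.1]) (by simp [hI.2.1]) (fun _ => by omega)
      (WP.incr S.room (by omega) (by norm_num) (fun _ => ?_) (WP.nil (t := 0) ?_ le_rfl))) (by simp)
    · simp [hI.2.1]
      omega
    · refine ⟨(hI.1.written _ _ _).setReg (by norm_num) (by norm_num), by simp [hI.2.1], ?_⟩
      rw [view_setReg (by norm_num), view_written_cell (hI.1.ready hready₁), hI.2.2]
      exact partialState_set _ _ _ _ _ _
  case fin =>
    intro σ' hf hv
    have hl : Loose false σ₁ σ' := hI₃.1.trans hf.loose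
    have hnot : ∀ α i, σ'.arr (stampArr true α) i ≠ σ'.reg (clk true) := by
      rcases hl.ready hready₁ with h' | h'
      · exact absurd h' (by simp)
      · exact h'
    have hview := view_eq_lower hnot
    rw [hview] at hv ⊢
    refine h σ' (hmod₁.loose hl) (fun x hx => ?_) ?_ ?_ ?_
      (hl.stamps fun b α i => (hst₁ b α i).le) hv
    · rw [hl.reg x (by omega)]
      simp only [hσ₁, setReg_reg]
      rw [if_neg (by omega), if_neg (by omega), if_neg (by omega), if_neg (by omega),
        if_neg (by omega), if_neg (by omega)]
    · have := hl.clk false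
      simp [clk] at this
      rw [this]
      simp [hσ₁]
    · have := hl.clk true
      simp [clk] at this
      rw [this]
      simp [hσ₁]
    · rw [hl.arr 3 (by norm_num)]
      rfl

end Setting

end ExactTriangle

/-! ### One pair -/

namespace ExactTriangle

open WordRAM SlotGraph VertexFailure Expr

namespace Setting

variable {S : Setting}

variable (S) in
/-- The memory of the oracle after the preprocessing with modulus `q` for the group `γ` -/
noncomputable def prepared (γ q : ℕ) : PMF State :=
  exec S.O.pre (S.tpre (numVerts (S.I.n * q + S.I.n) S.g (q + 2))
    ((S.I.n * q + S.I.n) * S.g) (S.I.n * q + S.I.n))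
    (preState (S.I.n * q + S.I.n) S.g (q + 2) (S.I.elem S.g γ q))

variable (S) in
/-- The memory of the oracle after the update for the pair at position `j`, from memory `s` -/
noncomputable def updated (q j : ℕ) (s : State) : PMF State :=
  exec S.O.upd (S.tupd (numVerts (S.I.n * q + S.I.n) S.g (q + 2)) 2)
    (updState s (S.I.left q j) (S.I.right q j))

variable (S) in
/-- The memory of the oracle after the query for the pair at position `j`, from memory `s` -/
noncomputable def queried (q j : ℕ) (s : State) : PMF State :=
  exec S.O.qry (S.tqry (numVerts (S.I.n * q + S.I.n) S.g (q + 2)) 2)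
    (qryState s (S.I.left q j) (S.I.right q j))

variable (S) in
open Classical in
/-- The counts of positive answers when the pair at position `j` is answered by the memory `s` -/
noncomputable def tally (j : ℕ) (cnt : ℕ → ℕ) (s : State) : ℕ → ℕ :=
  Function.update cnt j (cnt j + if S.I.adj j = 1 ∧ s.reg 0 = 1 then 1 else 0)

/-- What is preserved between the queries for two pairs -/
structure Between (γ q j : ℕ) (σ : State) (c58 c59 : ℕ) (s₁ : State) : Prop where
  modulus : S.Modulus γ q σ
  r30 : σ.reg 30 = j
  r58 : σ.reg 58 = c58
  r59 : σ.reg 59 = c59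
  stamps : Stamps σ
  lower : ofLay (lower σ) = s₁

/-- One pair: the upper layer is cleared, which restores the memory `s₁` of the oracle after the
preprocessing, then the update and the query are simulated and the answer is counted. -/
theorem wp_pairBody {γ q j c58 c59 : ℕ} {σ s₁ : State} (hq : 1 ≤ q) (hq' : q < 2 * S.M)
    (hj : j < S.I.n * S.I.n) (hσ : S.Between γ q j σ c58 c59 s₁) (h59 : c59 + 1 < S.X)
    (hM : S.M ≤ q) (hs₁ : s₁ ∈ (S.prepared γ q).support) (hc : σ.arr 3 j + 1 < S.X)
    (Ψ : (ℕ → ℕ) → ℝ≥0∞) {E : ℝ≥0∞}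
    (hE : expect (S.updated q j s₁) (fun s₂ => expect (S.queried q j s₂) fun s =>
      Ψ (S.tally j (σ.arr 3) s)) ≤ E) :
    WP S.B S.X [pairBody S.O, incr 30] (200 * S.Tu + 200 * S.Tq + 300) σ
      (fun σ' => S.Between γ q (j + 1) σ' c58 (c59 + 1) s₁ ∧ (∀ x < 30, σ'.reg x = σ.reg x) ∧
        ∃ s, σ'.arr 3 = S.tally j (σ.arr 3) s)
      (fun σ' => Ψ (σ'.arr 3)) E := by
  classical
  have hX := S.lt_X
  have hn := S.n_pos
  have hD := S.depth
  have hst := hσ.modulus.static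
  have h13 := hσ.modulus.r13
  have h17 := hσ.modulus.r17
  have h30 := hσ.r30
  set d := S.I.n * q + S.I.n with hd
  set N := numVerts d S.g (q + 2) with hN
  set u := S.I.left q j with hu
  set v := S.I.right q j with hv
  have hul : u < S.I.n * q := S.I.left_lt hq hj
  have hvl : v < d := by
    have : j % S.I.n < S.I.n := Nat.mod_lt _ hn
    simp only [hv, Inst.right, hd]
    omega
  have huv : u ≠ v := by
    have : S.I.n * q ≤ v := Nat.le_add_right _ _
    omega
  have hNX : N < S.X := S.size_lt q hq'
  have hdN : d ≤ N := Nat.le_add_right _ _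
  have hjX := S.sq_lt
  have hB₀ := S.word_le q hq'
  obtain ⟨_, hTu, hTq⟩ := S.time_le q hM hq'
  have hserve := ((S.serves d S.g (q + 2) (S.I.elem S.g γ q) (by omega)
    (S.I.elem_lt hq S.g γ)).2 u v (by omega) hvl huv).1 s₁ hs₁
  -- the memory with the upper layer cleared
  set σ₁ := ((σ.setReg 33 u).setReg 34 v).setReg 59 (σ.reg 59 + 1) with hσ₁
  have hmod₁ : S.Modulus γ q σ₁ := hσ.modulus.congr (fun x hx => by
    simp only [hσ₁, setReg_reg]
    rw [if_neg (by omega), if_neg (by omega), if_neg (by omega)]) fun _ _ => rfl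
  have hst₁ : Stamps σ₁ := by
    intro b α i
    have := hσ.stamps b α i
    cases b
    · simpa [hσ₁, clk] using this
    · simp [hσ₁, clk] at this ⊢
      omega
  have hlow₁ : lower σ₁ = lower σ := by
    funext α i
    simp [lower, hσ₁, clk]
  have hview₁ : view σ₁ = s₁ := by
    rw [view_eq_lower fun α i => ?_, hlow₁, hσ.lower]
    · have := hσ.stamps true α i
      simp [hσ₁, clk] at this ⊢
      omega
  have hready : Ready true σ₁ := Or.inl rfl
  have hr : ∀ σ' : State, Ready true σ' := fun _ => Or.inl rfl
  set w₁ := written true (written true (written true σ₁ 0 0 2) 4 0 u) 4 1 v with hw₁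
  have l₁ : Loose true σ₁ w₁ := (((Loose.refl _ _).written _ _ _).written _ _ _).written _ _ _
  have hview₂ : view w₁ = updState s₁ u v := by
    rw [hw₁, view_written_cell (hr _), view_written_cell (hr _), view_written_reg (hr _), hview₁]
    rfl
  have r33 : w₁.reg 33 = u := by simp [hw₁, hσ₁]
  have r34 : w₁.reg 34 = v := by simp [hw₁, hσ₁]
  refine WP.time_mono (WP.block (t := 200 * S.Tu + 200 * S.Tq + 250)
    (WP.time_mono (WP.assign_eq S.room u (by norm_num) (fits_edge _ (by simp [resE])
        (by simp [resE])) (by simp [resE, h30, hst.r4, h13, hst.a1, hst.a2, hu, Inst.left, Inst.res])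
        (fun _ => by omega)
    (WP.assign_eq S.room v (by norm_num) (fits_edge _ (by simp) (by simp))
        (by simp [h30, hst.r4, h17, hv, Inst.right]) (fun _ => by omega)
    (WP.incr S.room (by omega) (by norm_num) (fun _ => by simpa [hσ.r59] using h59)
    (WP.write_eq S.room 0 2 (fits_edge _ (by simp; omega) (by simp))
      (fits_edge _ (by simp; omega) (by simp)) (by simp) (by simp) (fun _ => by omega)
    (WP.write_eq S.room 0 u (fits_edge _ (by simp; omega) (by simp))
      (fits_edge _ (by simp) (by simp)) (by simp) (by simp) (fun _ => by omega)
    (WP.write_eq S.room 1 v (t := 200 * S.Tu + (200 * S.Tq + 150))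
      (fits_edge _ (by simp; omega) (by simp))
      (fits_edge _ (by simp) (by simp)) (by simp) (by simp) (fun _ => by omega)
    ?upd)))))) (by simp [resE]; omega))) (by simp; omega)
  refine (WP.simulate S.room (t' := 200 * S.Tq + 150) (by omega) hB₀ (fun s₂ =>
    expect (S.queried q j s₂) fun s => Ψ (S.tally j (σ.arr 3) s)) S.names_upd (hr _) hview₂
    hserve.1 (fun w₂ hf₂ hv₂ => ?_) hE).time_mono
    (Nat.add_le_add_right (Nat.mul_le_mul_left 200 hTu) _)
  have l₂ : Loose true σ₁ w₂ := l₁.trans hf₂.loose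
  set w₃ := written true (written true w₂ 0 0 u) 0 1 v with hw₃
  have l₃ : Loose true σ₁ w₃ := (l₂.written _ _ _).written _ _ _
  have hview₃ : view w₃ = qryState (view w₂) u v := by
    rw [hw₃, view_written_reg (hr _), view_written_reg (hr _)]
    rfl
  have e33 : w₂.reg 33 = u := (hf₂.reg 33 (by norm_num)).trans r33
  have e34 : w₂.reg 34 = v := (hf₂.reg 34 (by norm_num)).trans r34
  refine WP.time_mono (WP.write_eq S.room 0 u (fits_edge _ (by simp; omega) (by simp))
    (fits_edge _ (by simp) (by simp)) (by simp) (by simp [e33]) (fun _ => by omega)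
  (WP.write_eq S.room 1 v (t := 200 * S.Tq + 130) (fits_edge _ (by simp; omega) (by simp))
    (fits_edge _ (by simp) (by simp)) (by simp) (by simp [e34]) (fun _ => by omega)
    ?qry)) (by simp; omega)
  refine (WP.simulate S.room (t' := 130) (by omega) hB₀ (fun s => Ψ (S.tally j (σ.arr 3) s))
    S.names_qry (hr _) hview₃
    (hserve.2 _ hv₂) (fun w₄ hf₄ hv₄ => ?_) le_rfl).time_mono
    (Nat.add_le_add_right (Nat.mul_le_mul_left 200 hTq) _)
  have l₄ : Loose true σ₁ w₄ := l₃.trans hf₄.loose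
  have hmod₄ := hmod₁.loose l₄
  have e30 : w₄.reg 30 = j := by
    rw [hf₄.reg 30 (by norm_num)]
    simp only [hw₃, written_reg]
    rw [hf₂.reg 30 (by norm_num)]
    simp [hw₁, hσ₁, h30]
  have e3 : w₄.arr 3 = σ.arr 3 := l₄.arr 3 (by norm_num)
  have hrd : (rd 0).Tame S.X := tame_layE (by omega) 0 (by simp only [Expr.Tame]; omega)
  have hval : (cond (eq (load 0 (var 30)) (const 1))
      (load 3 (var 30) + eq (rd 0) (const 1)) (load 3 (var 30)) : Expr).eval w₄ =
      σ.arr 3 j + if S.I.adj j = 1 ∧ (view w₄).reg 0 = 1 then 1 else 0 := by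
    simp only [Expr.eval, eq, Op.eval, eval_rd, e30, hmod₄.static.a0, e3]
    by_cases h1 : S.I.adj j = 1 <;> by_cases h2 : (view w₄).reg 0 = 1 <;> simp [h1, h2]
  refine WP.time_mono (WP.put S.room (fits_edge _ (by simp) (by simp))
    (fits_edge _ (by simp [hrd]; omega) (by simp [rd, size_layE]))
    (fun _ => ?_) (WP.incr S.room (by omega) (by norm_num) (fun _ => ?_)
    (WP.nil (t := 0) ?_ ?_))) (by simp [cost_rd])
  · rw [hval]
    split_ifs <;> omega
  · simp [e30]
    omega
  · rw [hval]
    have hI : (var 30).eval w₄ = j := e30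
    rw [hI]
    have h58 := l₄.clk false
    have h59 := l₄.clk true
    simp [clk, hσ₁] at h58 h59
    refine ⟨⟨hmod₄.congr (fun x hx => ?_) (fun a ha => ?_), ?_, ?_, ?_, ?_, ?_⟩,
      fun x hx => ?_, view w₄, ?_⟩
    · rw [setReg_reg, if_neg (by omega)]
      rfl
    · rw [setReg_arr, setCell_arr, if_neg (by omega)]
    · simp [e30]
    · simp [h58, hσ.r58]
    · simp [h59, hσ.r59]
    · intro b α i
      have := l₄.stamps hst₁ b α i
      have hb : stampArr b α ≠ 3 := by cases b <;> simp [stampArr] <;> omega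
      rw [setReg_arr, setCell_arr, if_neg hb, setReg_reg,
        if_neg (by have := clk_eq b; omega)]
      exact this
    · rw [← hσ.lower, ← hlow₁, ← l₄.lower_eq]
      congr 1
      funext α i
      have h1 : valArr false α ≠ 3 := by simp [valArr]; omega
      have h2 : stampArr false α ≠ 3 := by simp [stampArr]; omega
      simp only [lower, setReg_arr, setCell_arr, if_neg h1, if_neg h2, setReg_reg, clk]
      simp
    · rw [setReg_reg, if_neg (by omega)]
      change w₄.reg x = _
      rw [l₄.reg x hx]
      simp only [hσ₁, setReg_reg]
      rw [if_neg (by omega), if_neg (by omega), if_neg (by omega)]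
    · rw [setReg_arr, setCell_arr, if_pos rfl, e3]
      rfl
  · have hI : (var 30).eval w₄ = j := e30
    rw [hval, hI, setReg_arr, setCell_arr, if_pos rfl, e3]
    rfl

end Setting

end ExactTriangle

/-! ### The potential of the repetitions -/

namespace ExactTriangle

open WordRAM SlotGraph VertexFailure Expr

namespace Setting

variable {S : Setting}

variable (S) in
open Classical in
/-- The number of wrong answers for the pair at position `j` after `ρ` repetitions with `x` positive
answers -/
noncomputable def wrong (γ j ρ x : ℕ) : ℕ := if S.I.Truth S.g γ j then ρ - x else x

variable (S) in
/-- The weight of a pair in the potential -/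
noncomputable def weight (κ : ℝ≥0∞) (γ j ρ x : ℕ) : ℝ≥0∞ := κ * (1 + 1 / 2) ^ S.wrong γ j ρ x

variable (S) in
/-- The potential when, in the repetition `ρ`, the pairs before position `i` have been answered. A pair
that has yet to be answered counts with the factor by which its weight grows in expectation, given the
memory `s₁` of the oracle after the preprocessing. -/
noncomputable def mixed (κ : ℝ≥0∞) (γ q ρ i : ℕ) (s₁ : State) (cnt : ℕ → ℕ) : ℝ≥0∞ :=
  ∑ j ∈ Finset.range (S.I.n * S.I.n), if j < i then S.weight κ γ j (ρ + 1) (cnt j) else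
    S.weight κ γ j ρ (cnt j) *
      (1 + 1 / 2 * pairErr S.I S.O (S.tupd (numVerts (S.I.n * q + S.I.n) S.g (q + 2)) 2)
        (S.tqry (numVerts (S.I.n * q + S.I.n) S.g (q + 2)) 2) S.g γ q j s₁)

variable (S) in
/-- The potential after `ρ` repetitions -/
noncomputable def potential (κ : ℝ≥0∞) (γ ρ : ℕ) (cnt : ℕ → ℕ) : ℝ≥0∞ :=
  ∑ j ∈ Finset.range (S.I.n * S.I.n), S.weight κ γ j ρ (cnt j)

open Classical in
theorem weight_tally_le (κ : ℝ≥0∞) (γ j ρ : ℕ) (cnt : ℕ → ℕ) (s : State) :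
    S.weight κ γ j (ρ + 1) (S.tally j cnt s j) ≤ S.weight κ γ j ρ (cnt j) *
      (1 + 1 / 2 * if S.I.adj j = 1 then (if s.reg 0 = 1 ↔ S.I.Truth S.g γ j then 0 else 1)
        else 0) := by
  have h1 : (1 : ℝ≥0∞) ≤ 1 + 1 / 2 := le_self_add
  have key : ∀ W W' : ℕ, ∀ b : ℝ≥0∞, (W ≤ W' ∨ (W ≤ W' + 1 ∧ b = 1)) →
      κ * (1 + 1 / 2) ^ W ≤ κ * (1 + 1 / 2) ^ W' * (1 + 1 / 2 * b) := by
    rintro W W' b (h | ⟨h, rfl⟩)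
    · refine le_trans (mul_le_mul_right (pow_le_pow_right₀ h1 h) _) ?_
      exact le_mul_of_one_le_right zero_le le_self_add
    · rw [mul_assoc, mul_one, ← pow_succ]
      exact mul_le_mul_right (pow_le_pow_right₀ h1 h) _
  refine key _ _ _ ?_
  simp only [tally, Function.update_self, wrong]
  by_cases ha : S.I.adj j = 1
  · by_cases hr : s.reg 0 = 1 <;> by_cases ht : S.I.Truth S.g γ j <;>
      (simp [ha, hr, ht]; try omega)
  · have ht : ¬ S.I.Truth S.g γ j := fun ht => ha ht.1
    simp [ha, ht]

/-- Answering one pair does not increase the potential in expectation. -/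
theorem expect_mixed_le (A κ : ℝ≥0∞) {γ q ρ j : ℕ} (hj : j < S.I.n * S.I.n) (s₁ : State)
    (cnt : ℕ → ℕ) :
    expect (S.updated q j s₁) (fun s₂ => expect (S.queried q j s₂) fun s =>
      A + S.mixed κ γ q ρ (j + 1) s₁ (S.tally j cnt s)) ≤ A + S.mixed κ γ q ρ j s₁ cnt := by
  classical
  have hj' : j ∈ Finset.range (S.I.n * S.I.n) := Finset.mem_range.2 hj
  set r : ℝ≥0∞ := ∑ i ∈ (Finset.range (S.I.n * S.I.n)).erase j,
    if i < j then S.weight κ γ i (ρ + 1) (cnt i) else S.weight κ γ i ρ (cnt i) *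
      (1 + 1 / 2 * pairErr S.I S.O (S.tupd (numVerts (S.I.n * q + S.I.n) S.g (q + 2)) 2)
        (S.tqry (numVerts (S.I.n * q + S.I.n) S.g (q + 2)) 2) S.g γ q i s₁) with hr
  have h1 : ∀ s, S.mixed κ γ q ρ (j + 1) s₁ (S.tally j cnt s) =
      S.weight κ γ j (ρ + 1) (S.tally j cnt s j) + r := by
    intro s
    rw [mixed, ← Finset.add_sum_erase _ _ hj', if_pos (by omega), hr]
    congr 1
    refine Finset.sum_congr rfl fun i hi => ?_
    have hij := (Finset.mem_erase.1 hi).1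
    have : S.tally j cnt s i = cnt i := by simp [tally, hij]
    rw [this]
    exact if_congr (by omega) rfl rfl
  have h2 : S.mixed κ γ q ρ j s₁ cnt = S.weight κ γ j ρ (cnt j) *
      (1 + 1 / 2 * pairErr S.I S.O (S.tupd (numVerts (S.I.n * q + S.I.n) S.g (q + 2)) 2)
        (S.tqry (numVerts (S.I.n * q + S.I.n) S.g (q + 2)) 2) S.g γ q j s₁) + r := by
    rw [mixed, ← Finset.add_sum_erase _ _ hj', if_neg (by omega)]
  rw [h2]
  refine (expect_mono _ fun s₂ _ => expect_mono (g := fun s : State => (A + r) +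
    S.weight κ γ j ρ (cnt j) * (1 + 1 / 2 * if S.I.adj j = 1 then
      (if s.reg 0 = 1 ↔ S.I.Truth S.g γ j then 0 else 1) else 0)) _ fun s _ => ?_).trans ?_
  · rw [h1, ← add_assoc, add_right_comm]
    exact add_le_add_right (weight_tally_le κ γ j ρ cnt s) _
  · simp only [expect_add, expect_const, expect_const_mul]
    refine le_of_eq ?_
    rw [add_assoc, add_comm r]
    congr 4
    by_cases ha : S.I.adj j = 1
    · simp only [ha, pairErr, if_true]
      rfl
    · simp only [ha, pairErr, if_false, expect_const]

theorem mixed_zero (κ : ℝ≥0∞) (γ q ρ : ℕ) (s₁ : State) (cnt : ℕ → ℕ) :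
    S.mixed κ γ q ρ 0 s₁ cnt = ∑ j ∈ Finset.range (S.I.n * S.I.n), S.weight κ γ j ρ (cnt j) *
      (1 + 1 / 2 * pairErr S.I S.O (S.tupd (numVerts (S.I.n * q + S.I.n) S.g (q + 2)) 2)
        (S.tqry (numVerts (S.I.n * q + S.I.n) S.g (q + 2)) 2) S.g γ q j s₁) := by
  simp [mixed]

theorem mixed_last (κ : ℝ≥0∞) (γ q ρ : ℕ) (s₁ : State) (cnt : ℕ → ℕ) :
    S.mixed κ γ q ρ (S.I.n * S.I.n) s₁ cnt = S.potential κ γ (ρ + 1) cnt :=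
  Finset.sum_congr rfl fun _ hj => if_pos (Finset.mem_range.1 hj)

/-- Averaged over the modulus and the preprocessing, one repetition increases the potential by the
factor `6 / 5 = 1 + 1 / 2 * (2 / 5)`. -/
theorem average_mixed_le {k L : ℕ} (hpos : ∀ p, S.I.pos p ≤ S.I.n ^ k)
    (hneg : ∀ p, S.I.neg p ≤ S.I.n ^ k)
    (hL : ∀ W : ℕ, W ≠ 0 → W ≤ 3 * S.I.n ^ k → W.divisors.card ≤ L) (hgL : 15 * (S.g * L) ≤ S.M)
    (A κ : ℝ≥0∞) (γ ρ : ℕ) (cnt : ℕ → ℕ) :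
    (∑ v ∈ Finset.range S.M, expect (S.prepared γ (v + S.M)) fun s₁ =>
      A + S.mixed κ γ (v + S.M) ρ 0 s₁ cnt) * (S.M : ℝ≥0∞)⁻¹ ≤
      A + 6 / 5 * S.potential κ γ ρ cnt := by
  have hM0 : (S.M : ℝ≥0∞) ≠ 0 := by
    have := S.M_pos
    simp only [ne_eq, Nat.cast_eq_zero]
    omega
  have hMt : (S.M : ℝ≥0∞) ≠ ⊤ := by simp
  have h65 : (1 : ℝ≥0∞) + 1 / 2 * (2 / 5) = 6 / 5 := by
    rw [← ENNReal.toReal_eq_toReal_iff' (by finiteness) (by finiteness), ENNReal.toReal_add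
      (by finiteness) (by finiteness)]
    simp
    norm_num
  rw [← div_eq_mul_inv, ENNReal.div_le_iff hM0 hMt]
  simp only [mixed_zero, expect_add, expect_const, expect_finset_sum, expect_const_mul,
    Finset.sum_add_distrib, Finset.sum_const, Finset.card_range, nsmul_eq_mul]
  rw [Finset.sum_comm, add_mul, mul_comm A]
  refine add_le_add_right ?_ _
  rw [potential, Finset.mul_sum, Finset.sum_mul]
  refine Finset.sum_le_sum fun j hj => ?_
  rw [← Finset.mul_sum, Finset.sum_add_distrib, ← Finset.mul_sum, Finset.sum_const,
    Finset.card_range, nsmul_eq_mul, mul_one]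
  calc _ ≤ S.weight κ γ j ρ (cnt j) * (S.M + 1 / 2 * (S.M * (2 / 5))) :=
        mul_le_mul_right (add_le_add_right (mul_le_mul_right (sum_expect_pairErr_le S.serves S.I
          S.M_pos (Finset.mem_range.1 hj) hpos hneg hL hgL) _) _) _
    _ = _ := by
        rw [← h65]
        ring

end Setting

end ExactTriangle

/-! ### One repetition -/

namespace ExactTriangle

open WordRAM SlotGraph VertexFailure Expr

namespace Setting

variable {S : Setting}

theorem tally_le (j : ℕ) (cnt : ℕ → ℕ) (s : State) (i : ℕ) :
    S.tally j cnt s i ≤ if i = j then cnt i + 1 else cnt i := by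
  classical
  simp only [tally, Function.update_apply]
  split_ifs with h1 h2
  · subst h1
    rfl
  · subst h1
    omega
  · rfl

/-- All pairs are queried in one repetition. -/
theorem wp_pairs {γ q ρ c58 c59 : ℕ} {σ s₁ : State} (hM : S.M ≤ q) (hq' : q < 2 * S.M)
    (hmod : S.Modulus γ q σ) (h58 : σ.reg 58 = c58) (h59 : σ.reg 59 = c59) (hs : Stamps σ)
    (hlow : ofLay (lower σ) = s₁) (hs₁ : s₁ ∈ (S.prepared γ q).support)
    (hX59 : c59 + S.I.n * S.I.n < S.X) (hρ : ρ + 1 < S.X)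
    (hcnt : ∀ j < S.I.n * S.I.n, σ.arr 3 j ≤ ρ) (A κ : ℝ≥0∞) :
    WP S.B S.X [forTo 30 10 (pairBody S.O)]
      (S.I.n * S.I.n * (200 * S.Tu + 200 * S.Tq + 308) + 15) σ
      (fun σ' => S.Modulus γ q σ' ∧ σ'.reg 58 = c58 ∧ σ'.reg 59 = c59 + S.I.n * S.I.n ∧
        Stamps σ' ∧ (∀ x < 30, σ'.reg x = σ.reg x) ∧ ∀ j < S.I.n * S.I.n, σ'.arr 3 j ≤ ρ + 1)
      (fun σ' => A + S.potential κ γ (ρ + 1) (σ'.arr 3)) (A + S.mixed κ γ q ρ 0 s₁ (σ.arr 3)) := by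
  have hD := S.depth
  have hMp := S.M_pos
  refine (WP.forTo S.room (t := 0) (by omega) (by norm_num) (by norm_num) (S.I.n * S.I.n)
    (200 * S.Tu + 200 * S.Tq + 300)
    (fun i σ' => S.Between γ q i σ' c58 (c59 + i) s₁ ∧ (∀ x < 30, σ'.reg x = σ.reg x) ∧
      ∀ j < S.I.n * S.I.n, σ'.arr 3 j ≤ if j < i then ρ + 1 else ρ)
    (fun i σ' => A + S.mixed κ γ q ρ i s₁ (σ'.arr 3))
    (fun i _ σ' h => ⟨h.1.r30, h.1.modulus.static.r10⟩) ?_ le_rfl ?_ ?_).time_mono (by simp)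
  · refine ⟨⟨hmod.congr (fun x hx => ?_) fun _ _ => rfl, by simp, by simp [h58], by simp [h59],
      fun b α i => ?_, ?_⟩, fun x hx => ?_, fun j hj => ?_⟩
    · rw [setReg_reg, if_neg (by omega)]
    · rw [setReg_arr, setReg_reg, if_neg (by have := clk_eq b; omega)]
      exact hs b α i
    · rw [← hlow]
      congr 1
    · rw [setReg_reg, if_neg (by omega)]
    · simpa using hcnt j hj
  · rintro i hi σ' _ ⟨h1, h2, h3⟩
    refine (wp_pairBody (hMp.trans hM) hq' hi h1 (by omega) hM hs₁ ?_
      (fun cnt => A + S.mixed κ γ q ρ (i + 1) s₁ cnt)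
      (expect_mixed_le A κ hi s₁ (σ'.arr 3))).mono le_rfl
      (fun σ'' _ h => ⟨h.1, fun x hx => (h.2.1 x hx).trans (h2 x hx), fun j hj => ?_⟩)
      (fun _ _ _ => le_rfl) le_rfl
    · have := h3 i hi
      rw [if_neg (by omega)] at this
      omega
    · obtain ⟨s, hs⟩ := h.2.2
      rw [hs]
      have h4 := tally_le (S := S) i (σ'.arr 3) s j
      have h5 := h3 j hj
      split_ifs at h4 h5 ⊢ <;> omega
  · rintro σ' _ ⟨h1, h2, h3⟩
    refine WP.nil ⟨h1.modulus, h1.r58, h1.r59, h1.stamps, h2, fun j hj => ?_⟩ ?_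
    · have := h3 j hj
      rwa [if_pos hj] at this
    · rw [mixed_last]

variable (S) in
/-- What holds in the loop over the repetitions, for the group `γ` -/
structure Rep (γ ρ : ℕ) (σ₀ σ : State) : Prop where
  static : S.Static σ
  r11 : σ.reg 11 = γ
  r12 : σ.reg 12 = ρ
  out : ∀ x < 4, σ.reg x = σ₀.reg x
  r58 : σ.reg 58 = γ * S.R + ρ
  r59 : σ.reg 59 = (γ * S.R + ρ) * (S.I.n * S.I.n + 1)
  stamps : Stamps σ
  cnt : ∀ j < S.I.n * S.I.n, σ.arr 3 j ≤ ρ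

variable (S) in
/-- A bound for the time of one repetition -/
def repTime : ℕ :=
  200 * S.Tp + 1200 * (S.I.n * S.M * S.g) +
    S.I.n * S.I.n * (200 * S.Tu + 200 * S.Tq + 308) + 700

/-- In one repetition the potential grows by a factor of at most `6 / 5` in expectation. -/
theorem wp_repBody {γ ρ : ℕ} {σ₀ σ : State} (hγ : γ < S.G) (hρ : ρ < S.R)
    (hσ : S.Rep γ ρ σ₀ σ) {k L : ℕ} (hpos : ∀ p, S.I.pos p ≤ S.I.n ^ k)
    (hneg : ∀ p, S.I.neg p ≤ S.I.n ^ k)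
    (hL : ∀ W : ℕ, W ≠ 0 → W ≤ 3 * S.I.n ^ k → W.divisors.card ≤ L) (hgL : 15 * (S.g * L) ≤ S.M)
    (A κ : ℝ≥0∞) :
    WP S.B S.X [repBody S.O, incr 12] S.repTime σ (S.Rep γ (ρ + 1) σ₀)
      (fun σ' => A + S.potential κ γ (ρ + 1) (σ'.arr 3))
      (A + 6 / 5 * S.potential κ γ ρ (σ.arr 3)) := by
  have hX := S.lt_X
  have hD := S.depth
  have hMp := S.M_pos
  have hMX := S.M_lt
  have hRX := S.R_lt
  have hst := hσ.static
  have hcl : (γ * S.R + ρ + 1) * (S.I.n * S.I.n + 1) < S.X := by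
    refine lt_of_le_of_lt (Nat.mul_le_mul_right _ ?_) S.clk_lt
    have : (γ + 1) * S.R ≤ S.G * S.R := Nat.mul_le_mul_right _ hγ
    nlinarith
  have hcl' : γ * S.R + ρ + 1 < S.X := lt_of_le_of_lt (Nat.le_mul_of_pos_right _ (by omega)) hcl
  have hcl'' : (γ * S.R + ρ) * (S.I.n * S.I.n + 1) + (1 + S.I.n * S.I.n) < S.X := by
    calc _ = (γ * S.R + ρ + 1) * (S.I.n * S.I.n + 1) := by ring
      _ < _ := hcl
  refine WP.time_mono (WP.block (t := S.repTime - 20)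
    (WP.time_mono (WP.assign_eq S.room (S.M - 1) (by norm_num)
      (fits_edge _ (by simp; omega) (by simp)) (by simp [hst.r7]) (fun _ => by omega)
    (WP.rand S.room (by norm_num) (by norm_num)
      (fun v => expect (S.prepared γ (v + S.M)) fun s₁ =>
        A + S.mixed κ γ (v + S.M) ρ 0 s₁ (σ.arr 3))
      (t := S.repTime - 30) (fun v hv => ?draw) ?avg)) (by simp [repTime]; omega)))
      (by simp [repTime]; omega)
  case avg =>
    have e1 : (σ.setReg 13 (S.M - 1)).reg 13 + 1 = S.M := by
      simp only [setReg_reg, if_true]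
      omega
    rw [e1]
    exact average_mixed_le hpos hneg hL hgL A κ γ ρ _
  case draw =>
    have hv' : v < S.M := by
      simp only [setReg_reg, if_true] at hv
      omega
    set q := v + S.M with hq
    have hm : (S.I.n * q + S.I.n) * S.g ≤ 2 * (S.I.n * S.M * S.g) := by
      have : S.I.n * (q + 1) ≤ S.I.n * (2 * S.M) := Nat.mul_le_mul_left _ (by omega)
      calc (S.I.n * q + S.I.n) * S.g = S.I.n * (q + 1) * S.g := by ring
        _ ≤ S.I.n * (2 * S.M) * S.g := Nat.mul_le_mul_right _ this
        _ = _ := by ring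
    set σ₁ := ((σ.setReg 13 (S.M - 1)).setReg 13 v).setReg 13 q with hσ₁
    have hr₁ : ∀ x, x ≠ 13 → σ₁.reg x = σ.reg x := fun x hx => by simp [hσ₁, hx]
    have hst₁ : S.Static σ₁ := hst.congr (fun x hx => hr₁ x (by omega)) fun _ _ => rfl
    have hstamp₁ : Stamps σ₁ := fun b α i => by
      rw [hr₁ _ (by have := clk_eq b; omega)]
      exact hσ.stamps b α i
    refine WP.time_mono (WP.assign_eq S.room q (by norm_num)
      (fits_edge _ (by simp) (by simp)) (by simp [hst.r7, hq]) (fun _ => by omega)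
      (wp_prepare (γ := γ) (q := q) (σ := σ₁)
        (t := S.I.n * S.I.n * (200 * S.Tu + 200 * S.Tq + 308) + 15 + 7) (by omega) (by omega) hst₁
        (by rw [hr₁ 11 (by norm_num), hσ.r11]) (by simp [hσ₁]) hstamp₁
        (by rw [hr₁ 58 (by norm_num), hσ.r58]; exact hcl')
        (by rw [hr₁ 59 (by norm_num), hσ.r59]; omega)
        (fun s₁ => A + S.mixed κ γ q ρ 0 s₁ (σ.arr 3)) (fun σ₂ m₂ r₂ c58 c59 a₂ s₂ hs₂ => ?_) le_rfl))
      (by simp [repTime]; omega)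
    rw [hr₁ 58 (by norm_num), hσ.r58] at c58
    rw [hr₁ 59 (by norm_num), hσ.r59] at c59
    have ha : σ₂.arr 3 = σ.arr 3 := a₂.trans rfl
    have h3 := wp_pairs (S := S) (by omega) (by omega) m₂ c58 c59 s₂ rfl hs₂
      (by omega) (ρ := ρ) (by omega) (by rw [ha]; exact hσ.cnt) A κ
    rw [ha] at h3
    refine WP.append (l₁ := [forTo 30 10 (pairBody S.O)]) h3 fun σ₃ _ h => ?_
    obtain ⟨m₃, c58', c59', s₃, r₃, n₃⟩ := h
    have hr₃ : ∀ x < 13, σ₃.reg x = σ.reg x := fun x hx =>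
      (r₃ x (by omega)).trans ((r₂ x hx).trans (hr₁ x (by omega)))
    have h12 : σ₃.reg 12 = ρ := (hr₃ 12 (by norm_num)).trans hσ.r12
    refine WP.incr S.room (t := 0) (by omega) (by norm_num) (fun _ => by omega)
      (WP.nil ⟨m₃.static.congr (fun x hx => ?_) fun _ _ => rfl, ?_, ?_, fun x hx => ?_, ?_, ?_,
        fun b α i => ?_, n₃⟩ le_rfl)
    · rw [setReg_reg, if_neg (by omega)]
    · simp [m₃.r11]
    · simp [h12]
    · rw [setReg_reg, if_neg (by omega), hr₃ x (by omega), hσ.out x hx]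
    · simp [c58']
      ring
    · simp [c59']
      ring
    · rw [setReg_reg, if_neg (by have := clk_eq b; omega)]
      exact s₃ b α i

end Setting

end ExactTriangle

/-! ### Processing a group -/

namespace ExactTriangle

open WordRAM SlotGraph VertexFailure Expr

namespace Inst

variable (I : Inst)

/-- The memory does not claim a wrong triangle. -/
def Sound (σ : State) : Prop :=
  σ.reg 0 = 0 ∨ (σ.reg 0 = 1 ∧ I.Zero (σ.reg 1) (σ.reg 2) (σ.reg 3) ∧ σ.reg 1 < I.n ∧
    σ.reg 2 < I.n ∧ σ.reg 3 < I.n)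

variable {I}

theorem Sound.congr {σ σ' : State} (h : I.Sound σ) (hr : ∀ x < 4, σ'.reg x = σ.reg x) :
    I.Sound σ' := by
  rw [Sound, hr 0 (by norm_num), hr 1 (by norm_num), hr 2 (by norm_num), hr 3 (by norm_num)]
  exact h

end Inst

namespace Setting

variable {S : Setting}

/-- The test for a zero triangle over the pair `a, b`, with node `t` of the group -/
theorem wp_checkBody (hadj : ∀ p, S.I.adj p ≤ 1) {γ t a b : ℕ} {σ : State} (hst : S.Static σ)
    (h11 : σ.reg 11 = γ) (h30 : σ.reg 30 = t) (ht : t < S.g) (h31 : σ.reg 31 = a)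
    (h32 : σ.reg 32 = b) (ha : a < S.I.n) (hb : b < S.I.n) (hs : S.I.Sound σ) {E : ℝ≥0∞} :
    WP S.B S.X [checkBody, incr 30] 250 σ
      (fun σ' => σ'.arr = σ.arr ∧ (∀ x, 4 ≤ x → x ≠ 30 → x ≠ 35 → σ'.reg x = σ.reg x) ∧
        σ'.reg 30 = t + 1 ∧ S.I.Sound σ' ∧ (σ.reg 0 ≠ 0 → σ'.reg 0 ≠ 0) ∧
        (S.I.Zero a b (S.I.node S.g γ t) → σ'.reg 0 ≠ 0))
      (fun _ => E) E := by
  have hX := S.lt_X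
  have hD := S.depth
  have hn := S.n_pos
  have hg := S.g_pos
  have hgX : S.g < S.X := by
    have h1 := S.edges_lt 0 (by have := S.M_pos; omega)
    have h2 : 1 * S.g ≤ (S.I.n * 0 + S.I.n) * S.g := Nat.mul_le_mul_right _ (by omega)
    omega
  have hnX : S.I.n < S.X := lt_of_le_of_lt (Nat.le_mul_of_pos_left _ hn) S.sq_lt
  set c := S.I.node S.g γ t with hc
  have hcn : c < S.I.n := Nat.mod_lt _ hn
  set σ₁ := σ.setReg 35 c with hσ₁
  set E₀ : Expr := load 0 (var 31 * var 4 + var 32) * load 0 (var 32 * var 4 + var 35) *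
        load 0 (var 31 * var 4 + var 35) *
        eq (load 1 (var 31 * var 4 + var 32) + load 1 (var 32 * var 4 + var 35) +
            load 1 (var 31 * var 4 + var 35))
          (load 2 (var 31 * var 4 + var 32) + load 2 (var 32 * var 4 + var 35) +
            load 2 (var 31 * var 4 + var 35)) with hE₀
  have hzero : E₀.eval σ₁ ≠ 0 ↔ S.I.Zero a b c := by
    have h1 := hadj (a * S.I.n + b)
    have h2 := hadj (b * S.I.n + c)
    have h3 := hadj (a * S.I.n + c)
    by_cases h4 : S.I.pos (a * S.I.n + b) + S.I.pos (b * S.I.n + c) + S.I.pos (a * S.I.n + c) =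
        S.I.neg (a * S.I.n + b) + S.I.neg (b * S.I.n + c) + S.I.neg (a * S.I.n + c)
    · have hev : E₀.eval σ₁ = S.I.adj (a * S.I.n + b) * S.I.adj (b * S.I.n + c) *
          S.I.adj (a * S.I.n + c) := by
        simp [hE₀, hσ₁, h31, h32, hst.r4, hst.a0, hst.a1, hst.a2, h4]
      rw [hev, Inst.Zero, Inst.wsum]
      simp only [ne_eq, mul_eq_zero, not_or, Inst.ix]
      omega
    · have hev : E₀.eval σ₁ = 0 := by
        simp [hE₀, hσ₁, h31, h32, hst.r4, hst.a0, hst.a1, hst.a2, h4]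
      rw [hev, Inst.Zero, Inst.wsum]
      simp only [Inst.ix]
      omega
  refine WP.time_mono (WP.block (WP.assign_eq S.room c (by norm_num)
    (fits_edge _ (by simp) (by simp)) (by simp [h30, h11, hst.r6, hst.r4, hc, Inst.node])
    (fun _ => by omega) (WP.ifte S.room (t := 50) (fits_edge _ (by simp) (by simp))
      (fun h => ?yes) (fun h => ?no)))) (by simp)
  case yes =>
    have hz := hzero.1 h
    refine WP.time_mono (WP.block
      (WP.assign_eq S.room 1 (by norm_num) (fits_edge _ (by simp; omega) (by simp)) (by simp)
        (fun _ => by omega)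
      (WP.assign_eq S.room a (by norm_num) (fits_edge _ (by simp) (by simp)) (by simp [h31])
        (fun _ => by omega)
      (WP.assign_eq S.room b (by norm_num) (fits_edge _ (by simp) (by simp)) (by simp [h32])
        (fun _ => by omega)
      (WP.assign_eq S.room c (by norm_num) (fits_edge _ (by simp) (by simp)) (by simp)
        (fun _ => by omega)
      (WP.incr S.room (t := 0) (by omega) (by norm_num) (fun _ => by simp [h30]; omega)
        (WP.nil ⟨rfl, fun x h1 h2 h3 => ?_, by simp [h30], ?_, by simp, by simp⟩ le_rfl)))))))
      (by simp)
    · simp only [setReg_reg]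
      rw [if_neg h2, if_neg (by omega), if_neg (by omega), if_neg (by omega), if_neg (by omega),
        if_neg h3]
    · exact Or.inr ⟨by simp, by simpa using hz, by simpa using ha, by simpa using hb,
        by simpa using hcn⟩
  case no =>
    have hz : ¬ S.I.Zero a b c := fun hz => hzero.2 hz h
    refine WP.time_mono (WP.skip
      (WP.incr S.room (t := 0) (by omega) (by norm_num) (fun _ => by simp [h30]; omega)
        (WP.nil ⟨rfl, fun x h1 h2 h3 => ?_, by simp [h30], ?_, by simp, fun hz' => absurd hz' hz⟩
          le_rfl))) (by simp)
    · simp only [setReg_reg]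
      rw [if_neg h2, if_neg h3]
    · refine hs.congr fun x hx => ?_
      simp only [setReg_reg]
      rw [if_neg (by omega), if_neg (by omega)]

variable (S) in
/-- What holds in the loop over the groups -/
structure Group (γ : ℕ) (σ : State) : Prop where
  static : S.Static σ
  r11 : σ.reg 11 = γ
  sound : S.I.Sound σ
  r58 : σ.reg 58 = γ * S.R
  r59 : σ.reg 59 = γ * S.R * (S.I.n * S.I.n + 1)
  stamps : Stamps σ

theorem Static.congr_of {σ σ' : State} (h : S.Static σ) (ha : σ'.arr = σ.arr)
    (hr : ∀ x, 4 ≤ x → x < 11 → σ'.reg x = σ.reg x) : S.Static σ' := by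
  refine ⟨?_, ?_, ?_, ?_, ?_, ?_, ?_, ?_, ?_⟩
  · rw [hr 4 (by norm_num) (by norm_num), h.r4]
  · rw [hr 6 (by norm_num) (by norm_num), h.r6]
  · rw [hr 7 (by norm_num) (by norm_num), h.r7]
  · rw [hr 8 (by norm_num) (by norm_num), h.r8]
  · rw [hr 9 (by norm_num) (by norm_num), h.r9]
  · rw [hr 10 (by norm_num) (by norm_num), h.r10]
  · rw [ha, h.a0]
  · rw [ha, h.a1]
  · rw [ha, h.a2]

/-- If the pair that the majority selects does not yield a triangle, although there is one in the
group, then some pair got at least `R'` wrong answers. -/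
theorem one_le_potential {R' γ c : ℕ} {cnt : ℕ → ℕ} (hR : S.R = 2 * R') (hc : c < S.I.n * S.I.n)
    (hmaj : (∀ j < S.I.n * S.I.n, cnt j + cnt j ≤ S.R) ∨ S.R < cnt c + cnt c)
    (hno : ¬ S.I.Truth S.g γ c) (hex : ∃ j < S.I.n * S.I.n, S.I.Truth S.g γ j) :
    1 ≤ S.potential ((2 / 3) ^ R') γ S.R cnt := by
  have key : ∀ j < S.I.n * S.I.n, R' ≤ S.wrong γ j S.R (cnt j) →
      1 ≤ S.potential ((2 / 3) ^ R') γ S.R cnt := by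
    intro j hj hw
    have h1 : (2 / 3 : ℝ≥0∞) * (1 + 1 / 2) = 1 := by
      rw [← ENNReal.toReal_eq_toReal_iff' (by finiteness) (by finiteness), ENNReal.toReal_mul,
        ENNReal.toReal_add (by finiteness) (by finiteness)]
      simp
      norm_num
    calc (1 : ℝ≥0∞) = (2 / 3) ^ R' * (1 + 1 / 2) ^ R' := by rw [← mul_pow, h1, one_pow]
      _ ≤ S.weight ((2 / 3) ^ R') γ j S.R (cnt j) :=
        mul_le_mul_right (pow_le_pow_right₀ le_self_add hw) _
      _ ≤ _ := Finset.single_le_sum (f := fun j => S.weight ((2 / 3) ^ R') γ j S.R (cnt j))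
        (fun _ _ => zero_le) (Finset.mem_range.2 hj)
  rcases hmaj with h | h
  · obtain ⟨j, hj, ht⟩ := hex
    refine key j hj ?_
    have := h j hj
    rw [wrong, if_pos ht]
    omega
  · refine key c hc ?_
    rw [wrong, if_neg hno]
    omega

theorem potential_mul (c κ : ℝ≥0∞) (γ ρ : ℕ) (cnt : ℕ → ℕ) :
    c * S.potential κ γ ρ cnt = S.potential (c * κ) γ ρ cnt := by
  simp only [potential, weight, Finset.mul_sum, mul_assoc]

/-- The output after the repetitions for a group -/
theorem wp_decide (hadj : ∀ p, S.I.adj p ≤ 1) {γ R' : ℕ} (hγ : γ < S.G) {σ₀ σ : State}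
    (hσ : S.Rep γ S.R σ₀ σ) (hs : S.I.Sound σ₀) (hR : S.R = 2 * R') (A D : ℝ≥0∞)
    (hD : D = 0 ∨ ∃ j < S.I.n * S.I.n, S.I.Truth S.g γ j) :
    WP S.B S.X [assign 36 (const 0),
      forTo 30 10
        (assign 36 (cond (lt (var 8) (load 3 (var 30) + load 3 (var 30))) (var 30) (var 36))),
      assign 31 (var 36 / var 4), assign 32 (var 36 % var 4), forTo 30 6 checkBody, incr 11]
      (S.I.n * S.I.n * 58 + S.g * 258 + 100) σ
      (fun σ' => S.Group (γ + 1) σ' ∧ (σ₀.reg 0 ≠ 0 → σ'.reg 0 ≠ 0))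
      (fun σ' => A + D * if σ'.reg 0 = 0 then 1 else 0)
      (A + D * S.potential ((2 / 3) ^ R') γ S.R (σ.arr 3)) := by
  have hX := S.lt_X
  have hDp := S.depth
  have hn := S.n_pos
  have hnn : 0 < S.I.n * S.I.n := Nat.mul_pos hn hn
  have hGX := S.G_lt
  have hXn := S.sq_lt
  have hst := hσ.static
  have hnX : S.I.n ≤ S.I.n * S.I.n := Nat.le_mul_of_pos_left _ hn
  set E := A + D * S.potential ((2 / 3) ^ R') γ S.R (σ.arr 3) with hE
  refine WP.time_mono (WP.assign_eq S.room 0 (by norm_num)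
    (fits_edge _ (by simp; omega) (by simp)) (by simp) (fun _ => by omega)
    (WP.forTo S.room (t := S.g * 258 + 60) (by omega) (by norm_num) (by norm_num) (S.I.n * S.I.n) 50
      (fun i σ' => σ'.arr = σ.arr ∧ (∀ x, x ≠ 30 → x ≠ 36 → σ'.reg x = σ.reg x) ∧
        σ'.reg 30 = i ∧ σ'.reg 36 < S.I.n * S.I.n ∧
        ((∀ j < i, σ.arr 3 j + σ.arr 3 j ≤ S.R) ∨
          S.R < σ.arr 3 (σ'.reg 36) + σ.arr 3 (σ'.reg 36)))
      (fun _ _ => E) (fun i _ σ' h => ⟨h.2.2.1, (h.2.1 10 (by norm_num) (by norm_num)).trans hst.r10⟩)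
      ?init le_rfl ?body fun σ₁ _ h₁ => ?rest)) (by simp; omega)
  case init =>
    refine ⟨rfl, fun x h1 h2 => by simp [h1, h2], by simp, by simpa using hnn, Or.inl ?_⟩
    intro j hj
    omega
  case body =>
    rintro i hi σ' - ⟨h1, h2, h3, h4, h5⟩
    have h8 : σ'.reg 8 = S.R := (h2 8 (by norm_num) (by norm_num)).trans hst.r8
    refine WP.time_mono (WP.assign_eq S.room
      (if S.R < σ.arr 3 i + σ.arr 3 i then i else σ'.reg 36) (by norm_num)
      (fits_edge _ (by simp) (by simp)) (by simp [h3, h8, h1])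
      (fun _ => by split_ifs <;> omega) (WP.incr S.room (t := 0) (by omega) (by norm_num)
        (fun _ => by simp [h3]; omega)
        (WP.nil ⟨h1, fun x hx hx' => ?_, by simp [h3], ?_, ?_⟩ le_rfl))) (by simp)
    · simp [hx, hx', h2 x hx hx']
    · simp
      split_ifs <;> omega
    · simp only [setReg_reg]
      simp only [show (36 : ℕ) ≠ 30 by norm_num, if_false, if_true]
      by_cases hc : S.R < σ.arr 3 i + σ.arr 3 i
      · right
        rwa [if_pos hc]
      · rw [if_neg hc]
        refine h5.imp_left fun h j hj => ?_
        rcases Nat.lt_succ_iff_lt_or_eq.1 hj with h' | rfl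
        · exact h j h'
        · omega
  case rest =>
    obtain ⟨h1, h2, h3, h4, h5⟩ := h₁
    set c := σ₁.reg 36 with hc
    have hca : c / S.I.n < S.I.n := Nat.div_lt_of_lt_mul h4
    have hcb : c % S.I.n < S.I.n := Nat.mod_lt _ hn
    have hr : ∀ x < 30, σ₁.reg x = σ.reg x := fun x hx => h2 x (by omega) (by omega)
    have h4' := (hr 4 (by norm_num)).trans hst.r4
    refine WP.time_mono (WP.assign_eq S.room (c / S.I.n) (by norm_num)
      (fits_edge _ (by simp) (by simp)) (by simp [h4', hc]) (fun _ => hca.trans (by omega))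
      (WP.assign_eq S.room (c % S.I.n) (by norm_num)
      (fits_edge _ (by simp) (by simp)) (by simp [h4', hc]) (fun _ => hcb.trans (by omega))
      (WP.forTo S.room (t := 10) (by omega) (by norm_num) (by norm_num) S.g 250
        (fun t σ' => σ'.arr = σ.arr ∧
          (∀ x, 4 ≤ x → x < 30 ∨ 37 ≤ x → σ'.reg x = σ.reg x) ∧ σ'.reg 30 = t ∧
          σ'.reg 31 = c / S.I.n ∧ σ'.reg 32 = c % S.I.n ∧ S.I.Sound σ' ∧
          (σ₀.reg 0 ≠ 0 → σ'.reg 0 ≠ 0) ∧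
          ((∃ t' < t, S.I.Zero (c / S.I.n) (c % S.I.n) (S.I.node S.g γ t')) → σ'.reg 0 ≠ 0))
        (fun _ _ => E) (fun t _ σ' h => ⟨h.2.2.1, (h.2.1 6 (by norm_num) (by norm_num)).trans hst.r6⟩)
        ?init2 le_rfl ?body2 fun σ₂ _ h₂ => ?rest2))) (by simp; omega)
    case init2 =>
      refine ⟨h1, fun x hx hx' => ?_, by simp, by simp, by simp, hs.congr fun x hx => ?_, ?_, ?_⟩
      · simp only [setReg_reg]
        rw [if_neg (by omega), if_neg (by omega), if_neg (by omega), h2 x (by omega) (by omega)]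
      · simp only [setReg_reg]
        rw [if_neg (by omega), if_neg (by omega), if_neg (by omega), hr x (by omega), hσ.out x hx]
      · simp [hr 0, hσ.out 0]
      · rintro ⟨t', ht', _⟩
        omega
    case body2 =>
      rintro t ht σ' - ⟨g1, g2, g3, g4, g5, g6, g7, g8⟩
      refine (wp_checkBody hadj (hst.congr_of g1 fun x hx hx' => g2 x hx (by omega)) ((g2 11 (by norm_num) (by norm_num)).trans hσ.r11)
        g3 ht g4 g5 hca hcb g6).mono le_rfl ?_ (fun _ _ _ => le_rfl) le_rfl
      rintro σ'' - ⟨k1, k2, k3, k4, k5, k6⟩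
      refine ⟨k1.trans g1, fun x hx hx' => ?_, k3, ?_, ?_, k4, fun h => k5 (g7 h), ?_⟩
      · rw [k2 x hx (by omega) (by omega), g2 x hx hx']
      · rw [k2 31 (by norm_num) (by norm_num) (by norm_num), g4]
      · rw [k2 32 (by norm_num) (by norm_num) (by norm_num), g5]
      · rintro ⟨t', ht', hz⟩
        rcases Nat.lt_succ_iff_lt_or_eq.1 ht' with h' | rfl
        · exact k5 (g8 ⟨t', h', hz⟩)
        · exact k6 hz
    case rest2 =>
      obtain ⟨g1, g2, g3, g4, g5, g6, g7, g8⟩ := h₂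
      have h11 : σ₂.reg 11 = γ := (g2 11 (by norm_num) (by norm_num)).trans hσ.r11
      refine WP.time_mono (WP.incr S.room (σ := σ₂) (t := 0) (by omega) (by norm_num)
        (fun _ => by rw [h11]; omega) (WP.nil ?post ?pot)) (by simp)
      case post =>
        refine ⟨⟨?_, by simp [h11], g6.congr fun x hx => by simp; omega, ?_, ?_, ?_⟩, ?_⟩
        · refine hst.congr_of g1 fun x hx hx' => ?_
          rw [setReg_reg, if_neg (by omega), g2 x hx (by omega)]
        · rw [setReg_reg, if_neg (by norm_num), g2 58 (by norm_num) (by norm_num), hσ.r58]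
          ring
        · rw [setReg_reg, if_neg (by norm_num), g2 59 (by norm_num) (by norm_num), hσ.r59]
          ring
        · intro b α i
          have := clk_eq b
          rw [setReg_reg, if_neg (by omega), g2 (clk b) (by omega) (by omega), setReg_arr, g1]
          exact hσ.stamps b α i
        · simpa using g7
      case pot =>
        have h0 : (σ₂.setReg 11 (σ₂.reg 11 + 1)).reg 0 = σ₂.reg 0 := by simp
        rw [h0]
        refine add_le_add_right ?_ _
        split_ifs with h0
        · rcases hD with rfl | hD
          · simp
          · refine mul_le_mul_right (one_le_potential hR h4 h5 (fun ht => ?_) hD) _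
            exact g8 ht.2 h0
        · simp

end Setting

end ExactTriangle

/-! ### The loop over the groups -/

namespace ExactTriangle

open WordRAM SlotGraph VertexFailure Expr

namespace Setting

variable {S : Setting}

variable (S) in
/-- The conditions on the instance and on the parameters under which the output is correct with
probability `2 / 3`: there are `2 * R'` repetitions, and a number `W ≠ 0` that occurs as the
absolute value of the weight of a triangle has at most `L` divisors. -/
structure Reliable (k L R' : ℕ) : Prop where
  adj_le : ∀ p, S.I.adj p ≤ 1
  pos_le : ∀ p, S.I.pos p ≤ S.I.n ^ k
  neg_le : ∀ p, S.I.neg p ≤ S.I.n ^ k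
  card_divisors_le : ∀ W : ℕ, W ≠ 0 → W ≤ 3 * S.I.n ^ k → W.divisors.card ≤ L
  le_M : 15 * (S.g * L) ≤ S.M
  R_eq : S.R = 2 * R'
  G_eq : S.G = S.I.n / S.g + 1
  decay : ((S.I.n * S.I.n : ℕ) : ℝ≥0∞) * (24 / 25) ^ R' ≤ 1 / 3

variable (S) in
/-- A bound for the time spent on one group -/
def groupTime : ℕ := S.R * (S.repTime + 8) + S.I.n * S.I.n * 100 + S.g * 258 + 200

/-- Processing a group does not revoke an answer, and if `D ≠ 0`, that is, if the group contains the
third node of a zero triangle, then such a triangle is found with probability at least `2 / 3`. The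
constant `A` carries the potential through the groups whose outcome does not matter. -/
theorem wp_groupBody {k L R' : ℕ} (hS : S.Reliable k L R') {γ : ℕ} (hγ : γ < S.G) {σ : State}
    (hσ : S.Group γ σ) (A D : ℝ≥0∞) (hD : D = 0 ∨ ∃ j < S.I.n * S.I.n, S.I.Truth S.g γ j) :
    WP S.B S.X [groupBody S.O, incr 11] S.groupTime σ
      (fun σ' => S.Group (γ + 1) σ' ∧ (σ.reg 0 ≠ 0 → σ'.reg 0 ≠ 0))
      (fun σ' => A + D * if σ'.reg 0 = 0 then 1 else 0) (A + D * (1 / 3)) := by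
  have hX := S.lt_X
  have hDp := S.depth
  have hn := S.n_pos
  have hXn := S.sq_lt
  have hst := hσ.static
  refine WP.time_mono (WP.block (WP.forTo S.room (t := S.R * (S.repTime + 8) + 15 +
      (S.I.n * S.I.n * 58 + S.g * 258 + 100)) (by omega) (by norm_num) (by norm_num)
      (S.I.n * S.I.n) 20
    (fun i σ' => (∀ a, a ≠ 3 → σ'.arr a = σ.arr a) ∧ (∀ x, x ≠ 30 → σ'.reg x = σ.reg x) ∧
      σ'.reg 30 = i ∧ ∀ j < i, σ'.arr 3 j = 0) (fun _ _ => A + D * (1 / 3))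
    (fun i _ σ' h => ⟨h.2.2.1, (h.2.1 10 (by norm_num)).trans hst.r10⟩) ?init le_rfl ?zero
    fun σ₁ _ h₁ => ?rest)) (by simp [groupTime]; omega)
  case init =>
    refine ⟨fun _ _ => rfl, fun x hx => by simp [hx], by simp, fun j hj => ?_⟩
    omega
  case zero =>
    rintro i hi σ' - ⟨h1, h2, h3, h4⟩
    refine WP.time_mono (WP.put S.room (fits_edge _ (by simp) (by simp))
      (fits_edge _ (by simp; omega) (by simp)) (fun _ => by simp; omega)
      (WP.incr S.room (t := 0) (by omega) (by norm_num) (fun _ => by simp [h3]; omega)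
        (WP.nil ?_ le_rfl))) (by simp)
    refine ⟨fun a ha => ?_, fun x hx => ?_, by simp [h3], fun j hj => ?_⟩
    · rw [setReg_arr, setCell_arr, if_neg ha, h1 a ha]
    · rw [setReg_reg, if_neg hx, setCell_reg, h2 x hx]
    · rw [setReg_arr, setCell_arr, if_pos rfl, Function.update_apply]
      simp only [eval, h3]
      split_ifs with hji
      · rfl
      · exact h4 j (by omega)
  case rest =>
    obtain ⟨h1, h2, h3, h4⟩ := h₁
    refine WP.forTo S.room (t := S.I.n * S.I.n * 58 + S.g * 258 + 100) (by omega) (by norm_num)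
      (by norm_num) S.R S.repTime (fun ρ σ' => S.Rep γ ρ σ σ')
      (fun ρ σ' => A + S.potential (D * (2 / 3) ^ R' * (6 / 5) ^ (S.R - ρ)) γ ρ (σ'.arr 3))
      (fun i _ σ' h => ⟨h.r12, h.static.r8⟩) ?init2 ?start ?rep fun σ₂ _ h₂ => ?fin
    case init2 =>
      refine ⟨hst.congr (fun x hx => ?_) fun a ha => h1 a (by omega), ?_, by simp, fun x hx => ?_,
        ?_, ?_, fun b α i => ?_, fun j hj => ?_⟩
      · rw [setReg_reg, if_neg (by omega), h2 x (by omega)]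
      · simp [h2 11, hσ.r11]
      · rw [setReg_reg, if_neg (by omega), h2 x (by omega)]
      · simp [h2 58, hσ.r58]
      · simp [h2 59, hσ.r59]
      · have hb : stampArr b α ≠ 3 := by cases b <;> simp [stampArr] <;> omega
        have := clk_eq b
        rw [setReg_reg, if_neg (by omega), h2 (clk b) (by omega), setReg_arr, h1 _ hb]
        exact hσ.stamps b α i
      · rw [setReg_arr, h4 j hj]
    case start =>
      refine add_le_add_right ?_ _
      have hw : ∀ j ∈ Finset.range (S.I.n * S.I.n),
          S.weight (D * (2 / 3) ^ R' * (6 / 5) ^ (S.R - 0)) γ j 0 ((σ₁.setReg 12 0).arr 3 j) =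
            D * (24 / 25) ^ R' := by
        intro j hj
        have h0 : (σ₁.setReg 12 0).arr 3 j = 0 := h4 j (Finset.mem_range.1 hj)
        have hw0 : S.wrong γ j 0 0 = 0 := by simp [wrong]
        have hc : (2 / 3 : ℝ≥0∞) * (6 / 5) ^ 2 = 24 / 25 := by
          rw [← ENNReal.toReal_eq_toReal_iff' (by finiteness) (by finiteness), ENNReal.toReal_mul,
            ENNReal.toReal_pow]
          simp
          norm_num
        rw [weight, h0, hw0, pow_zero, mul_one, Nat.sub_zero, hS.R_eq, pow_mul, mul_assoc,
          ← mul_pow, hc]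
      rw [potential, Finset.sum_congr rfl hw, Finset.sum_const, Finset.card_range, nsmul_eq_mul,
        mul_left_comm]
      exact mul_le_mul_right hS.decay _
    case rep =>
      intro ρ hρ σ' _ hI
      refine (wp_repBody hγ hρ hI hS.pos_le hS.neg_le hS.card_divisors_le hS.le_M A
        (D * (2 / 3) ^ R' * (6 / 5) ^ (S.R - (ρ + 1)))).le_expect (le_of_eq ?_)
      rw [potential_mul]
      congr 2
      rw [show S.R - ρ = S.R - (ρ + 1) + 1 by omega, pow_succ]
      ring
    case fin =>
      refine (wp_decide hS.adj_le hγ h₂ hσ.sound hS.R_eq A D hD).le_expect (le_of_eq ?_)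
      rw [potential_mul, Nat.sub_self, pow_zero, mul_one]

variable (S) in
/-- There is a triangle of weight zero. -/
def HasZero : Prop := ∃ a < S.I.n, ∃ b < S.I.n, ∃ c < S.I.n, S.I.Zero a b c

theorem exists_truth (h : S.HasZero) :
    ∃ γ ≤ S.I.n / S.g, ∃ j < S.I.n * S.I.n, S.I.Truth S.g γ j := by
  obtain ⟨a, ha, b, hb, c, hc, h⟩ := h
  have hn := S.n_pos
  have hg := S.g_pos
  have h1 : (a * S.I.n + b) / S.I.n = a := by
    rw [mul_comm, Nat.mul_add_div hn, Nat.div_eq_of_lt hb, add_zero]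
  have h2 : (a * S.I.n + b) % S.I.n = b := by
    rw [mul_comm, Nat.mul_add_mod, Nat.mod_eq_of_lt hb]
  have h3 : S.I.node S.g (c / S.g) (c % S.g) = c := by
    rw [Inst.node, Nat.div_add_mod', Nat.mod_eq_of_lt hc]
  refine ⟨c / S.g, Nat.div_le_div_right hc.le, a * S.I.n + b, ?_, h.1, c % S.g, Nat.mod_lt _ hg, ?_⟩
  · have : (a + 1) * S.I.n ≤ S.I.n * S.I.n := Nat.mul_le_mul_right _ ha
    nlinarith
  · rw [h1, h2, h3]
    exact h

open Classical in
/-- The loop over the groups: only one group that contains a zero triangle has to succeed. -/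
theorem wp_groups {k L R' : ℕ} (hS : S.Reliable k L R') {σ : State} (hst : S.Static σ)
    (h0 : σ.reg 0 = 0) (h58 : σ.reg 58 = 0) (h59 : σ.reg 59 = 0) (hs : Stamps σ) :
    WP S.B S.X [forTo 11 9 (groupBody S.O)] (S.G * (S.groupTime + 8) + 15) σ
      (fun σ' => S.I.Sound σ') (fun σ' => if S.HasZero ∧ σ'.reg 0 = 0 then 1 else 0) (1 / 3) := by
  have hDp := S.depth
  have hinit : S.Group 0 (σ.setReg 11 0) := by
    refine ⟨hst.congr (fun x hx => ?_) fun _ _ => rfl, by simp, Or.inl (by simp [h0]), ?_, ?_,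
      fun b α i => ?_⟩
    · rw [setReg_reg, if_neg (by omega)]
    · simp [h58]
    · simp [h59]
    · have := clk_eq b
      rw [setReg_reg, if_neg (by omega)]
      exact hs b α i
  by_cases hz : S.HasZero
  · obtain ⟨γ₀, hγ₀, hj⟩ := exists_truth hz
    refine (WP.forTo S.room (t := 0) (by omega) (by norm_num) (by norm_num) S.G S.groupTime
      (fun γ σ' => S.Group γ σ')
      (fun γ σ' => if γ ≤ γ₀ then 1 / 3 else if σ'.reg 0 = 0 then 1 else 0)
      (fun i _ σ' h => ⟨h.r11, h.static.r9⟩) hinit (by simp) (fun γ hγ σ' _ hI => ?_)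
      fun σ' _ h => WP.nil h.sound ?_).time_mono (by omega)
    · rcases lt_trichotomy γ γ₀ with h | h | h
      · refine (wp_groupBody hS hγ hI (1 / 3) 0 (Or.inl rfl)).mono le_rfl (fun _ _ h => h.1)
          (fun σ'' _ _ => ?_) ?_
        · rw [if_pos (by omega)]
          simp
        · rw [if_pos (by omega)]
          simp
      · refine (wp_groupBody hS hγ hI 0 1 (Or.inr (h ▸ hj))).mono le_rfl (fun _ _ h => h.1)
          (fun σ'' _ _ => ?_) ?_
        · rw [if_neg (by omega)]
          simp
        · rw [if_pos (by omega)]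
          simp
      · refine (wp_groupBody hS hγ hI (if σ'.reg 0 = 0 then 1 else 0) 0 (Or.inl rfl)).mono le_rfl
          (fun _ _ h => h.1) (fun σ'' _ h' => ?_) ?_
        · rw [if_neg (show ¬ γ + 1 ≤ γ₀ by omega)]
          have := h'.2
          by_cases h1 : σ'.reg 0 = 0
          · simp only [h1, if_true]
            split_ifs <;> simp
          · simp [this h1]
        · rw [if_neg (show ¬ γ ≤ γ₀ by omega)]
          simp
    · have hG := hS.G_eq
      rw [if_neg (show ¬ S.G ≤ γ₀ by omega)]
      simp [hz]
  · refine (WP.forTo S.room (t := 0) (by omega) (by norm_num) (by norm_num) S.G S.groupTime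
      (fun γ σ' => S.Group γ σ') (fun _ _ => 1 / 3)
      (fun i _ σ' h => ⟨h.r11, h.static.r9⟩) hinit le_rfl (fun γ hγ σ' _ hI => ?_)
      fun σ' _ h => WP.nil h.sound ?_).time_mono (by omega)
    · exact (wp_groupBody hS hγ hI (1 / 3) 0 (Or.inl rfl)).mono le_rfl (fun _ _ h => h.1)
        (fun σ'' _ _ => by simp) (by simp)
    · simp [hz]

end Setting

/-! ### The choice of the parameters -/

theorem eval_powE (σ : State) (e : Expr) (r : ℕ) : (powE e r).eval σ = e.eval σ ^ r := by
  induction r with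
  | zero => rfl
  | succ r ih => simp [powE, ih, pow_succ]

theorem size_powE (e : Expr) (r : ℕ) : (powE e r).size = 1 + r * e.size := by
  induction r with
  | zero => simp [powE]
  | succ r ih =>
    simp only [powE, mul_def, size, ih]
    ring

theorem cost_powE (e : Expr) (r : ℕ) : (powE e r).cost = 1 + r * (e.cost + 3) := by
  induction r with
  | zero => simp [powE]
  | succ r ih =>
    simp only [powE, mul_def, cost, ih]
    ring

theorem tame_powE {X : ℕ} (hX : 2 ≤ X) {e : Expr} (he : e.Tame X) (r : ℕ) : (powE e r).Tame X := by
  induction r with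
  | zero => simp only [powE, Tame]; omega
  | succ r ih => exact ⟨trivial, ih, he⟩

theorem eq_of_pow_le {r n h h' : ℕ} (h1 : h ^ r ≤ n) (h2 : n < (h + 1) ^ r) (h3 : h' ^ r ≤ n)
    (h4 : n < (h' + 1) ^ r) : h = h' := by
  have h5 := lt_of_pow_lt_pow_left' r (h1.trans_lt h4)
  have h6 := lt_of_pow_lt_pow_left' r (h3.trans_lt h2)
  omega

namespace Setting

variable {S : Setting}

open Classical in
/-- The whole program never claims a wrong triangle, and overlooks all triangles of weight zero with
probability at most `1 / 3`. -/
theorem wp_triangleProgram {k L R' r C₁ C₂ h : ℕ} (hS : S.Reliable k L R') (hr : 1 ≤ r)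
    (hrD : 2 * r + 8 ≤ S.D) (hC₁ : C₁ < S.X) (hC₂ : C₂ < S.X) (hh : h ^ r ≤ S.I.n)
    (hh' : S.I.n < (h + 1) ^ r) (hg : S.g = h * h) (hM : S.M = C₁ * h * h * h) (hR : S.R = C₂ * h)
    (hnX : S.I.n + 1 < S.X) {σ : State} (h0 : ∀ x, σ.reg x = if x = 0 then S.I.n else 0)
    (ha0 : σ.arr 0 = S.I.adj) (ha1 : σ.arr 1 = S.I.pos) (ha2 : σ.arr 2 = S.I.neg)
    (ha : ∀ a, 3 ≤ a → ∀ i, σ.arr a i = 0) :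
    WP S.B S.X [triangleProgram S.O r C₁ C₂]
      (S.G * (S.groupTime + 8) + S.I.n * (8 * r + 50) + 200) σ
      (fun σ' => S.I.Sound σ') (fun σ' => if S.HasZero ∧ σ'.reg 0 = 0 then 1 else 0) (1 / 3) := by
  have hX := S.lt_X
  have hDp := S.depth
  have hn := S.n_pos
  have hXn := S.sq_lt
  have hMX := S.M_lt
  have hRX := S.R_lt
  have hGX := S.G_lt
  have hgX : S.g < S.X := by
    have h1 := S.edges_lt 0 (by have := S.M_pos; omega)
    have h2 : 1 * S.g ≤ (S.I.n * 0 + S.I.n) * S.g := Nat.mul_le_mul_right _ (by omega)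
    omega
  set σ₁ := (((σ.setReg 4 S.I.n).setReg 0 0).setReg 10 (S.I.n * S.I.n)).setReg 5 1 with hσ₁
  refine WP.time_mono (WP.block
    (t := S.G * (S.groupTime + 8) + S.I.n * (8 * r + 50) + 180) (WP.time_mono
    (WP.assign_eq S.room S.I.n (by norm_num) (fits_edge _ (by simp) (by simp)) (by simp [h0])
      (fun _ => by omega)
    (WP.assign_eq S.room 0 (by norm_num) (fits_edge _ (by simp; omega) (by simp)) (by simp)
      (fun _ => by omega)
    (WP.assign_eq S.room (S.I.n * S.I.n) (by norm_num) (fits_edge _ (by simp) (by simp)) (by simp)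
      (fun _ => by omega)
    (WP.assign_eq S.room 1 (t := S.G * (S.groupTime + 8) + S.I.n * (8 * r + 50) + 100) (by norm_num)
      (fits_edge _ (by simp; omega) (by simp)) (by simp) (fun _ => by omega) ?loop))))
      (by simp; omega))) (by simp; omega)
  case loop =>
    refine WP.time_mono (WP.forTo S.room (t := S.G * (S.groupTime + 8) + 80) (by omega)
      (by norm_num) (by norm_num) S.I.n (8 * r + 40)
      (fun i σ' => σ'.arr = σ.arr ∧ (∀ x, x ≠ 5 → x ≠ 11 → σ'.reg x = σ₁.reg x) ∧ σ'.reg 11 = i ∧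
        1 ≤ σ'.reg 5 ∧ σ'.reg 5 ^ r ≤ S.I.n ∧ σ'.reg 5 ≤ i + 1 ∧
        (σ'.reg 5 = i + 1 ∨ S.I.n < (σ'.reg 5 + 1) ^ r))
      (fun _ _ => 1 / 3) (fun i _ σ' hI => ⟨hI.2.2.1, by rw [hI.2.1 4 (by norm_num) (by norm_num)]
                                                         simp [hσ₁]⟩)
      ⟨rfl, fun x h1 h2 => by simp [hσ₁, h2], by simp, by simp, by simpa using hn, by simp, by simp⟩
      le_rfl ?body fun σ₂ _ h₂ => ?rest) (by
        have : S.I.n * (8 * r + 40 + 8) ≤ S.I.n * (8 * r + 50) := Nat.mul_le_mul_left _ (by omega)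
        omega)
    case body =>
      rintro i hi σ' - ⟨h1, h2, h3, h4, h5, h6, h7⟩
      have e4 : σ'.reg 4 = S.I.n := by
        rw [h2 4 (by norm_num) (by norm_num)]
        simp [hσ₁]
      refine WP.time_mono (WP.assign_eq S.room
        (if S.I.n < (σ'.reg 5 + 1) ^ r then σ'.reg 5 else σ'.reg 5 + 1) (by norm_num)
        ⟨⟨⟨trivial, by simp, tame_powE (by omega) (by simp; omega) r⟩, by simp, by simp; omega⟩, ?_⟩
        (by simp [eval_powE, e4])
        (fun _ => by split_ifs <;> omega) (WP.incr S.room (t := 0) (by omega) (by norm_num)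
          (fun _ => by simp [h3]; omega) (WP.nil ?_ le_rfl))) ?_
      · simp [size_powE]
        omega
      · refine ⟨h1, fun x hx hx' => by simp [hx, hx', h2 x hx hx'], by simp [h3], ?_⟩
        have e5 : ∀ v, ((σ'.setReg 5 v).setReg 11 ((σ'.setReg 5 v).reg 11 + 1)).reg 5 = v := by
          intro v
          simp
        rw [e5]
        split_ifs with hc
        · exact ⟨h4, h5, by omega, Or.inr hc⟩
        · exact ⟨by omega, by omega, by omega, by omega⟩
      · simp [cost_powE]
        omega
    case rest =>
      obtain ⟨h1, h2, h3, h4, h5, h6, h7⟩ := h₂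
      have h8 : S.I.n < (σ₂.reg 5 + 1) ^ r := by
        rcases h7 with h7 | h7
        · have := Nat.le_self_pow (n := r) (by omega) (σ₂.reg 5)
          omega
        · exact h7
      have e5 : σ₂.reg 5 = h := eq_of_pow_le h5 h8 hh hh'
      have e4 : σ₂.reg 4 = S.I.n := by
        rw [h2 4 (by norm_num) (by norm_num)]
        simp [hσ₁]
      have e10 : σ₂.reg 10 = S.I.n * S.I.n := by
        rw [h2 10 (by norm_num) (by norm_num)]
        simp [hσ₁]
      refine WP.time_mono
        (WP.assign_eq S.room S.g (by norm_num) (fits_edge _ (by simp) (by simp)) (by simp [e5, hg])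
          (fun _ => hgX)
        (WP.assign_eq S.room S.M (by norm_num) (fits_edge _ (by simp; omega) (by simp))
          (by simp [e5, hM]) (fun _ => by omega)
        (WP.assign_eq S.room S.R (by norm_num) (fits_edge _ (by simp; omega) (by simp))
          (by simp [e5, hR]) (fun _ => by omega)
        (WP.assign_eq S.room S.G (by norm_num) (fits_edge _ (by simp; omega) (by simp))
          (by simp [e4, hS.G_eq]) (fun _ => by omega)
        (wp_groups hS ⟨by simp [e4], by simp, by simp, by simp, by simp, by simp [e10],
          by simp [h1, ha0], by simp [h1, ha1], by simp [h1, ha2]⟩ ?_ ?_ ?_ fun b α i => ?_)))))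
        (by simp; omega)
      · simp [h2 0, hσ₁]
      · simp [h2 58, hσ₁, h0]
      · simp [h2 59, hσ₁, h0]
      · simp only [setReg_arr, h1]
        rw [ha _ (by simp only [stampArr]; split_ifs <;> omega)]
        exact Nat.zero_le _

end Setting

end ExactTriangle

namespace ExactTriangle

open WordRAM SlotGraph VertexFailure

/-! ### Memory layout of the instances -/

/-- The instance in the memory at the start -/
noncomputable def Inst.ofGraph {n : ℕ} (G : SimpleGraph (Fin n)) (w : Sym2 (Fin n) → ℤ) : Inst where
  n := n
  adj := (input G w).arr 0
  pos := (input G w).arr 1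
  neg := (input G w).arr 2

section Input

variable {n : ℕ} {G : SimpleGraph (Fin n)} {w : Sym2 (Fin n) → ℤ}

theorem rowMajor_le {M : Fin n → Fin n → ℕ} {b : ℕ} (h : ∀ i j, M i j ≤ b) (p : ℕ) :
    rowMajor M p ≤ b := by
  rw [rowMajor]
  split_ifs
  · exact h _ _
  · exact Nat.zero_le _

theorem rowMajor_apply (M : Fin n → Fin n → ℕ) (i j : Fin n) :
    rowMajor M ((i : ℕ) * n + j) = M i j := by
  have hn : 0 < n := i.pos
  have hlt : (i : ℕ) * n + j < n * n := by
    have : ((i : ℕ) + 1) * n ≤ n * n := Nat.mul_le_mul_right _ i.isLt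
    have := j.isLt
    nlinarith
  rw [rowMajor, dif_pos hlt]
  congr 1
  · ext
    simp only [Fin.divNat]
    rw [mul_comm, Nat.mul_add_div hn, Nat.div_eq_of_lt j.isLt, add_zero]
  · ext
    simp only [Fin.modNat]
    rw [mul_comm, Nat.mul_add_mod, Nat.mod_eq_of_lt j.isLt]

open Classical in
theorem adj_ofGraph : (Inst.ofGraph G w).adj = rowMajor fun i j => if G.Adj i j then 1 else 0 :=
  rfl

open Classical in
theorem pos_ofGraph : (Inst.ofGraph G w).pos =
    rowMajor fun i j => if G.Adj i j then (w s(i, j)).toNat else 0 := by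
  simp [Inst.ofGraph, input]

open Classical in
theorem neg_ofGraph : (Inst.ofGraph G w).neg =
    rowMajor fun i j => if G.Adj i j then (-w s(i, j)).toNat else 0 := by
  simp [Inst.ofGraph, input]

theorem adj_ofGraph_le (p : ℕ) : (Inst.ofGraph G w).adj p ≤ 1 := by
  classical
  rw [adj_ofGraph]
  refine rowMajor_le (fun i j => ?_) p
  split_ifs <;> omega

theorem pos_ofGraph_le {k : ℕ} (hw : ∀ e ∈ G.edgeSet, |w e| ≤ (n : ℤ) ^ k) (p : ℕ) :
    (Inst.ofGraph G w).pos p ≤ n ^ k := by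
  classical
  rw [pos_ofGraph]
  refine rowMajor_le (fun i j => ?_) p
  split_ifs with h
  · have := (abs_le.1 (hw s(i, j) h)).2
    rw [Int.toNat_le]
    exact_mod_cast this
  · exact Nat.zero_le _

theorem neg_ofGraph_le {k : ℕ} (hw : ∀ e ∈ G.edgeSet, |w e| ≤ (n : ℤ) ^ k) (p : ℕ) :
    (Inst.ofGraph G w).neg p ≤ n ^ k := by
  classical
  rw [neg_ofGraph]
  refine rowMajor_le (fun i j => ?_) p
  split_ifs with h
  · have := (abs_le.1 (hw s(i, j) h)).1
    rw [Int.toNat_le]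
    push_cast
    omega
  · exact Nat.zero_le _

theorem zero_iff (a b c : Fin n) : (Inst.ofGraph G w).Zero a b c ↔ IsZeroTriangle G w a b c := by
  classical
  have hadj : ∀ i j : Fin n, (Inst.ofGraph G w).adj ((Inst.ofGraph G w).ix i j) =
      if G.Adj i j then 1 else 0 := fun i j => by
    rw [adj_ofGraph]
    exact rowMajor_apply _ i j
  have hpos : ∀ i j : Fin n, (Inst.ofGraph G w).pos ((Inst.ofGraph G w).ix i j) =
      if G.Adj i j then (w s(i, j)).toNat else 0 := fun i j => by
    rw [pos_ofGraph]
    exact rowMajor_apply _ i j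
  have hneg : ∀ i j : Fin n, (Inst.ofGraph G w).neg ((Inst.ofGraph G w).ix i j) =
      if G.Adj i j then (-w s(i, j)).toNat else 0 := fun i j => by
    rw [neg_ofGraph]
    exact rowMajor_apply _ i j
  simp only [Inst.Zero, Inst.wsum, hadj, hpos, hneg, IsZeroTriangle]
  by_cases h1 : G.Adj a b <;> by_cases h2 : G.Adj b c <;> by_cases h3 : G.Adj a c <;>
    simp [h1, h2, h3]
  omega

theorem input_bounded {k B : ℕ} (hw : ∀ e ∈ G.edgeSet, |w e| ≤ (n : ℤ) ^ k) (hB : 1 < B)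
    (hn : n < B) (hk : n ^ k < B) : (input G w).Bounded B := by
  refine ⟨fun x => ?_, fun a i => ?_⟩
  · simp only [input]
    split_ifs <;> omega
  · by_cases h0 : a = 0
    · subst h0
      exact (adj_ofGraph_le (G := G) (w := w) i).trans_lt hB
    by_cases h1 : a = 1
    · subst h1
      exact (pos_ofGraph_le hw i).trans_lt hk
    by_cases h2 : a = 2
    · subst h2
      exact (neg_ofGraph_le hw i).trans_lt hk
    simp only [input, if_neg h0, if_neg h1, if_neg h2]
    omega

end Input

/-- A run that never claims a wrong triangle and overlooks a triangle with probability at most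
`1 / 3` solves the problem. -/
theorem solves_of_wp {n : ℕ} {G : SimpleGraph (Fin n)} {w : Sym2 (Fin n) → ℤ} {S : Setting}
    (hI : S.I = Inst.ofGraph G w) {P : Cmd} {t T : ℕ} (htT : t ≤ T)
    (hX : (input G w).Bounded S.X) [Decidable S.HasZero]
    (h : WP S.B S.X [P] t (input G w) (fun σ' => S.I.Sound σ')
      (fun σ' => if S.HasZero ∧ σ'.reg 0 = 0 then 1 else 0) (1 / 3)) :
    RunsWithin P S.B T (input G w) ∧
      2 / 3 ≤ (exec P T (input G w)).toOuterMeasure {s | CorrectOutput G w s} := by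
  classical
  have hvars : (input G w).vars = input G w := by
    refine State.ext' (fun x => ?_) (fun _ _ => rfl)
    simp only [State.vars, input]
    split_ifs <;> first | rfl | omega
  have hB : (input G w).Bounded S.B :=
    ⟨fun x => (hX.1 x).trans_le S.room.le, fun a i => (hX.2 a i).trans_le S.room.le⟩
  have hgood := (h hX (input G w) hvars hB [] 0 (fun s => S.I.Sound s.vars)
    (fun s => if S.HasZero ∧ s.vars.reg 0 = 0 then 1 else 0)
    fun s' h1 _ h3 => Good.halted 0 h1 h3 le_rfl).mono htT le_rfl
  refine ⟨⟨hgood.1, fun p hp => (hgood.2.1 p hp).1⟩, ?_⟩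
  have hbad : expect (exec P T (input G w))
      (fun s => if ¬ CorrectOutput G w s then 1 else 0) ≤ 1 / 3 := by
    rw [exec, expect_map]
    refine (expect_mono _ fun p hp => ?_).trans hgood.2.2
    obtain ⟨-, hs⟩ := hgood.2.1 p hp
    by_cases hc : CorrectOutput G w p.2
    · rw [if_neg (not_not.2 hc)]
      exact zero_le
    · rw [if_pos hc]
      dsimp only
      rw [if_pos]
      have hr : ∀ x < 4, p.2.vars.reg x = p.2.reg x := fun x hx => vars_reg _ (by omega)
      rw [Inst.Sound, hr 0 (by norm_num), hr 1 (by norm_num), hr 2 (by norm_num),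
        hr 3 (by norm_num), hI] at hs
      rw [hr 0 (by norm_num)]
      rcases hs with h0 | ⟨h0, hz, ha, hb, hc'⟩
      · refine ⟨?_, h0⟩
        by_contra hno
        refine hc (Or.inr ⟨h0, ?_⟩)
        rintro ⟨a, b, c, habc⟩
        refine hno ?_
        rw [Setting.HasZero, hI]
        exact ⟨a, a.isLt, b, b.isLt, c, c.isLt, (zero_iff a b c).2 habc⟩
      · exact absurd (Or.inl ⟨h0, ⟨_, ha⟩, ⟨_, hb⟩, ⟨_, hc'⟩,
          (zero_iff (G := G) (w := w) ⟨_, ha⟩ ⟨_, hb⟩ ⟨_, hc'⟩).1 hz, rfl, rfl, rfl⟩) hc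
  have hsum := expect_indicator_add_not (exec P T (input G w)) (CorrectOutput G w)
  rw [expect_indicator] at hsum
  have h23 : (2 / 3 : ℝ≥0∞) + 1 / 3 = 1 := by
    rw [← ENNReal.toReal_eq_toReal_iff' (by finiteness) (by finiteness), ENNReal.toReal_add
      (by finiteness) (by finiteness)]
    simp
    norm_num
  have h3 : (1 / 3 : ℝ≥0∞) ≠ ⊤ := by finiteness
  refine (ENNReal.add_le_add_iff_right h3).1 ?_
  exact (h23.trans hsum.symm).le.trans (add_le_add_right hbad _)

end ExactTriangle

namespace ExactTriangle

open WordRAM SlotGraph VertexFailure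

/-! ### Polynomial word bounds -/

theorem mul_pow_lt (n a b : ℕ) : a * (n + 2) ^ b < (n + 2) ^ (a + b) := by
  rw [pow_add]
  refine Nat.mul_lt_mul_of_pos_right ?_ (by positivity)
  exact a.lt_two_pow_self.trans_le (Nat.pow_le_pow_left (by omega) a)

section Bounds

variable {n h q C : ℕ}

theorem edges_le (hh : h ≤ n) (hq : q < 2 * (C * h * h * h)) :
    n * q + n ≤ 2 * C * (n + 2) ^ 4 ∧ (n * q + n) * (h * h) ≤ 2 * C * (n + 2) ^ 6 := by
  have hx : h ≤ n + 2 := by omega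
  have h1 : q + 1 ≤ 2 * C * (n + 2) ^ 3 := by
    calc q + 1 ≤ 2 * C * h ^ 3 := by
          have : 2 * (C * h * h * h) = 2 * C * h ^ 3 := by ring
          omega
      _ ≤ _ := Nat.mul_le_mul_left _ (Nat.pow_le_pow_left hx 3)
  have h2 : n * q + n ≤ 2 * C * (n + 2) ^ 4 := by
    calc n * q + n = n * (q + 1) := by ring
      _ ≤ (n + 2) * (2 * C * (n + 2) ^ 3) := Nat.mul_le_mul (by omega) h1
      _ = _ := by ring
  refine ⟨h2, ?_⟩
  calc (n * q + n) * (h * h) ≤ 2 * C * (n + 2) ^ 4 * ((n + 2) * (n + 2)) :=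
        Nat.mul_le_mul h2 (Nat.mul_le_mul hx hx)
    _ = _ := by ring

theorem numVerts_add_two_le (hh : h ≤ n) (hq : q < 2 * (C * h * h * h)) :
    numVerts (n * q + n) (h * h) (q + 2) + 2 ≤ (4 * C + 3) * (n + 2) ^ 5 := by
  have hx : h ≤ n + 2 := by omega
  obtain ⟨h1, -⟩ := edges_le hh hq
  have h2 : q + 2 ≤ (2 * C + 1) * (n + 2) ^ 3 := by
    have h3 : C * h * h * h ≤ C * (n + 2) ^ 3 := by
      calc C * h * h * h = C * h ^ 3 := by ring
        _ ≤ _ := Nat.mul_le_mul_left _ (Nat.pow_le_pow_left hx 3)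
    have h4 : 1 ≤ (n + 2) ^ 3 := Nat.one_le_pow _ _ (by omega)
    nlinarith
  have h5 : h * h * (q + 2) ≤ (2 * C + 1) * (n + 2) ^ 5 := by
    calc h * h * (q + 2) ≤ (n + 2) * (n + 2) * ((2 * C + 1) * (n + 2) ^ 3) :=
          Nat.mul_le_mul (Nat.mul_le_mul hx hx) h2
      _ = _ := by ring
  have h6 : (n + 2) ^ 4 ≤ (n + 2) ^ 5 := Nat.pow_le_pow_right (by omega) (by norm_num)
  have h7 : 1 ≤ (n + 2) ^ 5 := Nat.one_le_pow _ _ (by omega)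
  have h8 : 2 * C * (n + 2) ^ 4 ≤ 2 * C * (n + 2) ^ 5 := Nat.mul_le_mul_left _ h6
  simp only [numVerts]
  nlinarith

end Bounds

/-- The exponent of the bound for variables and array entries -/
def expo (C₁ C₂ c k Y : ℕ) : ℕ := (4 * C₁ + 8) * c + (4 * C₁ + C₂ + k + Y + 20)

theorem lt_pow_expo {n C₁ C₂ c k Y a b v : ℕ} (hv : v ≤ a * (n + 2) ^ b)
    (h : a + b ≤ expo C₁ C₂ c k Y) : v < (n + 2) ^ expo C₁ C₂ c k Y :=
  (hv.trans_lt (mul_pow_lt n a b)).trans_le (Nat.pow_le_pow_right (by omega) h)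

/-- The setting of the program for an instance, if `h` is the integer part of a root of the number of
nodes. Names of registers in the programs of the oracle are below `Y`. -/
def Setting.ofRoot {O : Oracle} {tpre : ℕ → ℕ → ℕ → ℕ} {tupd tqry : ℕ → ℕ → ℕ} {c : ℕ}
    (hO : Serves O tpre tupd tqry c) (I : Inst) {C₁ C₂ k Y D h Tp Tu Tq : ℕ} (hn : 1 ≤ I.n)
    (hC₁ : 1 ≤ C₁) (hD : 64 ≤ D) (hh1 : 1 ≤ h) (hh : h ≤ I.n)
    (hY : NamesLt Y O.pre ∧ NamesLt Y O.upd ∧ NamesLt Y O.qry)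
    (hT : ∀ q, C₁ * h * h * h ≤ q → q < 2 * (C₁ * h * h * h) →
      tpre (numVerts (I.n * q + I.n) (h * h) (q + 2)) ((I.n * q + I.n) * (h * h))
          (I.n * q + I.n) ≤ Tp ∧
        tupd (numVerts (I.n * q + I.n) (h * h) (q + 2)) 2 ≤ Tu ∧
          tqry (numVerts (I.n * q + I.n) (h * h) (q + 2)) 2 ≤ Tq) : Setting where
  O := O
  tpre := tpre
  tupd := tupd
  tqry := tqry
  c := c
  serves := hO
  I := I
  g := h * h
  M := C₁ * h * h * h
  R := C₂ * h
  G := I.n / (h * h) + 1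
  B := ((I.n + 2) ^ expo C₁ C₂ c k Y) ^ D
  X := (I.n + 2) ^ expo C₁ C₂ c k Y
  D := D
  room := ⟨lt_pow_expo (a := 1) (b := 0) (by simp) (by simp only [expo]; omega), le_rfl, by omega⟩
  depth := hD
  Tp := Tp
  Tu := Tu
  Tq := Tq
  n_pos := hn
  g_pos := Nat.mul_pos hh1 hh1
  M_pos := Nat.mul_pos (Nat.mul_pos (Nat.mul_pos hC₁ hh1) hh1) hh1
  names_pre := hY.1.mono (lt_pow_expo (a := Y) (b := 0) (by simp) (by simp only [expo]; omega)).le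
  names_upd := hY.2.1.mono (lt_pow_expo (a := Y) (b := 0) (by simp) (by simp only [expo]; omega)).le
  names_qry := hY.2.2.mono (lt_pow_expo (a := Y) (b := 0) (by simp) (by simp only [expo]; omega)).le
  lt_X := by
    refine lt_pow_expo (a := 1) (b := 6) ?_ (by simp only [expo]; omega)
    have : 2 ^ 6 ≤ (I.n + 2) ^ 6 := Nat.pow_le_pow_left (by omega) 6
    omega
  word_le q hq := by
    calc _ ≤ ((I.n + 2) ^ (4 * C₁ + 3 + 5)) ^ c := Nat.pow_le_pow_left
          ((numVerts_add_two_le hh hq).trans (mul_pow_lt _ _ _).le) c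
      _ = (I.n + 2) ^ ((4 * C₁ + 8) * c) := by rw [← pow_mul]
      _ ≤ _ := Nat.pow_le_pow_right (by omega) (by simp only [expo]; omega)
  size_lt q hq :=
    lt_pow_expo ((Nat.le_add_right _ 2).trans (numVerts_add_two_le hh hq))
      (by simp only [expo]; omega)
  edges_lt q hq := lt_pow_expo (edges_le hh hq).2 (by simp only [expo]; omega)
  sq_lt := lt_pow_expo (a := 1) (b := 2) (by nlinarith) (by simp only [expo]; omega)
  M_lt := by
    refine lt_pow_expo (a := 2 * C₁) (b := 3) ?_ (by simp only [expo]; omega)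
    calc 2 * (C₁ * h * h * h) = 2 * C₁ * h ^ 3 := by ring
      _ ≤ _ := Nat.mul_le_mul_left _ (Nat.pow_le_pow_left (by omega) 3)
  R_lt := by
    refine lt_pow_expo (a := C₂) (b := 1) ?_ (by simp only [expo]; omega)
    exact Nat.mul_le_mul_left _ (by rw [pow_one]; omega)
  G_lt := by
    refine lt_pow_expo (a := 1) (b := 1) ?_ (by simp only [expo]; omega)
    have := Nat.div_le_self I.n (h * h)
    rw [pow_one]
    omega
  clk_lt := by
    refine lt_pow_expo (a := C₂) (b := 4) ?_ (by simp only [expo]; omega)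
    have h1 := Nat.div_le_self I.n (h * h)
    calc (I.n / (h * h) + 1) * (C₂ * h) * (I.n * I.n + 1)
        ≤ (I.n + 2) * (C₂ * (I.n + 2)) * (I.n + 2) ^ 2 := by
          refine Nat.mul_le_mul (Nat.mul_le_mul (by omega) (Nat.mul_le_mul_left _ (by omega))) ?_
          nlinarith
      _ = _ := by ring
  time_le := hT

/-! ### The number of repetitions -/

theorem decay_le {n h r s : ℕ} (hh1 : 1 ≤ h) (hn : n < (h + 1) ^ r) (hs : 2 * r + 2 ≤ s) :
    ((n * n : ℕ) : ℝ≥0∞) * (24 / 25) ^ (17 * s * h) ≤ 1 / 3 := by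
  have h1 : h + 1 ≤ 2 ^ h := Nat.lt_two_pow_self
  have h2 : n ≤ 2 ^ (h * r) := by
    rw [pow_mul]
    exact hn.le.trans (Nat.pow_le_pow_left h1 r)
  have h3 : 3 * (n * n) ≤ 2 ^ (s * h) := by
    calc 3 * (n * n) ≤ 2 ^ 2 * (2 ^ (h * r) * 2 ^ (h * r)) :=
          Nat.mul_le_mul (by norm_num) (Nat.mul_le_mul h2 h2)
      _ = 2 ^ (2 + (h * r + h * r)) := by rw [← pow_add, ← pow_add]
      _ ≤ 2 ^ (s * h) := Nat.pow_le_pow_right (by norm_num) (by nlinarith)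
  rw [← ENNReal.toReal_le_toReal (by finiteness) (by finiteness), ENNReal.toReal_mul,
    ENNReal.toReal_pow, ENNReal.toReal_natCast]
  have h4 : (24 / 25 : ℝ≥0∞).toReal = 24 / 25 := by simp
  have h5 : (1 / 3 : ℝ≥0∞).toReal = 1 / 3 := by simp
  rw [h4, h5, mul_assoc, pow_mul]
  have h6 : ((24 / 25 : ℝ) ^ 17) ^ (s * h) ≤ (1 / 2) ^ (s * h) :=
    pow_le_pow_left₀ (by positivity) (by norm_num) _
  have h7 : (3 : ℝ) * ((n * n : ℕ) : ℝ) ≤ 2 ^ (s * h) := by exact_mod_cast h3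
  have h8 : (2 : ℝ) ^ (s * h) * (1 / 2) ^ (s * h) = 1 := by rw [← mul_pow]; norm_num
  have h9 : (0 : ℝ) ≤ (1 / 2) ^ (s * h) := by positivity
  calc ((n * n : ℕ) : ℝ) * ((24 / 25 : ℝ) ^ 17) ^ (s * h)
      ≤ ((n * n : ℕ) : ℝ) * (1 / 2) ^ (s * h) := mul_le_mul_of_nonneg_left h6 (by positivity)
    _ ≤ 1 / 3 := by nlinarith

theorem exists_root {r n : ℕ} (hr : 1 ≤ r) (hn : 1 ≤ n) :
    ∃ h, 1 ≤ h ∧ h ^ r ≤ n ∧ n < (h + 1) ^ r := by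
  have hex : ∃ m, n < (m + 1) ^ r :=
    ⟨n, (Nat.lt_succ_self n).trans_le (Nat.le_self_pow (by omega) _)⟩
  classical
  obtain ⟨m, hm⟩ : ∃ m, Nat.find hex = m := ⟨_, rfl⟩
  have h1 : n < (m + 1) ^ r := hm ▸ Nat.find_spec hex
  have h0 : m ≠ 0 := by
    rintro rfl
    simp at h1
    omega
  refine ⟨m, by omega, ?_, h1⟩
  have h2 := Nat.find_min hex (m := m - 1) (by omega)
  rw [Nat.sub_add_cancel (by omega)] at h2
  omega

end ExactTriangle

namespace ExactTriangle

open WordRAM SlotGraph VertexFailure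

/-! ### Running time -/

theorem exists_le_mul_rpow {t : ℕ → ℕ → ℕ} (ht : SubpolynomialTime t) (η : ℕ) {δ : ℝ}
    (hδ : 0 < δ) : ∃ A : ℝ, 0 ≤ A ∧ ∀ N : ℕ, 1 ≤ N → (t N η : ℝ) ≤ A * (N : ℝ) ^ δ := by
  obtain ⟨f, h, hh, hb⟩ := ht
  obtain ⟨N₀, hN₀⟩ := Filter.eventually_atTop.1 (hh.eventually (gt_mem_nhds hδ))
  have hnn : ∀ i ∈ Finset.range N₀, (0 : ℝ) ≤ (i : ℝ) ^ h i := fun i _ =>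
    Real.rpow_nonneg (Nat.cast_nonneg i) _
  have hs := Finset.sum_nonneg hnn
  refine ⟨|f η| * (1 + ∑ i ∈ Finset.range N₀, (i : ℝ) ^ h i), by positivity, fun N hN => ?_⟩
  have hN1 : (1 : ℝ) ≤ N := by exact_mod_cast hN
  have h1 : (1 : ℝ) ≤ (N : ℝ) ^ δ := Real.one_le_rpow hN1 hδ.le
  have h2 : (N : ℝ) ^ h N ≤ (1 + ∑ i ∈ Finset.range N₀, (i : ℝ) ^ h i) * (N : ℝ) ^ δ := by
    rcases Nat.lt_or_ge N N₀ with h3 | h3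
    · have h4 := Finset.single_le_sum hnn (Finset.mem_range.2 h3)
      nlinarith
    · have h4 : (N : ℝ) ^ h N ≤ (N : ℝ) ^ δ := Real.rpow_le_rpow_of_exponent_le hN1 (hN₀ N h3).le
      nlinarith
  have h0 : (0 : ℝ) ≤ (N : ℝ) ^ h N := Real.rpow_nonneg (Nat.cast_nonneg N) _
  calc (t N η : ℝ) ≤ f η * (N : ℝ) ^ h N := hb N η hN
    _ ≤ |f η| * (N : ℝ) ^ h N := mul_le_mul_of_nonneg_right (le_abs_self _) h0
    _ ≤ |f η| * ((1 + ∑ i ∈ Finset.range N₀, (i : ℝ) ^ h i) * (N : ℝ) ^ δ) :=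
      mul_le_mul_of_nonneg_left h2 (abs_nonneg _)
    _ = _ := by ring

theorem rpow_le_mul_rpow {v a x p : ℝ} (hv : 0 ≤ v) (ha : 1 ≤ a) (hx : 0 ≤ x) (h : v ≤ a * x)
    (hp : 0 ≤ p) (hp' : p ≤ 1) : v ^ p ≤ a * x ^ p := by
  calc v ^ p ≤ (a * x) ^ p := Real.rpow_le_rpow hv h hp
    _ = a ^ p * x ^ p := Real.mul_rpow (by linarith) hx
    _ ≤ a * x ^ p := by
      refine mul_le_mul_of_nonneg_right ?_ (Real.rpow_nonneg hx _)
      calc a ^ p ≤ a ^ (1 : ℝ) := Real.rpow_le_rpow_of_exponent_le ha hp'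
        _ = a := Real.rpow_one a

section

variable {n h q C : ℕ}

theorem sets_le (hq : q < 2 * (C * h * h * h)) :
    ((n * q + n : ℕ) : ℝ) ≤ 2 * C * h ^ 3 * n := by
  have : n * q + n ≤ 2 * C * h ^ 3 * n := by
    calc n * q + n = (q + 1) * n := by ring
      _ ≤ 2 * (C * h * h * h) * n := Nat.mul_le_mul_right _ hq
      _ = _ := by ring
  exact_mod_cast this

theorem edges_le_real (hq : q < 2 * (C * h * h * h)) :
    (((n * q + n) * (h * h) : ℕ) : ℝ) ≤ 2 * C * h ^ 5 * n := by
  have h1 := sets_le (n := n) hq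
  calc (((n * q + n) * (h * h) : ℕ) : ℝ) = ((n * q + n : ℕ) : ℝ) * (h * h) := by push_cast; ring
    _ ≤ 2 * C * h ^ 3 * n * (h * h) := mul_le_mul_of_nonneg_right h1 (by positivity)
    _ = _ := by ring

theorem numVerts_le (hn : 1 ≤ n) (hh : 1 ≤ h) (hC : 1 ≤ C) (hq : q < 2 * (C * h * h * h)) :
    ((numVerts (n * q + n) (h * h) (q + 2) : ℕ) : ℝ) ≤ 5 * C * h ^ 5 * n := by
  have h1 : n * q + n ≤ 2 * C * h ^ 5 * n := by
    calc n * q + n = (q + 1) * n := by ring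
      _ ≤ 2 * (C * h * h * h) * n := Nat.mul_le_mul_right _ hq
      _ = 2 * C * h ^ 3 * n := by ring
      _ ≤ _ := Nat.mul_le_mul_right _ (Nat.mul_le_mul_left _
        (Nat.pow_le_pow_right hh (by norm_num)))
  have h2 : h * h * (q + 2) ≤ 3 * C * h ^ 5 * n := by
    have h3 : 1 ≤ C * h * h * h := Nat.mul_pos (Nat.mul_pos (Nat.mul_pos hC hh) hh) hh
    calc h * h * (q + 2) ≤ h * h * (3 * (C * h * h * h)) := Nat.mul_le_mul_left _ (by omega)
      _ = 3 * C * h ^ 5 * 1 := by ring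
      _ ≤ _ := Nat.mul_le_mul_left _ hn
  have h3 : numVerts (n * q + n) (h * h) (q + 2) ≤ 5 * C * h ^ 5 * n := by
    simp only [numVerts]
    calc _ ≤ 2 * C * h ^ 5 * n + 3 * C * h ^ 5 * n := Nat.add_le_add h1 h2
      _ = _ := by ring
  exact_mod_cast h3

end

/-- The preprocessing of the oracle is faster than `n ^ 2`, up to a power of `h`. -/
theorem exists_preprocessing_le {tpre : ℕ → ℕ → ℕ → ℕ} {ε ε₁ : ℝ} (hε₁ : 0 < ε₁) (hle : ε₁ ≤ ε)
    (hε₁' : ε₁ ≤ 1)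
    (h : (∃ K : ℝ, ∀ n m d : ℕ, 1 ≤ d → d ≤ n →
          (tpre n m d : ℝ) ≤ K * ((d : ℝ) ^ (1 - ε) * m + n + m)) ∨
        (∃ K : ℝ, ∀ n m d : ℕ, 1 ≤ d → d ≤ n →
          (tpre n m d : ℝ) ≤ K * (d * (m : ℝ) ^ (1 - ε) + n + m))) {C : ℕ} (hC : 1 ≤ C) :
    ∃ A : ℝ, 0 ≤ A ∧ ∀ n h q : ℕ, 1 ≤ n → 1 ≤ h → q < 2 * (C * h * h * h) →
      (tpre (numVerts (n * q + n) (h * h) (q + 2)) ((n * q + n) * (h * h)) (n * q + n) : ℝ) ≤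
        A * ((n : ℝ) ^ (2 - ε₁) * h ^ 8) := by
  have key : ∃ K : ℝ, ∀ n h q : ℕ, 1 ≤ n → 1 ≤ h → q < 2 * (C * h * h * h) →
      ∃ v w : ℝ, 0 ≤ v ∧ 0 ≤ w ∧ v ≤ 2 * C * h ^ 5 * n ∧ w ≤ 2 * C * h ^ 5 * n ∧
      (v ≤ 2 * C * h ^ 3 * n ∨ w ≤ 2 * C * h ^ 3 * n) ∧
      (tpre (numVerts (n * q + n) (h * h) (q + 2)) ((n * q + n) * (h * h)) (n * q + n) : ℝ) ≤
        K * (v ^ (1 - ε₁) * w + (numVerts (n * q + n) (h * h) (q + 2) : ℕ) +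
          ((n * q + n) * (h * h) : ℕ)) := by
    have hmono : ∀ v : ℕ, 1 ≤ v → (v : ℝ) ^ (1 - ε) ≤ (v : ℝ) ^ (1 - ε₁) := fun v hv =>
      Real.rpow_le_rpow_of_exponent_le (by exact_mod_cast hv) (by linarith)
    have h35 : ∀ h : ℕ, 1 ≤ h → (h : ℝ) ^ 3 ≤ (h : ℝ) ^ 5 := fun h hh =>
      pow_le_pow_right₀ (by exact_mod_cast hh) (by norm_num)
    rcases h with ⟨K, hK⟩ | ⟨K, hK⟩
    · refine ⟨|K|, fun n h q hn hh hq => ⟨(n * q + n : ℕ), ((n * q + n) * (h * h) : ℕ),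
        Nat.cast_nonneg _, Nat.cast_nonneg _, ?_, edges_le_real hq, Or.inl (sets_le hq), ?_⟩⟩
      · refine (sets_le hq).trans ?_
        have := h35 h hh
        gcongr
      · refine (hK _ _ _ (by omega) (Nat.le_add_right _ _)).trans ?_
        refine mul_le_mul (le_abs_self K) ?_ (by positivity) (abs_nonneg K)
        have := hmono (n * q + n) (by omega)
        gcongr
    · refine ⟨|K|, fun n h q hn hh hq => ⟨((n * q + n) * (h * h) : ℕ), (n * q + n : ℕ),
        Nat.cast_nonneg _, Nat.cast_nonneg _, edges_le_real hq, ?_, Or.inr (sets_le hq), ?_⟩⟩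
      · refine (sets_le hq).trans ?_
        have := h35 h hh
        gcongr
      · refine (hK _ _ _ (by omega) (Nat.le_add_right _ _)).trans ?_
        refine mul_le_mul (le_abs_self K) ?_ (by positivity) (abs_nonneg K)
        have := hmono ((n * q + n) * (h * h)) (Nat.mul_pos (by omega) (Nat.mul_pos hh hh))
        rw [mul_comm]
        gcongr
  obtain ⟨K, hK⟩ := key
  refine ⟨|K| * (4 * C ^ 2 + 7 * C), by positivity, fun n h q hn hh hq => ?_⟩
  obtain ⟨v, w, hv, hw, hv5, hw5, h3, hT⟩ := hK n h q hn hh hq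
  have hn1 : (1 : ℝ) ≤ n := by exact_mod_cast hn
  have hh1 : (1 : ℝ) ≤ h := by exact_mod_cast hh
  have hC1 : (1 : ℝ) ≤ C := by exact_mod_cast hC
  set P : ℝ := (n : ℝ) ^ (2 - ε₁) with hP
  have hP1 : (n : ℝ) ^ (1 - ε₁) * n = P := by
    rw [hP, show (2 : ℝ) - ε₁ = (1 - ε₁) + 1 by ring, Real.rpow_add (by linarith), Real.rpow_one]
  have hnP : (n : ℝ) ≤ P := by
    calc (n : ℝ) = (n : ℝ) ^ (1 : ℝ) := (Real.rpow_one _).symm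
      _ ≤ P := Real.rpow_le_rpow_of_exponent_le hn1 (by linarith)
  have hpow : ∀ i : ℕ, (1 : ℝ) ≤ (h : ℝ) ^ i := fun i => one_le_pow₀ hh1
  have hone : ∀ i : ℕ, (1 : ℝ) ≤ 2 * C * (h : ℝ) ^ i := fun i => by
    have := hpow i
    nlinarith
  have hnn : (0 : ℝ) ≤ (n : ℝ) ^ (1 - ε₁) := by positivity
  have h1 : v ^ (1 - ε₁) * w ≤ 4 * C ^ 2 * (P * h ^ 8) := by
    rw [← hP1]
    rcases h3 with h3 | h3
    · calc v ^ (1 - ε₁) * w ≤ (2 * C * h ^ 3 * (n : ℝ) ^ (1 - ε₁)) * (2 * C * h ^ 5 * n) :=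
          mul_le_mul (rpow_le_mul_rpow hv (hone 3) (by linarith) h3 (by linarith) (by linarith)) hw5
            hw (by positivity)
        _ = _ := by ring
    · calc v ^ (1 - ε₁) * w ≤ (2 * C * h ^ 5 * (n : ℝ) ^ (1 - ε₁)) * (2 * C * h ^ 3 * n) :=
          mul_le_mul (rpow_le_mul_rpow hv (hone 5) (by linarith) hv5 (by linarith) (by linarith)) h3
            hw (by positivity)
        _ = _ := by ring
  have h58 : (h : ℝ) ^ 5 ≤ (h : ℝ) ^ 8 := pow_le_pow_right₀ hh1 (by norm_num)
  have h2 : (h : ℝ) ^ 5 * n ≤ P * h ^ 8 := by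
    calc (h : ℝ) ^ 5 * n ≤ h ^ 8 * P := mul_le_mul h58 hnP (by linarith) (by positivity)
      _ = _ := by ring
  have h4 := numVerts_le hn hh hC hq
  have h5 := edges_le_real (n := n) hq
  have h6 : (0 : ℝ) ≤ C := by linarith
  have h7 : 7 * (C : ℝ) * (h ^ 5 * n) ≤ 7 * C * (P * h ^ 8) :=
    mul_le_mul_of_nonneg_left h2 (by positivity)
  have hvw : 0 ≤ v ^ (1 - ε₁) * w := mul_nonneg (Real.rpow_nonneg hv _) hw
  calc _ ≤ _ := hT
    _ ≤ |K| * (v ^ (1 - ε₁) * w + (numVerts (n * q + n) (h * h) (q + 2) : ℕ) +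
          ((n * q + n) * (h * h) : ℕ)) :=
        mul_le_mul_of_nonneg_right (le_abs_self K) (by positivity)
    _ ≤ |K| * ((4 * C ^ 2 + 7 * C) * (P * h ^ 8)) := by
        refine mul_le_mul_of_nonneg_left ?_ (abs_nonneg K)
        linarith
    _ = _ := by ring

/-- The update and query times are small powers of `n`. -/
theorem exists_query_le {t : ℕ → ℕ → ℕ} (ht : SubpolynomialTime t) {C : ℕ} (hC : 1 ≤ C) {δ : ℝ}
    (hδ : 0 < δ) :
    ∃ A : ℝ, 0 ≤ A ∧ ∀ n h q : ℕ, 1 ≤ n → 1 ≤ h → h ≤ n → q < 2 * (C * h * h * h) →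
      (t (numVerts (n * q + n) (h * h) (q + 2)) 2 : ℝ) ≤ A * (n : ℝ) ^ δ := by
  obtain ⟨A, hA, hb⟩ := exists_le_mul_rpow ht 2 (δ := δ / 6) (by positivity)
  refine ⟨A * (5 * C : ℝ) ^ (δ / 6), by positivity, fun n h q hn hh hhn hq => ?_⟩
  have h1 := numVerts_le hn hh hC hq
  have h2 : ((numVerts (n * q + n) (h * h) (q + 2) : ℕ) : ℝ) ≤ 5 * C * (n : ℝ) ^ 6 := by
    have h3 : (h : ℝ) ≤ n := by exact_mod_cast hhn
    calc _ ≤ _ := h1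
      _ ≤ 5 * C * (n : ℝ) ^ 5 * n := by gcongr
      _ = _ := by ring
  calc _ ≤ _ := hb _ (by simp only [numVerts]; omega)
    _ ≤ A * (5 * C * (n : ℝ) ^ 6) ^ (δ / 6) := by gcongr
    _ = A * (5 * C : ℝ) ^ (δ / 6) * (n : ℝ) ^ δ := by
      rw [Real.mul_rpow (by positivity) (by positivity), ← Real.rpow_natCast (n : ℝ) 6,
        ← Real.rpow_mul (by positivity), mul_assoc]
      congr 3
      push_cast
      ring

end ExactTriangle

/-! ### The reduction -/

namespace ExactTriangle

open WordRAM SlotGraph VertexFailure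

set_option maxHeartbeats 1000000 in
/-- The program runs in time `O(n ^ (3 - 1 / (2 * r)))`. With `n / h ^ 2` groups and a number of
repetitions proportional to `h`, the preprocessing costs `n ^ (3 - ε₁) * h ^ 7` in total, which the choice
`8 ≤ ε₁ * r` outweighs, and the queries cost `n ^ 3 / h` up to a factor `n ^ (1 / (2 * r))`. -/
theorem exists_total_le {ε₁ A₁ A₂ : ℝ} {r : ℕ} (hr : 8 ≤ r) (hrε : 8 ≤ ε₁ * r)
    (hA₁ : 0 ≤ A₁) (hA₂ : 0 ≤ A₂) (C₁ C₂ : ℕ) :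
    ∃ K : ℝ, 0 ≤ K ∧ ∀ (S : Setting) (h : ℕ), 1 ≤ h → h ^ r ≤ S.I.n → S.I.n < (h + 1) ^ r →
      S.g = h * h → S.M = C₁ * h * h * h → S.R = C₂ * h → S.G = S.I.n / (h * h) + 1 →
      (S.Tp : ℝ) ≤ A₁ * ((S.I.n : ℝ) ^ (2 - ε₁) * h ^ 8) →
      (S.Tu : ℝ) ≤ A₂ * (S.I.n : ℝ) ^ (1 / (2 * r) : ℝ) →
      (S.Tq : ℝ) ≤ A₂ * (S.I.n : ℝ) ^ (1 / (2 * r) : ℝ) →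
      ((S.G * (S.groupTime + 8) + S.I.n * (8 * r + 50) + 200 : ℕ) : ℝ) ≤
        K * (S.I.n : ℝ) ^ (3 - 1 / (2 * r) : ℝ) := by
  set B : ℝ := 400 * A₂ + 1200 * C₁ + 1016 with hB
  refine ⟨400 * A₁ * C₂ + 4 * C₂ * B + 2264 + (8 * r + 250), by positivity, ?_⟩
  intro S h hh1 hh hh' hg hM hR hG hTp hTu hTq
  have hn := S.n_pos
  have hr0 : (0 : ℝ) < r := by
    have : 0 < r := by omega
    exact_mod_cast this
  set x : ℝ := (S.I.n : ℝ) with hx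
  set y : ℝ := (h : ℝ) with hy
  have hx1 : 1 ≤ x := by rw [hx]; exact_mod_cast hn
  have hx0 : 0 < x := by linarith
  have hy1 : 1 ≤ y := by rw [hy]; exact_mod_cast hh1
  have hy0 : 0 < y := by linarith
  set s : ℝ := x ^ (1 / (2 * r) : ℝ) with hs
  set U : ℝ := x ^ (3 - 1 / (2 * r) : ℝ) with hU
  set P : ℝ := x ^ (2 - ε₁) with hP
  have hs1 : 1 ≤ s := Real.one_le_rpow hx1 (by positivity)
  have hU0 : 0 < U := Real.rpow_pos_of_pos hx0 _
  have hP0 : 0 < P := Real.rpow_pos_of_pos hx0 _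
  have hyr : y ^ r ≤ x := by rw [hx, hy]; exact_mod_cast hh
  have hy5 : y ^ 5 ≤ x := (pow_le_pow_right₀ hy1 (by omega)).trans hyr
  have hy2 : y ^ 2 ≤ x := (pow_le_pow_right₀ hy1 (by omega)).trans hyr
  have hhalf : 1 / (2 * (r : ℝ)) ≤ 1 / 16 := by
    have : (8 : ℝ) ≤ r := by exact_mod_cast hr
    exact one_div_le_one_div_of_le (by norm_num) (by linarith)
  -- the preprocessing of all repetitions for all groups
  have f1 : x * P * y ^ 7 ≤ U := by
    have h1 : y ^ 7 ≤ x ^ (7 / r : ℝ) := by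
      calc y ^ 7 = (y ^ r) ^ (7 / r : ℝ) := by
            rw [← Real.rpow_natCast y r, ← Real.rpow_mul hy0.le, mul_div_cancel₀ _ hr0.ne',
              ← Real.rpow_natCast y 7]
            norm_num
        _ ≤ x ^ (7 / r : ℝ) := Real.rpow_le_rpow (by positivity) hyr (by positivity)
    calc x * P * y ^ 7 ≤ x * P * x ^ (7 / r : ℝ) := by gcongr
      _ = x ^ (1 + (2 - ε₁) + 7 / r) := by
        rw [Real.rpow_add hx0, Real.rpow_add hx0, Real.rpow_one]
      _ ≤ U := by
        refine Real.rpow_le_rpow_of_exponent_le hx1 ?_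
        have h2 : 8 / (r : ℝ) ≤ ε₁ := by
          rw [div_le_iff₀ hr0]
          exact hrε
        have h3 : (7 : ℝ) / r + 1 / (2 * r) ≤ 8 / r := by
          rw [div_add_div _ _ hr0.ne' (by positivity), div_le_div_iff₀ (by positivity) hr0]
          nlinarith
        linarith
  -- the queries of all repetitions for all groups
  have f2 : x ^ 3 * s ≤ 2 * U * y := by
    have h1 : x ≤ (2 * y) ^ r := by
      have h2 : x ≤ (y + 1) ^ r := by rw [hx, hy]; exact_mod_cast hh'.le
      exact h2.trans (pow_le_pow_left₀ (by linarith) (by linarith) r)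
    have h3 : x ^ (1 / r : ℝ) ≤ 2 * y := by
      calc x ^ (1 / r : ℝ) ≤ ((2 * y) ^ r) ^ (1 / r : ℝ) :=
            Real.rpow_le_rpow hx0.le h1 (by positivity)
        _ = 2 * y := by
          rw [← Real.rpow_natCast (2 * y) r, ← Real.rpow_mul (by positivity),
            mul_one_div_cancel hr0.ne', Real.rpow_one]
    calc x ^ 3 * s = U * x ^ (1 / r : ℝ) := by
          rw [hU, hs, ← Real.rpow_natCast x 3, ← Real.rpow_add hx0, ← Real.rpow_add hx0]
          congr 1
          field_simp
          push_cast
          ring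
      _ ≤ U * (2 * y) := by gcongr
      _ = _ := by ring
  have hxU : x ≤ U := by
    calc x = x ^ (1 : ℝ) := (Real.rpow_one x).symm
      _ ≤ U := Real.rpow_le_rpow_of_exponent_le hx1 (by linarith)
  have hGr : (S.G : ℝ) * y ^ 2 ≤ 2 * x := by
    have h1 : S.G * (h * h) ≤ 2 * S.I.n := by
      have h2 : S.I.n / (h * h) * (h * h) ≤ S.I.n := Nat.div_mul_le_self _ _
      have h3 : h ^ 2 ≤ S.I.n := (Nat.pow_le_pow_right hh1 (by omega)).trans hh
      rw [hG]
      nlinarith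
    have h2 : ((S.G * (h * h) : ℕ) : ℝ) ≤ ((2 * S.I.n : ℕ) : ℝ) := by exact_mod_cast h1
    push_cast at h2
    rw [pow_two]
    exact h2
  have hG0 : (0 : ℝ) ≤ S.G := Nat.cast_nonneg _
  have f3 : S.G * y * (x ^ 2 * s) ≤ 4 * U := by
    refine le_of_mul_le_mul_right ?_ hy0
    calc S.G * y * (x ^ 2 * s) * y = (S.G * y ^ 2) * (x ^ 2 * s) := by ring
      _ ≤ 2 * x * (x ^ 2 * s) := by gcongr
      _ = 2 * (x ^ 3 * s) := by ring
      _ ≤ 2 * (2 * U * y) := by gcongr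
      _ = _ := by ring
  have hx2s : 1 ≤ x ^ 2 * s := by
    have : 1 ≤ x ^ 2 := one_le_pow₀ hx1
    nlinarith
  have hx2s' : x ^ 2 ≤ x ^ 2 * s := le_mul_of_one_le_right (by positivity) hs1
  have hrep : ((S.repTime + 8 : ℕ) : ℝ) ≤ 200 * A₁ * P * y ^ 8 + B * (x ^ 2 * s) := by
    have h1 : x * y ^ 5 ≤ x ^ 2 * s := by
      calc x * y ^ 5 ≤ x * x := by gcongr
        _ = x ^ 2 := by ring
        _ ≤ _ := hx2s'
    have h2 : ((S.repTime + 8 : ℕ) : ℝ) = 200 * S.Tp + 1200 * C₁ * (x * y ^ 5) +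
        x ^ 2 * (200 * S.Tu + 200 * S.Tq + 308) + 708 := by
      rw [Setting.repTime, hM, hg]
      push_cast
      ring
    have h3 : x ^ 2 * (200 * S.Tu + 200 * S.Tq + 308) ≤ x ^ 2 * ((400 * A₂ + 308) * s) := by
      gcongr
      linarith
    have h4 : 1200 * (C₁ : ℝ) * (x * y ^ 5) ≤ 1200 * C₁ * (x ^ 2 * s) := by gcongr
    rw [h2, hB]
    linarith
  have htotal : ((S.G * (S.groupTime + 8) + S.I.n * (8 * r + 50) + 200 : ℕ) : ℝ) =
      S.G * (C₂ * y * ((S.repTime + 8 : ℕ) : ℝ) + 100 * x ^ 2 + 258 * y ^ 2 + 208) +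
        x * (8 * r + 50) + 200 := by
    rw [Setting.groupTime, hR, hg]
    push_cast
    ring
  have g1 : S.G * (C₂ * y * (200 * A₁ * P * y ^ 8)) ≤ 400 * A₁ * C₂ * U := by
    calc S.G * (C₂ * y * (200 * A₁ * P * y ^ 8)) = 200 * A₁ * C₂ * (P * y ^ 7) * (S.G * y ^ 2) := by
          ring
      _ ≤ 200 * A₁ * C₂ * (P * y ^ 7) * (2 * x) := by gcongr
      _ = 400 * A₁ * C₂ * (x * P * y ^ 7) := by ring
      _ ≤ 400 * A₁ * C₂ * U := by gcongr
  have hB0 : 0 ≤ B := by positivity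
  have g2 : S.G * (C₂ * y * (B * (x ^ 2 * s))) ≤ 4 * C₂ * B * U := by
    calc S.G * (C₂ * y * (B * (x ^ 2 * s))) = C₂ * B * (S.G * y * (x ^ 2 * s)) := by ring
      _ ≤ C₂ * B * (4 * U) := by gcongr
      _ = _ := by ring
  have g3 : S.G * (100 * x ^ 2 + 258 * y ^ 2 + 208) ≤ 2264 * U := by
    have h1 : 100 * x ^ 2 + 258 * y ^ 2 + 208 ≤ 566 * (y * (x ^ 2 * s)) := by
      have h2 : x ≤ x ^ 2 := by nlinarith
      have h3 : x ^ 2 * s ≤ y * (x ^ 2 * s) := le_mul_of_one_le_left (by positivity) hy1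
      linarith
    calc S.G * (100 * x ^ 2 + 258 * y ^ 2 + 208) ≤ S.G * (566 * (y * (x ^ 2 * s))) := by gcongr
      _ = 566 * (S.G * y * (x ^ 2 * s)) := by ring
      _ ≤ 566 * (4 * U) := by gcongr
      _ = _ := by ring
  rw [htotal]
  calc _ ≤ S.G * (C₂ * y * (200 * A₁ * P * y ^ 8 + B * (x ^ 2 * s)) + 100 * x ^ 2 + 258 * y ^ 2 +
        208) + x * (8 * r + 50) + 200 := by gcongr
    _ = S.G * (C₂ * y * (200 * A₁ * P * y ^ 8)) + S.G * (C₂ * y * (B * (x ^ 2 * s))) +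
        S.G * (100 * x ^ 2 + 258 * y ^ 2 + 208) + (x * (8 * r + 50) + 200) := by ring
    _ ≤ 400 * A₁ * C₂ * U + 4 * C₂ * B * U + 2264 * U + (8 * r + 250) * U := by
        have h1 : x * (8 * r + 50) ≤ U * (8 * r + 50) := by gcongr
        linarith
    _ = _ := by ring

end ExactTriangle

open WordRAM SlotGraph VertexFailure ExactTriangle

theorem theorem2 (hET : ExactTriangle.Hypothesis) (ε : ℝ) (hε : 0 < ε) :
    ¬ ∃ (O : VertexFailure.Oracle) (tpre : ℕ → ℕ → ℕ → ℕ) (tupd tqry : ℕ → ℕ → ℕ),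
      O.IsConnectivityOracle tpre tupd tqry ∧
      VertexFailure.SubpolynomialTime tupd ∧
      VertexFailure.SubpolynomialTime tqry ∧
      ((∃ C : ℝ, ∀ n m d : ℕ, 1 ≤ d → d ≤ n →
          (tpre n m d : ℝ) ≤ C * ((d : ℝ) ^ (1 - ε) * m + n + m)) ∨
        (∃ C : ℝ, ∀ n m d : ℕ, 1 ≤ d → d ≤ n →
          (tpre n m d : ℝ) ≤ C * (d * (m : ℝ) ^ (1 - ε) + n + m))) := by
  rintro ⟨O, tpre, tupd, tqry, hO, hu, hq, hpre⟩
  classical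
  set ε₁ : ℝ := min ε 1 with hε₁
  have hε₁0 : 0 < ε₁ := lt_min hε one_pos
  obtain ⟨r, hr, hrε⟩ : ∃ r : ℕ, 8 ≤ r ∧ 8 ≤ ε₁ * r := by
    refine ⟨max 8 ⌈8 / ε₁⌉₊, le_max_left _ _, ?_⟩
    have h1 : 8 / ε₁ ≤ ((max 8 ⌈8 / ε₁⌉₊ : ℕ) : ℝ) :=
      (Nat.le_ceil _).trans (by exact_mod_cast le_max_right _ _)
    rw [div_le_iff₀ hε₁0] at h1
    linarith
  have hr0 : (0 : ℝ) < r := by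
    have : 0 < r := by omega
    exact_mod_cast this
  have hδ : (0 : ℝ) < 1 / (2 * r) := by positivity
  obtain ⟨k, hk⟩ := hET (1 / (2 * r)) hδ
  obtain ⟨c, hserves⟩ := serves_of_isConnectivityOracle hO
  obtain ⟨K, hK, hdiv⟩ := exists_card_divisors_le k r
  obtain ⟨Y₁, hY₁⟩ := exists_namesLt O.pre
  obtain ⟨Y₂, hY₂⟩ := exists_namesLt O.upd
  obtain ⟨Y₃, hY₃⟩ := exists_namesLt O.qry
  set Y := Y₁ + Y₂ + Y₃ with hY
  set C₁ := 15 * K with hC₁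
  set C₂ := 2 * (17 * (2 * r + 2)) with hC₂
  have hC₁1 : 1 ≤ C₁ := by omega
  obtain ⟨A₁, hA₁, hT₁⟩ := exists_preprocessing_le hε₁0 (min_le_left _ _) (min_le_right _ _) hpre hC₁1
  obtain ⟨A₂, hA₂, hT₂⟩ := exists_query_le hu hC₁1 hδ
  obtain ⟨A₃, hA₃, hT₃⟩ := exists_query_le hq hC₁1 hδ
  obtain ⟨A, hA, htotal⟩ := exists_total_le hr hrε hA₁
    (add_nonneg hA₂ hA₃) C₁ C₂
  refine hk ⟨triangleProgram O r C₁ C₂, fun n => ⌊A * (n : ℝ) ^ (3 - 1 / (2 * r) : ℝ)⌋₊,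
    ⟨expo C₁ C₂ c k Y * (2 * r + 64), fun n G w hn hw => ?_⟩, A, fun n _ =>
      Nat.floor_le (by positivity)⟩
  obtain ⟨h, hh1, hh, hh'⟩ := exists_root (r := r) (by omega) hn
  have hhn : h ≤ n := (Nat.le_self_pow (by omega) h).trans hh
  set I := Inst.ofGraph G w with hI
  have hIn : I.n = n := rfl
  set S : Setting := Setting.ofRoot hserves I (C₁ := C₁) (C₂ := C₂) (k := k) (Y := Y)
    (D := 2 * r + 64) (h := h) (Tp := ⌊A₁ * ((n : ℝ) ^ (2 - ε₁) * h ^ 8)⌋₊)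
    (Tu := ⌊A₂ * (n : ℝ) ^ (1 / (2 * r) : ℝ)⌋₊) (Tq := ⌊A₃ * (n : ℝ) ^ (1 / (2 * r) : ℝ)⌋₊) hn hC₁1
    (by omega) hh1 hhn ⟨hY₁.mono (by omega), hY₂.mono (by omega), hY₃.mono (by omega)⟩
    (fun q _ hq' => ⟨Nat.le_floor (hT₁ n h q hn hh1 hq'), Nat.le_floor (hT₂ n h q hn hh1 hhn hq'),
      Nat.le_floor (hT₃ n h q hn hh1 hhn hq')⟩) with hS
  have hrel : S.Reliable k (K * h) (17 * (2 * r + 2) * h) := by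
    refine ⟨adj_ofGraph_le, pos_ofGraph_le hw, neg_ofGraph_le hw,
      fun W hW hW' => hdiv n h W hh1 hh' hW hW', ?_, ?_, rfl, decay_le hh1 hh' le_rfl⟩
    · change 15 * (h * h * (K * h)) ≤ 15 * K * h * h * h
      exact le_of_eq (by ring)
    · change C₂ * h = 2 * (17 * (2 * r + 2) * h)
      rw [hC₂]
      ring
  have hX : ∀ {a b v : ℕ}, v ≤ a * (n + 2) ^ b → a + b ≤ expo C₁ C₂ c k Y → v < S.X :=
    fun hv hab => lt_pow_expo hv hab
  have hwp := Setting.wp_triangleProgram hrel (r := r) (C₁ := C₁) (C₂ := C₂) (h := h) (by omega)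
    (show 2 * r + 8 ≤ 2 * r + 64 by omega)
    (hX (a := C₁) (b := 0) (by simp) (by simp only [expo]; omega))
    (hX (a := C₂) (b := 0) (by simp) (by simp only [expo]; omega)) hh hh' rfl rfl rfl
    (hX (a := 1) (b := 1) (show n + 1 ≤ _ by rw [pow_one]; omega) (by simp only [expo]; omega))
    (σ := input G w) (fun _ => rfl) rfl rfl rfl (fun a ha i => by
      simp only [input]
      rw [if_neg (by omega), if_neg (by omega), if_neg (by omega)])
  have hsmall : (A₂ + A₃) * (n : ℝ) ^ (1 / (2 * r) : ℝ) =
      A₂ * (n : ℝ) ^ (1 / (2 * r) : ℝ) + A₃ * (n : ℝ) ^ (1 / (2 * r) : ℝ) := add_mul _ _ _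
  have hpow : (0 : ℝ) ≤ (n : ℝ) ^ (1 / (2 * r) : ℝ) := by positivity
  have htime : S.G * (S.groupTime + 8) + S.I.n * (8 * r + 50) + 200 ≤
      ⌊A * (n : ℝ) ^ (3 - 1 / (2 * r) : ℝ)⌋₊ := by
    refine Nat.le_floor (htotal S h hh1 hh hh' rfl rfl rfl rfl ?_ ?_ ?_)
    · exact Nat.floor_le (by positivity)
    · refine (Nat.floor_le (by positivity)).trans ?_
      change _ ≤ (A₂ + A₃) * (n : ℝ) ^ (1 / (2 * r) : ℝ)
      nlinarith
    · refine (Nat.floor_le (by positivity)).trans ?_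
      change _ ≤ (A₂ + A₃) * (n : ℝ) ^ (1 / (2 * r) : ℝ)
      nlinarith
  have hbound : (input G w).Bounded S.X := input_bounded hw
    (hX (a := 1) (b := 0) (by simp) (by simp only [expo]; omega))
    (hX (a := 1) (b := 1) (by rw [pow_one]; omega) (by simp only [expo]; omega))
    (hX (a := 1) (b := k) (by
      rw [one_mul]
      exact Nat.pow_le_pow_left (by omega) k) (by simp only [expo]; omega))
  have hfinal := solves_of_wp (S := S) rfl htime hbound hwp
  have hSB : S.B = (n + 2) ^ (expo C₁ C₂ c k Y * (2 * r + 64)) := (pow_mul _ _ _).symm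
  rw [hSB] at hfinal
  exact hfinal
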